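/- Let $\mathcal M\subseteq\mathcal B(H)$ be a von Neumann algebra with a normal semifinite faithful trace $\tau$, and let $\mathcal T=(T_t)_{t\ge0}$ be a Markovian semigroup on $(\mathcal M,\tau)$: $T_0=\mathrm{id}$, $T_{s+t}=T_sT_t$, each $T_t:\mathcal M\to\mathcal M$ is linear, unital, completely positive, $\tau$-preserving on $\mathcal M_+$, weak-$*$ continuous and self-adjoint ($\tau(f^*\,T_tg)=\tau((T_tf)^*g)$ for $f,g\in\mathcal M\cap L^2(\mathcal M)$), and $t\mapsto T_tf$ is weak-$*$ continuous on $[0,\infty)$ for every $f\in\mathcal M$. Write $T_t=e^{-tA}$, where $Af=\mathrm{w}^*\text{-}\lim_{t\to0^+}(f-T_tf)/t$, and let $P_s=e^{-sA^{1/2}}$ be the subordinated Poisson semigroup, i.e. $P_0=\mathrm{id}$ and, for $s>0$, $$P_sf=\frac1{2\sqrt\pi}\int_0^\infty s\,e^{-s^2/(4v)}\,v^{-3/2}\,T_vf\,dv ;$$ $A^{1/2}$ is its weak-$*$ generator. Put $|f|^2=f^*f$ and let $\|\cdot\|_\infty$ be the norm of $\mathcal M$. For $0<\alpha<1$ and $f\in\mathcal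 M$ define, with values in $[0,\infty]$, $$\|f\|_{\Lambda_\alpha^\circ}=\sup_{s>0}s^{1-\alpha}\Big\|\frac{d}{ds}P_sf\Big\|_\infty,\quad \|f\|_{\mathcal L\mathrm{ip}_\alpha^c}=\sup_{s>0}s^{-\alpha}\big\|P_s|f-P_sf|^2\big\|_\infty^{1/2},\quad \|f\|_{\ell\mathrm{ip}_\alpha^c}=\sup_{s>0}s^{-\alpha}\big\|P_s|f|^2-|P_sf|^2\big\|_\infty^{1/2},$$ and for $X\in\{\mathcal L\mathrm{ip},\ell\mathrm{ip}\}$ the row version $\|f\|_{X_\alpha^r}=\|f^*\|_{X_\alpha^c}$ and the symmetric version $\|f\|_{X_\alpha^{r\wedge c}}=\max\{\|f\|_{X_\alpha^c},\|f\|_{X_\alpha^r}\}$. A test algebra for $\mathcal T$ is a weak-$*$ dense $*$-subalgebra $\mathcal S\subseteq\mathcal M\cap L^1(\mathcal M)$, contained in the domain of $A^{1/2}$, with $A^{1/2}[\mathcal S]\subseteq\mathcal S$ and $T_t[\mathcal S]\subseteq\mathcal S$, $P_s[\mathcal S]\subseteq\mathcal S$ for all $s,t>0$. On $\mathcal S$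 put $$2\,\Gamma(f,g)=(Af)^*g+f^*(Ag)-A(f^*g),\qquad 2\,\Gamma^2(f,g)=\Gamma(Af,g)+\Gamma(f,Ag)-A\,\Gamma(f,g).$$ The semigroup has the property $\Gamma^2\ge0$ (relative to $\mathcal S$) if $\Gamma^2(f,f)\ge0$ for all $f\in\mathcal S$. Then: (i) For every $0<\alpha<1$ there is a constant $C_\alpha<\infty$ depending only on $\alpha$ such that, for all $(\mathcal M,\tau)$ and $\mathcal T$ as above, every $f\in\mathcal M$ and every $\dagger\in\{r,c,r\wedge c\}$, $$\|f\|_{\mathcal L\mathrm{ip}_\alpha^\dagger}\le C_\alpha\,\|f\|_{\Lambda_\alpha^\circ}.$$ (ii) For every $0<\alpha<1/2$ there is a constant $C'_\alpha<\infty$ depending only on $\alpha$ such that, for all $(\mathcal M,\tau)$ and $\mathcal T$ as above for which there is a test algebra $\mathcal S$ relative to which $\mathcal T$ has the property $\Gamma^2\ge0$, every $f\in\mathcal M$ and every $\dagger\in\{r,c,r\wedge c\}$, $$\|f\|_{\ell\mathrm{ip}_\alpha^\dagger}\le C'_\alpha\,\|f\|_{\Lambda_\alpha^\circ}.$$ 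-/

import Mathlib

open Set Filter Topology MeasureTheory
open scoped ENNReal NNReal ComplexOrder InnerProductSpace

noncomputable section

namespace SemigroupHolder

/-! ### Von Neumann algebras, their weak-* topology, and traces -/

section Basic

variable {H : Type*} [NormedAddCommGroup H] [InnerProductSpace ℂ H] [CompleteSpace H]

/-- The elements of a von Neumann algebra `M ⊆ B(H)`, with the algebraic operations, the order and
the operator norm inherited from `B(H)`. -/
abbrev Elem (M : VonNeumannAlgebra H) : Type _ := M.toStarSubalgebra

/-- The normal functional `f ↦ ∑ₙ ⟪ξₙ, f ηₙ⟫` given by two square-summable sequences of vectors.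
These functionals are exactly the elements of the predual of `M`. -/
def normalFunctional (M : VonNeumannAlgebra H) (ξ η : lp (fun _ : ℕ => H) 2) (f : Elem M) : ℂ :=
  ∑' n, ⟪ξ n, (f : H →L[ℂ] H) (η n)⟫_ℂ

/-- The weak-* (ultraweak) topology of a von Neumann algebra: the coarsest topology making all
the elements of the predual continuous. -/
abbrev weakStar (M : VonNeumannAlgebra H) : TopologicalSpace (Elem M) :=
  ⨅ (ξ : lp (fun _ : ℕ => H) 2) (η : lp (fun _ : ℕ => H) 2),
    TopologicalSpace.induced (normalFunctional M ξ η) inferInstance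

/-- Positivity in `M_m[M] ⊆ B(H^m)`: the matrix `F` acts on `H^m` as a positive operator. -/
def IsPosMatrix {M : VonNeumannAlgebra H} {m : ℕ} (F : Matrix (Fin m) (Fin m) (Elem M)) : Prop :=
  ∀ ξ : Fin m → H, 0 ≤ ∑ i, ∑ j, ⟪ξ i, (F i j : H →L[ℂ] H) (ξ j)⟫_ℂ

/-- A normal semifinite faithful trace `τ : M₊ → [0, ∞]`. Only the values of `toFun` on the
positive cone are meaningful. -/
structure NSFTrace (M : VonNeumannAlgebra H) where
  toFun : Elem M → ℝ≥0∞
  map_add : ∀ f g : Elem M, 0 ≤ f → 0 ≤ g → toFun (f + g) = toFun f + toFun g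
  map_smul : ∀ (c : ℝ≥0) (f : Elem M), 0 ≤ f → toFun (((c : ℝ) : ℂ) • f) = c * toFun f
  unitary_conj : ∀ u ∈ unitary (Elem M), ∀ f : Elem M, 0 ≤ f →
    toFun (u * f * star u) = toFun f
  normal : ∀ (D : Set (Elem M)) (f : Elem M), D.Nonempty → DirectedOn (· ≤ ·) D →
    (∀ d ∈ D, 0 ≤ d) → IsLUB D f → toFun f = ⨆ d ∈ D, toFun d
  semifinite : ∀ f : Elem M, 0 ≤ f → toFun f = ∞ →
    ∃ g : Elem M, 0 ≤ g ∧ g ≤ f ∧ g ≠ 0 ∧ toFun g < ∞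
  faithful : ∀ f : Elem M, 0 ≤ f → toFun f = 0 → f = 0

variable {M : VonNeumannAlgebra H}

/-- `z` is the value at `f` of the linear extension of `τ` to the span of the positive elements of
finite trace. -/
def NSFTrace.HasTrace (τ : NSFTrace M) (f : Elem M) (z : ℂ) : Prop :=
  ∃ a b c d : Elem M, 0 ≤ a ∧ 0 ≤ b ∧ 0 ≤ c ∧ 0 ≤ d ∧
    τ.toFun a < ∞ ∧ τ.toFun b < ∞ ∧ τ.toFun c < ∞ ∧ τ.toFun d < ∞ ∧
    f = (a - b) + Complex.I • (c - d) ∧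
    z = (((τ.toFun a).toReal - (τ.toFun b).toReal : ℝ) : ℂ) +
      Complex.I * (((τ.toFun c).toReal - (τ.toFun d).toReal : ℝ) : ℂ)

open Classical in
/-- The linear extension of `τ` to the span of the positive elements of finite trace
(and `0` outside of that span). -/
def NSFTrace.ext (τ : NSFTrace M) (f : Elem M) : ℂ :=
  if h : ∃ z, τ.HasTrace f z then h.choose else 0

/-- `f ∈ M ∩ L²(M)`, i.e. `τ(|f|²) < ∞`. -/
def NSFTrace.MemL2 (τ : NSFTrace M) (f : Elem M) : Prop := τ.toFun (star f * f) < ∞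

/-- `f ∈ M ∩ L¹(M)`, i.e. `τ(|f|) < ∞`, where `|f|` is the positive square root of `f* f`. -/
def NSFTrace.MemL1 (τ : NSFTrace M) (f : Elem M) : Prop :=
  ∃ a : Elem M, 0 ≤ a ∧ a * a = star f * f ∧ τ.toFun a < ∞

/-! ### Markovian semigroups -/

/-- Markovian operators: unital completely positive, trace preserving, weak-* continuous and
self-adjoint with respect to the trace. -/
structure IsMarkovian (τ : NSFTrace M) (T : Elem M →ₗ[ℂ] Elem M) : Prop where
  map_one : T 1 = 1
  completelyPositive : ∀ (m : ℕ) (F : Matrix (Fin m) (Fin m) (Elem M)),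
    IsPosMatrix F → IsPosMatrix (F.map T)
  trace_preserving : ∀ f : Elem M, 0 ≤ f → τ.toFun (T f) = τ.toFun f
  weakStar_continuous : @Continuous _ _ (weakStar M) (weakStar M) T
  self_adjoint : ∀ f g : Elem M, τ.MemL2 f → τ.MemL2 g →
    τ.ext (star f * T g) = τ.ext (star (T f) * g)

/-- A Markovian semigroup `(T_t)_{t ≥ 0}` on `(M, τ)`. The values for `t < 0` are irrelevant. -/
structure MarkovSemigroup (τ : NSFTrace M) where
  op : ℝ → Elem M →ₗ[ℂ] Elem M
  op_zero : op 0 = LinearMap.id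
  op_add : ∀ s t : ℝ, 0 ≤ s → 0 ≤ t → op (s + t) = op s ∘ₗ op t
  markovian : ∀ t : ℝ, 0 ≤ t → IsMarkovian τ (op t)
  weakStar_continuousOn : ∀ f : Elem M,
    @ContinuousOn ℝ (Elem M) _ (weakStar M) (fun t => op t f) (Ici 0)

end Basic

/-! ### The subordinated Poisson semigroup -/

/-- The density `φ_s(v) = (2√π)⁻¹ s e^{-s²/(4v)} v^{-3/2}` of the subordination formula,
characterised by `e^{-s√r} = ∫₀^∞ φ_s(v) e^{-vr} dv`. -/
def subordinator (s v : ℝ) : ℝ :=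
  1 / (2 * √Real.pi) * (s * Real.exp (-s ^ 2 / (4 * v)) * v ^ (-(3 / 2) : ℝ))

section Facts

variable {H : Type*} [NormedAddCommGroup H] [InnerProductSpace ℂ H] [CompleteSpace H]
  {M : VonNeumannAlgebra H} {τ : NSFTrace M}

theorem subordinator_continuousOn (s : ℝ) : ContinuousOn (subordinator s) (Ioi 0) := by
  intro v hv
  have hv' : (0 : ℝ) < v := hv
  apply ContinuousAt.continuousWithinAt
  unfold subordinator
  have h1 : ContinuousAt (fun v : ℝ => v ^ (-(3 / 2) : ℝ)) v :=
    Real.continuousAt_rpow_const _ _ (Or.inl hv'.ne')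
  have h2 : ContinuousAt (fun v : ℝ => -s ^ 2 / (4 * v)) v :=
    ContinuousAt.div (by fun_prop) (by fun_prop) (by positivity)
  exact continuousAt_const.mul ((continuousAt_const.mul h2.rexp).mul h1)

theorem subordinator_integrableOn {s : ℝ} (hs : 0 < s) :
    IntegrableOn (subordinator s) (Ioi 0) := by
  have hmeas : ∀ t ⊆ Ioi (0 : ℝ), MeasurableSet t →
      AEStronglyMeasurable (subordinator s) (volume.restrict t) := fun t ht hm =>
    ((subordinator_continuousOn s).mono ht).aestronglyMeasurable hm
  rw [← Ioc_union_Ioi_eq_Ioi (zero_le_one (α := ℝ))]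
  refine IntegrableOn.union ?_ ?_
  · have h := (intervalIntegral.intervalIntegrable_rpow' (a := 0) (b := 1)
      (r := -(1 / 2)) (by norm_num)).1
    refine Integrable.mono' (h.const_mul (1 / (2 * √Real.pi) * (4 / s)))
      (hmeas _ Ioc_subset_Ioi_self measurableSet_Ioc) ?_
    filter_upwards [ae_restrict_mem measurableSet_Ioc] with v hv
    have hv0 : 0 < v := hv.1
    have hexp : Real.exp (-s ^ 2 / (4 * v)) ≤ 4 * v / s ^ 2 := by
      have h1 := Real.add_one_le_exp (s ^ 2 / (4 * v))
      have h2 : s ^ 2 / (4 * v) ≤ Real.exp (s ^ 2 / (4 * v)) := by linarith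
      have h3 : (0 : ℝ) < s ^ 2 / (4 * v) := by positivity
      rw [neg_div, Real.exp_neg]
      calc (Real.exp (s ^ 2 / (4 * v)))⁻¹ ≤ (s ^ 2 / (4 * v))⁻¹ := inv_anti₀ h3 h2
        _ = 4 * v / s ^ 2 := inv_div _ _
    have hpow : v * v ^ (-(3 / 2) : ℝ) = v ^ (-(1 / 2) : ℝ) := by
      rw [← Real.rpow_one_add' hv0.le (by norm_num)]
      norm_num
    have hnn : 0 ≤ subordinator s v := by unfold subordinator; positivity
    rw [Real.norm_of_nonneg hnn]
    unfold subordinator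
    rw [mul_assoc (1 / (2 * √Real.pi)) (4 / s)]
    refine mul_le_mul_of_nonneg_left ?_ (by positivity)
    calc s * Real.exp (-s ^ 2 / (4 * v)) * v ^ (-(3 / 2) : ℝ)
        ≤ s * (4 * v / s ^ 2) * v ^ (-(3 / 2) : ℝ) := by gcongr
      _ = 4 / s * (v * v ^ (-(3 / 2) : ℝ)) := by field_simp
      _ = 4 / s * v ^ (-(1 / 2) : ℝ) := by rw [hpow]
  · have h := integrableOn_Ioi_rpow_of_lt (a := -(3 / 2)) (c := 1) (by norm_num) one_pos
    refine Integrable.mono' (h.const_mul (1 / (2 * √Real.pi) * s))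
      (hmeas _ (Ioi_subset_Ioi zero_le_one) measurableSet_Ioi) ?_
    filter_upwards [ae_restrict_mem measurableSet_Ioi] with v hv
    have hv0 : 0 < v := lt_trans one_pos hv
    have hexp : Real.exp (-s ^ 2 / (4 * v)) ≤ 1 := by
      rw [Real.exp_le_one_iff, neg_div]
      have : 0 ≤ s ^ 2 / (4 * v) := by positivity
      linarith
    have hnn : 0 ≤ subordinator s v := by unfold subordinator; positivity
    rw [Real.norm_of_nonneg hnn]
    unfold subordinator
    rw [mul_assoc (1 / (2 * √Real.pi)) s]
    gcongr
    calc s * Real.exp (-s ^ 2 / (4 * v)) ≤ s * 1 := by gcongr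
      _ = s := mul_one s

theorem norm_le_of_inner_le {H : Type*} [NormedAddCommGroup H] [InnerProductSpace ℂ H]
    {A : H →L[ℂ] H} {c : ℝ} (hc : 0 ≤ c)
    (h : ∀ ξ η : H, 2 * ‖⟪ξ, A η⟫_ℂ‖ ≤ c * (‖ξ‖ ^ 2 + ‖η‖ ^ 2)) : ‖A‖ ≤ c := by
  refine A.opNorm_le_bound hc fun η => ?_
  by_cases hA : A η = 0
  · rw [hA, norm_zero]; positivity
  have hη : η ≠ 0 := by rintro rfl; simp at hA
  have h0 : 0 < ‖A η‖ := norm_pos_iff.mpr hA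
  have h1 : 0 < ‖η‖ := norm_pos_iff.mpr hη
  have key := h (((‖η‖ / ‖A η‖ : ℝ) : ℂ) • A η) η
  have e1 : ‖(((‖η‖ / ‖A η‖ : ℝ) : ℂ) • A η)‖ = ‖η‖ := by
    rw [norm_smul, Complex.norm_real, Real.norm_of_nonneg (by positivity)]
    field_simp
  have e2 : ‖⟪(((‖η‖ / ‖A η‖ : ℝ) : ℂ) • A η), A η⟫_ℂ‖ = ‖η‖ * ‖A η‖ := by
    rw [inner_smul_left, norm_mul, inner_self_eq_norm_sq_to_K]
    simp only [Complex.conj_ofReal, Complex.norm_real, norm_pow, norm_norm, Complex.coe_algebraMap]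
    rw [Real.norm_of_nonneg (by positivity)]
    field_simp
  rw [e1, e2] at key
  nlinarith

theorem IsMarkovian.norm_le {T : Elem M →ₗ[ℂ] Elem M} (hT : IsMarkovian τ T) (f : Elem M) :
    ‖(T f : H →L[ℂ] H)‖ ≤ ‖(f : H →L[ℂ] H)‖ := by
  set c : ℝ := ‖(f : H →L[ℂ] H)‖ with hc
  have hc0 : 0 ≤ c := norm_nonneg _
  let F : Matrix (Fin 2) (Fin 2) (Elem M) := !![(c : ℂ) • 1, f; star f, (c : ℂ) • 1]
  have hF : IsPosMatrix F := by
    intro ξ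
    have e : ∑ i, ∑ j, ⟪ξ i, (F i j : H →L[ℂ] H) (ξ j)⟫_ℂ =
        ((c * (‖ξ 0‖ ^ 2 + ‖ξ 1‖ ^ 2) + 2 * (⟪ξ 0, (f : H →L[ℂ] H) (ξ 1)⟫_ℂ).re : ℝ) : ℂ) := by
      have e1 : ⟪ξ 1, ((star f : Elem M) : H →L[ℂ] H) (ξ 0)⟫_ℂ =
          starRingEnd ℂ ⟪ξ 0, (f : H →L[ℂ] H) (ξ 1)⟫_ℂ := by
        change ⟪ξ 1, ContinuousLinearMap.adjoint (f : H →L[ℂ] H) (ξ 0)⟫_ℂ = _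
        rw [ContinuousLinearMap.adjoint_inner_right, inner_conj_symm]
      have e2 : ∀ x : H, ⟪x, (((c : ℂ) • (1 : Elem M) : Elem M) : H →L[ℂ] H) x⟫_ℂ =
          ((c * ‖x‖ ^ 2 : ℝ) : ℂ) := by
        intro x
        change ⟪x, (c : ℂ) • x⟫_ℂ = _
        rw [inner_smul_right, inner_self_eq_norm_sq_to_K]
        simp
      simp only [Fin.sum_univ_two]
      change ⟪ξ 0, (((c : ℂ) • (1 : Elem M) : Elem M) : H →L[ℂ] H) (ξ 0)⟫_ℂ +
        ⟪ξ 0, (f : H →L[ℂ] H) (ξ 1)⟫_ℂ + (⟪ξ 1, ((star f : Elem M) : H →L[ℂ] H) (ξ 0)⟫_ℂ +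
        ⟪ξ 1, (((c : ℂ) • (1 : Elem M) : Elem M) : H →L[ℂ] H) (ξ 1)⟫_ℂ) = _
      rw [e1, e2, e2]
      have := Complex.add_conj ⟪ξ 0, (f : H →L[ℂ] H) (ξ 1)⟫_ℂ
      push_cast at this ⊢
      linear_combination this
    rw [e, Complex.zero_le_real]
    have h1 : ‖⟪ξ 0, (f : H →L[ℂ] H) (ξ 1)⟫_ℂ‖ ≤ ‖ξ 0‖ * (c * ‖ξ 1‖) :=
      (norm_inner_le_norm _ _).trans
        (mul_le_mul_of_nonneg_left (ContinuousLinearMap.le_opNorm _ _) (norm_nonneg _))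
    have h2 := (abs_le.mp (Complex.abs_re_le_norm ⟪ξ 0, (f : H →L[ℂ] H) (ξ 1)⟫_ℂ)).1
    nlinarith [mul_nonneg hc0 (sq_nonneg (‖ξ 0‖ - ‖ξ 1‖))]
  have hTF := hT.completelyPositive 2 F hF
  have key : ∀ ξ η : H, 0 ≤ (((c * (‖ξ‖ ^ 2 + ‖η‖ ^ 2) : ℝ) : ℂ) +
      (⟪ξ, (T f : H →L[ℂ] H) η⟫_ℂ + ⟪η, (T (star f) : H →L[ℂ] H) ξ⟫_ℂ)) := by
    intro ξ η
    have h := hTF ![ξ, η]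
    have e2 : ∀ x : H, ⟪x, (T ((c : ℂ) • (1 : Elem M)) : H →L[ℂ] H) x⟫_ℂ =
        ((c * ‖x‖ ^ 2 : ℝ) : ℂ) := by
      intro x
      rw [map_smul, hT.map_one]
      change ⟪x, (c : ℂ) • x⟫_ℂ = _
      rw [inner_smul_right, inner_self_eq_norm_sq_to_K]
      simp
    simp only [Fin.sum_univ_two] at h
    change 0 ≤ ⟪ξ, (T ((c : ℂ) • (1 : Elem M)) : H →L[ℂ] H) ξ⟫_ℂ +
      ⟪ξ, (T f : H →L[ℂ] H) η⟫_ℂ + (⟪η, (T (star f) : H →L[ℂ] H) ξ⟫_ℂ +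
      ⟪η, (T ((c : ℂ) • (1 : Elem M)) : H →L[ℂ] H) η⟫_ℂ) at h
    rw [e2, e2] at h
    convert h using 1
    push_cast
    ring
  refine norm_le_of_inner_le hc0 fun ξ η => ?_
  set a := ⟪ξ, (T f : H →L[ℂ] H) η⟫_ℂ with ha
  set b := ⟪η, (T (star f) : H →L[ℂ] H) ξ⟫_ℂ with hb
  have key2 : ∀ z : ℂ, ‖z‖ = 1 → 0 ≤ (((c * (‖ξ‖ ^ 2 + ‖η‖ ^ 2) : ℝ) : ℂ) +
      (z * a + starRingEnd ℂ z * b)) := by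
    intro z hz
    have h := key ξ (z • η)
    rw [norm_smul, hz, one_mul, map_smul, inner_smul_right, inner_smul_left] at h
    exact h
  have him : ∀ z : ℂ, ‖z‖ = 1 → (z * a + starRingEnd ℂ z * b).im = 0 := by
    intro z hz
    have h := (Complex.le_def.mp (key2 z hz)).2
    rw [Complex.add_im, Complex.ofReal_im, zero_add] at h
    exact h.symm
  have hre := fun z hz => (Complex.le_def.mp (key2 z hz)).1
  have i1 := him 1 (by simp)
  have i2 := him Complex.I (by simp)
  have hb' : b = starRingEnd ℂ a := by
    simp at i1 i2
    apply Complex.ext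
    · simp; linarith
    · simp; linarith
  by_cases ha0 : a = 0
  · rw [ha0, norm_zero, mul_zero]; positivity
  have hn : (‖a‖ : ℂ) ≠ 0 := by simpa using ha0
  have i3 := hre (-(starRingEnd ℂ a / ‖a‖)) (by
    rw [norm_neg, norm_div, RCLike.norm_conj, Complex.norm_real, norm_norm]
    exact div_self (by simpa using ha0))
  have e3 : -(starRingEnd ℂ a / ‖a‖) * a + starRingEnd ℂ (-(starRingEnd ℂ a / ‖a‖)) * b =
      ((-(2 * ‖a‖) : ℝ) : ℂ) := by
    have := Complex.conj_mul' a
    rw [hb']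
    simp only [map_neg, map_div₀, Complex.conj_conj, Complex.conj_ofReal]
    push_cast
    field_simp
    linear_combination (-2) * this
  rw [e3, ← Complex.ofReal_add, Complex.ofReal_re, Complex.zero_re] at i3
  linarith

theorem MarkovSemigroup.continuousOn_inner (T : MarkovSemigroup τ) (f : Elem M) (ξ η : H) :
    ContinuousOn (fun t : ℝ => ⟪ξ, (T.op t f : H →L[ℂ] H) η⟫_ℂ) (Ici 0) := by
  have h := T.weakStar_continuousOn f
  have hc : @Continuous _ _ (weakStar M) _
      (normalFunctional M (lp.single 2 0 ξ) (lp.single 2 0 η)) :=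
    continuous_iff_le_induced.mpr (iInf₂_le _ _)
  have := @Continuous.comp_continuousOn _ _ _ _ (weakStar M) _ _ _ _ hc h
  refine this.congr fun t _ => ?_
  simp only [Function.comp, normalFunctional]
  rw [tsum_eq_single 0]
  · simp
  · intro n hn
    simp [lp.single_apply, hn]

theorem MarkovSemigroup.exists_poisson (T : MarkovSemigroup τ) {s : ℝ} (hs : 0 < s) (f : Elem M) :
    ∃ g : Elem M, ∀ ξ η : H, ⟪ξ, (g : H →L[ℂ] H) η⟫_ℂ =
      ∫ v in Ioi (0 : ℝ), (subordinator s v : ℂ) * ⟪ξ, (T.op v f : H →L[ℂ] H) η⟫_ℂ := by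
  have hbd : ∀ v ∈ Ioi (0 : ℝ), ∀ ξ η : H,
      ‖⟪ξ, (T.op v f : H →L[ℂ] H) η⟫_ℂ‖ ≤ ‖(f : H →L[ℂ] H)‖ * ‖ξ‖ * ‖η‖ := by
    intro v hv ξ η
    calc ‖⟪ξ, (T.op v f : H →L[ℂ] H) η⟫_ℂ‖ ≤ ‖ξ‖ * ‖(T.op v f : H →L[ℂ] H) η‖ :=
          norm_inner_le_norm _ _
      _ ≤ ‖ξ‖ * (‖(T.op v f : H →L[ℂ] H)‖ * ‖η‖) := by
          gcongr; exact ContinuousLinearMap.le_opNorm _ _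
      _ ≤ ‖ξ‖ * (‖(f : H →L[ℂ] H)‖ * ‖η‖) := by
          gcongr; exact (T.markovian v (le_of_lt hv)).norm_le f
      _ = _ := by ring
  have hφ := subordinator_integrableOn hs
  have hint : ∀ ξ η : H, IntegrableOn
      (fun v => (subordinator s v : ℂ) * ⟪ξ, (T.op v f : H →L[ℂ] H) η⟫_ℂ) (Ioi 0) := by
    intro ξ η
    refine Integrable.mul_bdd (c := ‖(f : H →L[ℂ] H)‖ * ‖ξ‖ * ‖η‖) hφ.ofReal ?_ ?_
    · exact ((T.continuousOn_inner f ξ η).mono Ioi_subset_Ici_self).aestronglyMeasurable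
        measurableSet_Ioi
    · filter_upwards [ae_restrict_mem measurableSet_Ioi] with v hv using hbd v hv ξ η
  let K : ℝ := ∫ v in Ioi (0 : ℝ), ‖subordinator s v‖
  let B₀ : H →ₗ⋆[ℂ] H →ₗ[ℂ] ℂ := LinearMap.mk₂'ₛₗ (starRingEnd ℂ) (RingHom.id ℂ)
    (fun ξ η => ∫ v in Ioi (0 : ℝ), (subordinator s v : ℂ) * ⟪ξ, (T.op v f : H →L[ℂ] H) η⟫_ℂ)
    (by
      intro ξ ξ' η
      rw [← integral_add (hint ξ η) (hint ξ' η)]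
      simp only [inner_add_left, mul_add])
    (by
      intro c ξ η
      rw [smul_eq_mul, ← integral_const_mul]
      congr 1; ext v
      rw [inner_smul_left]; ring)
    (by
      intro ξ η η'
      rw [← integral_add (hint ξ η) (hint ξ η')]
      simp only [map_add, inner_add_right, mul_add])
    (by
      intro c ξ η
      rw [RingHom.id_apply, smul_eq_mul, ← integral_const_mul]
      congr 1; ext v
      rw [map_smul, inner_smul_right]; ring)
  have hB : ∀ ξ η, ‖B₀ ξ η‖ ≤ K * ‖(f : H →L[ℂ] H)‖ * ‖ξ‖ * ‖η‖ := by
    intro ξ η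
    change ‖∫ v in Ioi (0 : ℝ), (subordinator s v : ℂ) * ⟪ξ, (T.op v f : H →L[ℂ] H) η⟫_ℂ‖ ≤ _
    calc _ ≤ ∫ v in Ioi (0 : ℝ), ‖subordinator s v‖ * (‖(f : H →L[ℂ] H)‖ * ‖ξ‖ * ‖η‖) := by
          refine norm_integral_le_of_norm_le (hφ.norm.mul_const _) ?_
          filter_upwards [ae_restrict_mem measurableSet_Ioi] with v hv
          rw [norm_mul, Complex.norm_real]
          exact mul_le_mul_of_nonneg_left (hbd v hv ξ η) (norm_nonneg _)
      _ = _ := by rw [integral_mul_const]; ring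
  let B : H →L⋆[ℂ] H →L[ℂ] ℂ := LinearMap.mkContinuous₂ B₀ _ hB
  let g₀ : H →L[ℂ] H :=
    ContinuousLinearMap.adjoint (InnerProductSpace.continuousLinearMapOfBilin (𝕜 := ℂ) B)
  have hg : ∀ ξ η : H, ⟪ξ, g₀ η⟫_ℂ =
      ∫ v in Ioi (0 : ℝ), (subordinator s v : ℂ) * ⟪ξ, (T.op v f : H →L[ℂ] H) η⟫_ℂ := by
    intro ξ η
    rw [ContinuousLinearMap.adjoint_inner_right,
      InnerProductSpace.continuousLinearMapOfBilin_apply]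
    rfl
  have hmem : g₀ ∈ M := by
    rw [← M.commutant_commutant, VonNeumannAlgebra.mem_commutant_iff]
    intro a ha
    rw [VonNeumannAlgebra.mem_commutant_iff] at ha
    refine ContinuousLinearMap.ext fun η => ext_inner_left ℂ fun ξ => ?_
    change ⟪ξ, a (g₀ η)⟫_ℂ = ⟪ξ, g₀ (a η)⟫_ℂ
    rw [← ContinuousLinearMap.adjoint_inner_left, hg, hg]
    congr 1; ext v
    rw [ContinuousLinearMap.adjoint_inner_left]
    have := congrArg (fun L : H →L[ℂ] H => L η) (ha _ (T.op v f).2)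
    change (T.op v f : H →L[ℂ] H) (a η) = a ((T.op v f : H →L[ℂ] H) η) at this
    rw [this]
  exact ⟨⟨g₀, hmem⟩, hg⟩

end Facts

namespace MarkovSemigroup

variable {H : Type*} [NormedAddCommGroup H] [InnerProductSpace ℂ H] [CompleteSpace H]
  {M : VonNeumannAlgebra H} {τ : NSFTrace M}

/-- The Poisson semigroup `P_s = e^{-s A^{1/2}}` subordinated to `T_t = e^{-t A}`:
`P_0 f = f` and, for `s > 0`, `P_s f = ∫₀^∞ φ_s(v) T_v f dv` (as a weak integral). -/
def poisson (T : MarkovSemigroup τ) (s : ℝ) (f : Elem M) : Elem M :=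
  if hs : 0 < s then (T.exists_poisson hs f).choose else f

theorem inner_poisson (T : MarkovSemigroup τ) {s : ℝ} (hs : 0 < s) (f : Elem M) (ξ η : H) :
    ⟪ξ, (T.poisson s f : H →L[ℂ] H) η⟫_ℂ =
      ∫ v in Ioi (0 : ℝ), (subordinator s v : ℂ) * ⟪ξ, (T.op v f : H →L[ℂ] H) η⟫_ℂ := by
  rw [poisson, dif_pos hs]
  exact (T.exists_poisson hs f).choose_spec ξ η

/-! ### Generators, the gradient form, and the condition `Γ² ≥ 0` -/

/-- `f` lies in the domain of the (weak-*) infinitesimal generator `B` of the semigroup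
`U_t = e^{-tB}` and `B f = g`: the weak-* limit of `(f - U_t f) / t` as `t → 0⁺` is `g`. -/
def HasGenerator (U : ℝ → Elem M → Elem M) (f g : Elem M) : Prop :=
  Tendsto (fun t : ℝ => ((t : ℂ)⁻¹) • (f - U t f)) (𝓝[>] 0) (@nhds _ (weakStar M) g)

open Classical in
/-- The infinitesimal generator `A` of `T_t = e^{-tA}` (extended by `0` outside of its domain). -/
def generator (T : MarkovSemigroup τ) (f : Elem M) : Elem M :=
  if h : ∃ g, HasGenerator (fun t => T.op t) f g then h.choose else 0

/-- The derived form `B'` of a form `B`: `2 B'(f,g) = B(Af,g) + B(f,Ag) - A B(f,g)`. -/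
def derivedForm (T : MarkovSemigroup τ) (B : Elem M → Elem M → Elem M) (f g : Elem M) : Elem M :=
  (2 : ℂ)⁻¹ • (B (T.generator f) g + B f (T.generator g) - T.generator (B f g))

/-- The iterated gradient forms: `Γ⁰(f,g) = f* g` and `Γ^{k+1} = (Γ^k)'`; so `Γ¹` is the gradient
form `2 Γ(f,g) = (Af)* g + f* (Ag) - A(f* g)`. -/
def gradientForm (T : MarkovSemigroup τ) : ℕ → Elem M → Elem M → Elem M
  | 0 => fun f g => star f * g
  | k + 1 => T.derivedForm (gradientForm T k)

/-- A test algebra: a weak-* dense `*`-subalgebra `S ⊆ L¹(M) ∩ M` contained in the domain of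
`A^{1/2}` (the generator of the Poisson semigroup), with `A^{1/2}[S] ⊆ S`, and invariant under
`T_t` and `P_s`. -/
structure IsTestAlgebra (T : MarkovSemigroup τ) (S : NonUnitalStarSubalgebra ℂ (Elem M)) :
    Prop where
  dense : @Dense _ (weakStar M) (S : Set (Elem M))
  memL1 : ∀ f ∈ S, τ.MemL1 f
  sqrt_generator_mem : ∀ f ∈ S, ∃ g ∈ S, HasGenerator T.poisson f g
  op_mem : ∀ t : ℝ, 0 < t → ∀ f ∈ S, T.op t f ∈ S
  poisson_mem : ∀ s : ℝ, 0 < s → ∀ f ∈ S, T.poisson s f ∈ S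

/-- The `Γ² ≥ 0` property (relative to the test algebra `S`). -/
def GammaTwoNonneg (T : MarkovSemigroup τ) (S : NonUnitalStarSubalgebra ℂ (Elem M)) : Prop :=
  ∀ f ∈ S, 0 ≤ T.gradientForm 2 f f

/-! ### Hölder and Campanato seminorms -/

/-- The homogeneous Hölder seminorm `‖f‖_{Λ_α°} = sup_{s>0} s^{1-α} ‖(d/ds) P_s f‖_∞`. -/
def holder (T : MarkovSemigroup τ) (α : ℝ) (f : Elem M) : ℝ≥0∞ :=
  ⨆ (s : ℝ) (_ : 0 < s),
    ENNReal.ofReal (s ^ (1 - α) * ‖deriv (fun r : ℝ => (T.poisson r f : H →L[ℂ] H)) s‖)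

/-- `sup_{s>0} s^{-α} ‖P_s |f - P_s f|²‖_∞^{1/2}`. -/
def bigLipColumn (T : MarkovSemigroup τ) (α : ℝ) (f : Elem M) : ℝ≥0∞ :=
  ⨆ (s : ℝ) (_ : 0 < s),
    ENNReal.ofReal (s ^ (-α) *
      √‖(T.poisson s (star (f - T.poisson s f) * (f - T.poisson s f)) : H →L[ℂ] H)‖)

/-- `sup_{s>0} s^{-α} ‖P_s |f|² - |P_s f|²‖_∞^{1/2}`. -/
def littleLipColumn (T : MarkovSemigroup τ) (α : ℝ) (f : Elem M) : ℝ≥0∞ :=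
  ⨆ (s : ℝ) (_ : 0 < s),
    ENNReal.ofReal (s ^ (-α) *
      √‖((T.poisson s (star f * f) - star (T.poisson s f) * T.poisson s f : Elem M) :
        H →L[ℂ] H)‖)

end MarkovSemigroup

/-- The three versions `c`, `r`, `r ∧ c` of the Campanato seminorms. -/
inductive Side
  | column
  | row
  | symmetric

/-- The column, row or symmetric version of a column seminorm `p`: respectively `p f`, `p f*` and
the maximum of the two. -/
def Side.version {E : Type*} [Star E] (p : E → ℝ≥0∞) : Side → E → ℝ≥0∞
  | .column, f => p f
  | .row, f => p (star f)
  | .symmetric, f => max (p f) (p (star f))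

namespace MarkovSemigroup

variable {H : Type*} [NormedAddCommGroup H] [InnerProductSpace ℂ H] [CompleteSpace H]
  {M : VonNeumannAlgebra H} {τ : NSFTrace M}

/-- The Campanato seminorms `‖f‖_{𝓛ip_α^†}`, `† ∈ {c, r, r ∧ c}`. -/
def bigLip (T : MarkovSemigroup τ) (d : Side) (α : ℝ) (f : Elem M) : ℝ≥0∞ :=
  d.version (T.bigLipColumn α) f

/-- The Campanato seminorms `‖f‖_{ℓip_α^†}`, `† ∈ {c, r, r ∧ c}`. -/
def littleLip (T : MarkovSemigroup τ) (d : Side) (α : ℝ) (f : Elem M) : ℝ≥0∞ :=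
  d.version (T.littleLipColumn α) f

end MarkovSemigroup

end SemigroupHolder

end

noncomputable section

namespace SemigroupHolder

/-! ### The subordination kernel -/

/-! Write K for the Hölder seminorm of f, assumed finite. Integrating ‖(d/ds) P_s f‖ ≤ K s^(α-1)
down to 0 gives ‖f - P_s f‖ ≤ (K/α) s^α (`norm_sub_poisson_le`). As P_s is a contraction, this
proves (i) with constant 1/α. The row versions are free, because the Hölder seminorm is invariant
under f ↦ f*.

For (ii), P_s f is the mean of T_v f under the probability density φ_s(v) dv, so expanding the
square gives P_s|f|² - |P_s f|² = ∫ φ_s(v) [(T_v|f|² - |T_v f|²) + |T_v f - P_s f|²] dv. It suffices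
to bound T_v|f|² - |T_v f|² by a multiple of K² v^α and ‖T_v f - f‖ by a multiple of K v^(α/2): the
moment ∫ φ_s(v) v^α dv is a multiple of s^(2α), and it is finite exactly when α < 1/2. Both bounds
are instances of `seminorm_le_of_poisson_le`: a subadditive N with N(g) ≤ A‖g‖ and N(P_w g) ≤ A
(√v/w) ‖g‖ has N(f) ≲ A K v^(α/2), by telescoping along the dyadic scales w = 2^n √v.

For N(g) = ‖T_v g - g‖ the second hypothesis comes from ∫ |∂_v φ_w| dv ≲ w⁻²
(`exists_norm_op_poisson_sub_le`). For N(g)² = ⟨x, (T_v|g|² - |T_v g|²) x⟩ it comes from Γ² ≥ 0: the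
map u ↦ T_{L-u}|T_u g|² has second derivative 4 T_{L-u} Γ²(T_u g, T_u g), so it is convex on [0, L].
With L = v + t, comparing u = t with the endpoints gives T_v|T_t g|² - |T_{v+t} g|² ≤ (v/t)‖g‖²
(`schwarzCore_op_le`), and averaging in t gives `schwarzCore_poisson_le`. The derivatives are
computed on the test algebra, where A is the square of A^{1/2} and orbits are norm differentiable;
density extends the resulting inequality to M (`IsTestAlgebra.inner_inequality`). -/

theorem subordinator_nonneg {s v : ℝ} (hs : 0 ≤ s) (hv : 0 ≤ v) : 0 ≤ subordinator s v := by
  unfold subordinator; positivity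

/-- The constant `m_p` of the moment formula `∫ φ_s(v) v^p dv = m_p s^{2p}`. -/
def subordinatorMoment (p : ℝ) : ℝ := 1 / (2 * √Real.pi) * (4 ^ (1 / 2 - p) * Real.Gamma (1 / 2 - p))

theorem subordinatorMoment_nonneg {p : ℝ} (hp : p < 1 / 2) : 0 ≤ subordinatorMoment p := by
  have := Real.Gamma_pos_of_pos (sub_pos.mpr hp)
  unfold subordinatorMoment; positivity

/-- The substitution x = v⁻¹ turns moments of φ_s into Gamma integrals. The right side has the shape
required by `integral_comp_rpow_Ioi` with exponent -1. -/
theorem subordinator_mul_rpow_eq (s p : ℝ) {v : ℝ} (hv : 0 < v) :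
    subordinator s v * v ^ p = s / (2 * √Real.pi) * ((|(-1 : ℝ)| * v ^ ((-1 : ℝ) - 1)) •
      ((v ^ (-1 : ℝ)) ^ ((1 / 2 - p) - 1) * Real.exp (-(s ^ 2 / 4 * v ^ (-1 : ℝ))))) := by
  unfold subordinator
  have e1 : v ^ ((-1 : ℝ) - 1) * (v ^ (-1 : ℝ)) ^ ((1 / 2 - p) - 1) = v ^ (-(3 / 2) : ℝ) * v ^ p := by
    rw [← Real.rpow_mul hv.le, ← Real.rpow_add hv, ← Real.rpow_add hv]; congr 1; ring
  have e2 : -s ^ 2 / (4 * v) = -(s ^ 2 / 4 * v ^ (-1 : ℝ)) := by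
    rw [Real.rpow_neg_one]; field_simp
  rw [e2, smul_eq_mul, abs_neg, abs_one]
  linear_combination (-(s / (2 * √Real.pi)) * Real.exp (-(s ^ 2 / 4 * v ^ (-1 : ℝ)))) * e1

/-- The integrand decays like v^(p - 3/2) at infinity, hence p < 1/2; near 0 the exponential absorbs
every power. With p = α this is the origin of the restriction α < 1/2. -/
theorem subordinator_mul_rpow_integrableOn {s p : ℝ} (hs : 0 < s) (hp : p < 1 / 2) :
    IntegrableOn (fun v => subordinator s v * v ^ p) (Ioi 0) := by
  have h := integrableOn_rpow_mul_exp_neg_mul_rpow (p := 1) (s := (1 / 2 - p) - 1) (b := s ^ 2 / 4)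
    (by linarith) one_pos (by positivity)
  simp only [Real.rpow_one] at h
  have h2 := ((integrableOn_Ioi_comp_rpow_iff (p := -1) _ (by norm_num)).mpr h).const_mul
    (s / (2 * √Real.pi))
  refine IntegrableOn.congr_fun h2 (fun v hv => ?_) measurableSet_Ioi
  rw [subordinator_mul_rpow_eq s p hv]
  simp only [neg_mul]

theorem integral_subordinator_mul_rpow {s p : ℝ} (hs : 0 < s) (hp : p < 1 / 2) :
    ∫ v in Ioi 0, subordinator s v * v ^ p = subordinatorMoment p * s ^ (2 * p) := by
  rw [setIntegral_congr_fun measurableSet_Ioi (fun v hv => subordinator_mul_rpow_eq s p hv),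
    integral_const_mul, integral_comp_rpow_Ioi
      (fun x => x ^ ((1 / 2 - p) - 1) * Real.exp (-(s ^ 2 / 4 * x))) (by norm_num),
    Real.integral_rpow_mul_exp_neg_mul_Ioi (by linarith) (by positivity)]
  have e : (1 / (s ^ 2 / 4)) ^ (1 / 2 - p) = 4 ^ (1 / 2 - p) * (s ^ (2 * p) / s) := by
    rw [one_div_div, Real.div_rpow (by norm_num) (by positivity), ← Real.rpow_natCast,
      ← Real.rpow_mul hs.le, div_eq_mul_inv, ← Real.rpow_neg hs.le, ← Real.rpow_sub_one hs.ne']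
    congr 2; push_cast; ring
  rw [e, subordinatorMoment]
  field_simp

theorem integral_subordinator {s : ℝ} (hs : 0 < s) : ∫ v in Ioi 0, subordinator s v = 1 := by
  have h := integral_subordinator_mul_rpow (p := 0) hs (by norm_num)
  simp only [Real.rpow_zero, mul_one, mul_zero, subordinatorMoment, sub_zero] at h
  rw [h, Real.Gamma_one_half_eq, ← Real.sqrt_eq_rpow,
    show (4 : ℝ) = 2 ^ 2 by norm_num, Real.sqrt_sq (by norm_num)]
  have : √Real.pi ≠ 0 := by positivity
  field_simp

theorem subordinator_mul_sq {s x : ℝ} (hs : 0 < s) (hx : 0 < x) :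
    s ^ 2 * subordinator s (s ^ 2 * x) = subordinator 1 x := by
  unfold subordinator
  have e1 : (s ^ 2 * x) ^ (-(3 / 2) : ℝ) = x ^ (-(3 / 2) : ℝ) / s ^ 3 := by
    rw [Real.mul_rpow (by positivity) hx.le, ← Real.rpow_natCast s 2, ← Real.rpow_mul hs.le,
      ← Real.rpow_natCast s 3, eq_div_iff (by positivity), mul_right_comm, ← Real.rpow_add hs]
    norm_num
  have e2 : -s ^ 2 / (4 * (s ^ 2 * x)) = -1 ^ 2 / (4 * x) := by field_simp
  rw [e1, e2]; field_simp

/-- Scaling moves the dependence on s from the kernel to k, which prepares the limit s → 0. -/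
theorem integral_subordinator_mul {s : ℝ} (hs : 0 < s) (k : ℝ → ℂ) :
    ∫ v in Ioi 0, (subordinator s v : ℂ) * k v =
      ∫ x in Ioi 0, (subordinator 1 x : ℂ) * k (s ^ 2 * x) := by
  have h := integral_comp_mul_left_Ioi (fun v => (subordinator s v : ℂ) * k v) 0
    (show 0 < s ^ 2 by positivity)
  rw [mul_zero] at h
  have h' : ∫ v in Ioi 0, (subordinator s v : ℂ) * k v = (s ^ 2 : ℝ) •
      ∫ x in Ioi 0, (subordinator s (s ^ 2 * x) : ℂ) * k (s ^ 2 * x) := by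
    rw [h, smul_smul, mul_inv_cancel₀ (by positivity), one_smul]
  rw [h', ← integral_smul]
  refine setIntegral_congr_fun measurableSet_Ioi fun x hx => ?_
  rw [← subordinator_mul_sq hs hx, Complex.real_smul]; push_cast; ring

/-- The derivative of `s ↦ φ_s(v)`. -/
def subordinatorDeriv (s v : ℝ) : ℝ :=
  1 / (2 * √Real.pi) * (Real.exp (-s ^ 2 / (4 * v)) * (1 - s ^ 2 / (2 * v)) * v ^ (-(3 / 2) : ℝ))

/-- The second derivative of `s ↦ φ_s(v)`, which is also the derivative of `v ↦ φ_s(v)`. -/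
def subordinatorDeriv₂ (s v : ℝ) : ℝ := subordinator s v * (s ^ 2 / (4 * v ^ 2) - 3 / (2 * v))

theorem hasDerivAt_subordinator (s : ℝ) {v : ℝ} (hv : 0 < v) :
    HasDerivAt (fun s => subordinator s v) (subordinatorDeriv s v) s := by
  unfold subordinator subordinatorDeriv
  have h1 : HasDerivAt (fun s : ℝ => -s ^ 2 / (4 * v)) (-(2 * s) / (4 * v)) s := by
    simpa using ((hasDerivAt_pow 2 s).neg).div_const (4 * v)
  refine ((((hasDerivAt_id' s).mul h1.exp).mul_const _).const_mul _).congr_deriv ?_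
  field_simp; ring

theorem hasDerivAt_subordinatorDeriv (s : ℝ) {v : ℝ} (hv : 0 < v) :
    HasDerivAt (fun s => subordinatorDeriv s v) (subordinatorDeriv₂ s v) s := by
  unfold subordinatorDeriv₂ subordinator subordinatorDeriv
  have h1 : HasDerivAt (fun s : ℝ => -s ^ 2 / (4 * v)) (-(2 * s) / (4 * v)) s := by
    simpa using ((hasDerivAt_pow 2 s).neg).div_const (4 * v)
  have h2 : HasDerivAt (fun s : ℝ => 1 - s ^ 2 / (2 * v)) (-(2 * s / (2 * v))) s := by
    simpa using ((hasDerivAt_pow 2 s).div_const (2 * v)).const_sub 1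
  refine (((h1.exp.mul h2).mul_const _).const_mul _).congr_deriv ?_
  field_simp; ring

/-- Together with `hasDerivAt_subordinatorDeriv` this is the equation ∂_v φ = ∂_s² φ, the kernel
form of A = (A^{1/2})². -/
theorem hasDerivAt_subordinator_right (s : ℝ) {v : ℝ} (hv : 0 < v) :
    HasDerivAt (subordinator s) (subordinatorDeriv₂ s v) v := by
  unfold subordinatorDeriv₂ subordinator
  have h1 : HasDerivAt (fun v : ℝ => -s ^ 2 / (4 * v)) (s ^ 2 / (4 * v ^ 2)) v := by
    refine ((hasDerivAt_const v (-s ^ 2)).div ((hasDerivAt_id' v).const_mul 4)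
      (by positivity)).congr_deriv ?_
    field_simp; ring
  have h2 := Real.hasDerivAt_rpow_const (x := v) (p := -(3 / 2)) (Or.inl hv.ne')
  have e : v ^ (-(3 / 2) - 1 : ℝ) = v ^ (-(3 / 2) : ℝ) / v := Real.rpow_sub_one hv.ne' _
  rw [e] at h2
  refine (((h1.exp.const_mul s).mul h2).const_mul _).congr_deriv ?_
  field_simp; ring

theorem subordinatorDeriv₂_continuousOn (s : ℝ) : ContinuousOn (subordinatorDeriv₂ s) (Ioi 0) := by
  refine (subordinator_continuousOn s).mul ?_
  refine ContinuousOn.sub (ContinuousOn.div (by fun_prop) (by fun_prop) fun v hv => ?_)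
    (ContinuousOn.div (by fun_prop) (by fun_prop) fun v hv => ?_) <;>
  · have : (0 : ℝ) < v := hv
    positivity

theorem subordinatorDeriv_eq {s v : ℝ} (hs : 0 < s) :
    subordinatorDeriv s v = subordinator s v * (1 / s - s / (2 * v)) := by
  unfold subordinatorDeriv subordinator
  field_simp

theorem rpow_neg_two_eq {v : ℝ} (hv : 0 < v) : v ^ (-2 : ℝ) = 1 / v ^ 2 := by
  rw [Real.rpow_neg hv.le, one_div]; norm_cast

theorem subordinatorDeriv_integrableOn {s : ℝ} (hs : 0 < s) :
    IntegrableOn (subordinatorDeriv s) (Ioi 0) := by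
  have h := ((subordinator_integrableOn hs).const_mul (1 / s)).sub
    ((subordinator_mul_rpow_integrableOn (p := -1) hs (by norm_num)).const_mul (s / 2))
  refine IntegrableOn.congr_fun h (fun v hv => ?_) measurableSet_Ioi
  have hv : 0 < v := hv
  rw [subordinatorDeriv_eq hs]
  simp only [Pi.sub_apply, Real.rpow_neg_one]
  field_simp

theorem subordinatorDeriv₂_integrableOn {s : ℝ} (hs : 0 < s) :
    IntegrableOn (subordinatorDeriv₂ s) (Ioi 0) := by
  have h := ((subordinator_mul_rpow_integrableOn (p := -2) hs (by norm_num)).const_mul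
    (s ^ 2 / 4)).sub
    ((subordinator_mul_rpow_integrableOn (p := -1) hs (by norm_num)).const_mul (3 / 2))
  refine IntegrableOn.congr_fun h (fun v hv => ?_) measurableSet_Ioi
  have hv : 0 < v := hv
  simp only [Pi.sub_apply, Real.rpow_neg_one, subordinatorDeriv₂, rpow_neg_two_eq hv]
  field_simp

/-- The two terms of the kernel are moments of order -2 and -1, which scale like s⁻⁴ and s⁻²; the
first carries a factor s². -/
theorem exists_integral_abs_subordinatorDeriv₂_le :
    ∃ C : ℝ, 0 ≤ C ∧ ∀ s : ℝ, 0 < s → ∫ v in Ioi 0, |subordinatorDeriv₂ s v| ≤ C / s ^ 2 := by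
  refine ⟨1 / 4 * subordinatorMoment (-2) + 3 / 2 * subordinatorMoment (-1), ?_, fun s hs => ?_⟩
  · have h1 := subordinatorMoment_nonneg (p := -2) (by norm_num)
    have h2 := subordinatorMoment_nonneg (p := -1) (by norm_num)
    positivity
  have i2 := (subordinator_mul_rpow_integrableOn (p := -2) hs (by norm_num)).const_mul (s ^ 2 / 4)
  have i1 := (subordinator_mul_rpow_integrableOn (p := -1) hs (by norm_num)).const_mul (3 / 2)
  calc ∫ v in Ioi 0, |subordinatorDeriv₂ s v|
      ≤ ∫ v in Ioi 0, (s ^ 2 / 4 * (subordinator s v * v ^ (-2 : ℝ)) +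
        3 / 2 * (subordinator s v * v ^ (-1 : ℝ))) := by
        refine setIntegral_mono_on (subordinatorDeriv₂_integrableOn hs).abs (i2.add i1)
          measurableSet_Ioi fun v hv => ?_
        have hv : 0 < v := hv
        have h0 := subordinator_nonneg hs.le hv.le
        rw [subordinatorDeriv₂, abs_mul, abs_of_nonneg h0, rpow_neg_two_eq hv, Real.rpow_neg_one]
        have : |s ^ 2 / (4 * v ^ 2) - 3 / (2 * v)| ≤ s ^ 2 / (4 * v ^ 2) + 3 / (2 * v) := by
          refine (abs_sub _ _).trans (le_of_eq ?_)
          rw [abs_of_nonneg (by positivity), abs_of_nonneg (by positivity)]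
        calc _ ≤ subordinator s v * (s ^ 2 / (4 * v ^ 2) + 3 / (2 * v)) := by gcongr
          _ = _ := by field_simp
    _ = _ := by
        rw [integral_add i2 i1, integral_const_mul, integral_const_mul,
          integral_subordinator_mul_rpow hs (by norm_num),
          integral_subordinator_mul_rpow hs (by norm_num)]
        have e1 : s ^ (2 * (-2) : ℝ) = 1 / s ^ 4 := by
          rw [show (2 * (-2) : ℝ) = -(4 : ℕ) by norm_num, Real.rpow_neg hs.le, Real.rpow_natCast, one_div]
        have e2 : s ^ (2 * (-1) : ℝ) = 1 / s ^ 2 := by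
          rw [show (2 * (-1) : ℝ) = -(2 : ℕ) by norm_num, Real.rpow_neg hs.le, Real.rpow_natCast, one_div]
        rw [e1, e2]; field_simp

/-- The mean value inequality applied twice, which gives C where Taylor's formula would give C/2. -/
theorem abs_sub_sub_mul_le {f f' f'' : ℝ → ℝ} {a b C : ℝ}
    (hf : ∀ x ∈ Icc a b, HasDerivAt f (f' x) x) (hf' : ∀ x ∈ Icc a b, HasDerivAt f' (f'' x) x)
    (hC : ∀ x ∈ Icc a b, |f'' x| ≤ C) {x y : ℝ} (hx : x ∈ Icc a b) (hy : y ∈ Icc a b) :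
    |f y - f x - (y - x) * f' x| ≤ C * (y - x) ^ 2 := by
  have hsub : uIcc x y ⊆ Icc a b := uIcc_subset_Icc hx hy
  have h1 : ∀ z ∈ uIcc x y, ‖f' z - f' x‖ ≤ C * |y - x| := by
    intro z hz
    refine (Convex.norm_image_sub_le_of_norm_hasDerivWithin_le
      (fun w hw => (hf' w hw).hasDerivWithinAt) hC (convex_Icc a b) hx (hsub hz)).trans ?_
    have : |z - x| ≤ |y - x| := abs_sub_left_of_mem_uIcc hz
    have : 0 ≤ C := (abs_nonneg _).trans (hC x hx)
    rw [Real.norm_eq_abs]; gcongr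
  have h2 := Convex.norm_image_sub_le_of_norm_hasDerivWithin_le
    (f := fun z => f z - z * f' x) (f' := fun z => f' z - f' x)
    (fun w hw => (((hf w (hsub hw)).sub ((hasDerivAt_id' w).mul_const (f' x))).congr_deriv
      (by ring)).hasDerivWithinAt) h1 (convex_uIcc x y) left_mem_uIcc right_mem_uIcc
  calc |f y - f x - (y - x) * f' x| = ‖f y - y * f' x - (f x - x * f' x)‖ := by
        rw [Real.norm_eq_abs]; congr 1; ring
    _ ≤ _ := h2
    _ = C * (y - x) ^ 2 := by rw [Real.norm_eq_abs, mul_assoc, ← sq, sq_abs]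

/-- An integrable majorant of the second derivative of `σ ↦ φ_σ` for `σ ∈ [s/2, 3s/2]`. -/
def subordinatorMajorant (s v : ℝ) : ℝ :=
  3 * (9 / 16 * s ^ 2 * (subordinator (s / 2) v * v ^ (-2 : ℝ)) +
    3 / 2 * (subordinator (s / 2) v * v ^ (-1 : ℝ)))

theorem subordinatorMajorant_integrableOn {s : ℝ} (hs : 0 < s) :
    IntegrableOn (subordinatorMajorant s) (Ioi 0) :=
  (((subordinator_mul_rpow_integrableOn (half_pos hs) (by norm_num)).const_mul _).add
    ((subordinator_mul_rpow_integrableOn (half_pos hs) (by norm_num)).const_mul _)).const_mul _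

theorem abs_subordinatorDeriv₂_le {s σ v : ℝ} (hs : 0 < s) (hv : 0 < v)
    (hσ : σ ∈ Icc (s / 2) (3 * s / 2)) : |subordinatorDeriv₂ σ v| ≤ subordinatorMajorant s v := by
  have hσ0 : 0 < σ := (half_pos hs).trans_le hσ.1
  have h0 := subordinator_nonneg hσ0.le hv.le
  -- The exponential decreases in σ, and the linear factor grows at most by (3s/2)/(s/2) = 3.
  have h1 : subordinator σ v ≤ 3 * subordinator (s / 2) v := by
    unfold subordinator
    have : Real.exp (-σ ^ 2 / (4 * v)) ≤ Real.exp (-(s / 2) ^ 2 / (4 * v)) := by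
      gcongr; exact hσ.1
    calc _ ≤ 1 / (2 * √Real.pi) * ((3 * s / 2) * Real.exp (-(s / 2) ^ 2 / (4 * v)) *
          v ^ (-(3 / 2) : ℝ)) := by gcongr; exact hσ.2
      _ = _ := by ring
  have h2 : |σ ^ 2 / (4 * v ^ 2) - 3 / (2 * v)| ≤ 9 / 16 * s ^ 2 / v ^ 2 + 3 / 2 / v := by
    refine (abs_sub _ _).trans ?_
    rw [abs_of_nonneg (by positivity), abs_of_nonneg (by positivity)]
    have : σ ^ 2 ≤ (3 * s / 2) ^ 2 := by gcongr; exact hσ.2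
    calc _ ≤ (3 * s / 2) ^ 2 / (4 * v ^ 2) + 3 / (2 * v) := by gcongr
      _ = _ := by field_simp; ring
  have h3 := subordinator_nonneg (half_pos hs).le hv.le
  rw [subordinatorDeriv₂, abs_mul, abs_of_nonneg h0, subordinatorMajorant, rpow_neg_two_eq hv,
    Real.rpow_neg_one]
  calc _ ≤ 3 * subordinator (s / 2) v * (9 / 16 * s ^ 2 / v ^ 2 + 3 / 2 / v) := by gcongr
    _ = _ := by field_simp

theorem abs_subordinator_sub_sub_le {s h v : ℝ} (hs : 0 < s) (hv : 0 < v) (hh : |h| ≤ s / 2) :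
    |subordinator (s + h) v - subordinator s v - h * subordinatorDeriv s v| ≤
      subordinatorMajorant s v * h ^ 2 := by
  have := abs_le.mp hh
  have := abs_sub_sub_mul_le (f := fun s => subordinator s v) (a := s / 2) (b := 3 * s / 2)
    (x := s) (y := s + h) (fun x _ => hasDerivAt_subordinator x hv)
    (fun x _ => hasDerivAt_subordinatorDeriv x hv) (fun x hx => abs_subordinatorDeriv₂_le hs hv hx)
    ⟨by linarith, by linarith⟩ ⟨by linarith, by linarith⟩
  simpa using this

theorem subordinatorDeriv_continuousOn (s : ℝ) : ContinuousOn (subordinatorDeriv s) (Ioi 0) := by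
  intro v hv
  have hv' : (0 : ℝ) < v := hv
  apply ContinuousAt.continuousWithinAt
  unfold subordinatorDeriv
  have h1 : ContinuousAt (fun v : ℝ => v ^ (-(3 / 2) : ℝ)) v :=
    Real.continuousAt_rpow_const _ _ (Or.inl hv'.ne')
  have h2 : ContinuousAt (fun v : ℝ => -s ^ 2 / (4 * v)) v :=
    ContinuousAt.div (by fun_prop) (by fun_prop) (by positivity)
  have h3 : ContinuousAt (fun v : ℝ => 1 - s ^ 2 / (2 * v)) v :=
    continuousAt_const.sub (ContinuousAt.div (by fun_prop) (by fun_prop) (by positivity))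
  exact continuousAt_const.mul ((h2.rexp.mul h3).mul h1)

end SemigroupHolder

namespace SemigroupHolder

/-! ### The convolution identity `φ_s * φ_r = φ_{s+r}` -/

/-- A primitive of the Gaussian `e^{-c u²}`. -/
def gaussPrimitive (c z : ℝ) : ℝ := ∫ u in (0 : ℝ)..z, Real.exp (-c * u ^ 2)

theorem hasDerivAt_gaussPrimitive (c z : ℝ) :
    HasDerivAt (gaussPrimitive c) (Real.exp (-c * z ^ 2)) z := by
  have hc : Continuous fun u : ℝ => Real.exp (-c * u ^ 2) := by fun_prop
  exact intervalIntegral.integral_hasDerivAt_right (hc.intervalIntegrable _ _)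
    (hc.stronglyMeasurableAtFilter _ _) hc.continuousAt

theorem tendsto_gaussPrimitive_atTop {c : ℝ} (hc : 0 < c) :
    Tendsto (gaussPrimitive c) atTop (𝓝 (√(Real.pi / c) / 2)) := by
  rw [← integral_gaussian_Ioi]
  exact intervalIntegral_tendsto_integral_Ioi 0 (integrable_exp_neg_mul_sq hc).integrableOn
    tendsto_id

theorem gaussPrimitive_neg (c z : ℝ) : gaussPrimitive c (-z) = -gaussPrimitive c z := by
  unfold gaussPrimitive
  have h := intervalIntegral.integral_comp_neg (a := 0) (b := z) fun u : ℝ => Real.exp (-c * u ^ 2)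
  simp only [neg_sq, neg_zero] at h
  rw [intervalIntegral.integral_symm, ← h]

theorem tendsto_gaussPrimitive_atBot {c : ℝ} (hc : 0 < c) :
    Tendsto (gaussPrimitive c) atBot (𝓝 (-(√(Real.pi / c) / 2))) := by
  have h := ((tendsto_gaussPrimitive_atTop hc).comp tendsto_neg_atBot_atTop).neg
  refine h.congr fun z => ?_
  simp [gaussPrimitive_neg]

/-- The function `x ↦ r √(x/(v-x)) + σ √((v-x)/x)`. -/
def crossRatio (r σ v x : ℝ) : ℝ := r * (√x / √(v - x)) + σ * (√(v - x) / √x)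

theorem hasDerivAt_crossRatio (r σ : ℝ) {v x : ℝ} (h0 : 0 < x) (h1 : x < v) :
    HasDerivAt (crossRatio r σ v)
      (r * (v / (2 * √x * √(v - x) ^ 3)) - σ * (v / (2 * √x ^ 3 * √(v - x)))) x := by
  have hv : 0 < v - x := sub_pos.mpr h1
  have hX : 0 < √x := Real.sqrt_pos.mpr h0
  have hW : 0 < √(v - x) := Real.sqrt_pos.mpr hv
  have dX := Real.hasDerivAt_sqrt h0.ne'
  have dW : HasDerivAt (fun x => √(v - x)) (-1 / (2 * √(v - x))) x :=
    ((hasDerivAt_id' x).const_sub v).sqrt hv.ne'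
  have hsum : √x ^ 2 + √(v - x) ^ 2 = v := by
    rw [Real.sq_sqrt h0.le, Real.sq_sqrt hv.le]; ring
  refine (((dX.div dW hW.ne').const_mul r).add ((dW.div dX hX.ne').const_mul σ)).congr_deriv ?_
  generalize √x = X at *
  generalize √(v - x) = W at *
  rw [← hsum]
  field_simp
  ring

/-- For σ = ±s this identity makes exp(-`crossRatio`²/(4v)) a constant multiple of the product of
the exponentials in φ_s(x) and φ_r(v - x). A Gaussian primitive composed with `crossRatio` therefore
has the right exponential in its derivative. -/
theorem crossRatio_sq (r σ : ℝ) {v x : ℝ} (h0 : 0 < x) (h1 : x < v) :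
    crossRatio r σ v x ^ 2 = v * (r ^ 2 / (v - x) + σ ^ 2 / x) - (r - σ) ^ 2 := by
  have hv : 0 < v - x := sub_pos.mpr h1
  have hX : 0 < √x := Real.sqrt_pos.mpr h0
  have hW : 0 < √(v - x) := Real.sqrt_pos.mpr hv
  have eX := Real.sq_sqrt h0.le
  have eW := Real.sq_sqrt hv.le
  have hsum : √x ^ 2 + √(v - x) ^ 2 = v := by rw [eX, eW]; ring
  unfold crossRatio
  rw [show r ^ 2 / (v - x) + σ ^ 2 / x = r ^ 2 / √(v - x) ^ 2 + σ ^ 2 / √x ^ 2 by rw [eX, eW]]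
  generalize √x = X at *
  generalize √(v - x) = W at *
  rw [← hsum]
  field_simp
  ring

theorem subordinator_eq_sqrt (s : ℝ) {v : ℝ} (hv : 0 < v) :
    subordinator s v = 1 / (2 * √Real.pi) * (s * Real.exp (-s ^ 2 / (4 * v)) / √v ^ 3) := by
  unfold subordinator
  have : v ^ (-(3 / 2) : ℝ) = (√v ^ 3)⁻¹ := by
    rw [Real.rpow_neg hv.le, Real.sqrt_eq_rpow, ← Real.rpow_natCast, ← Real.rpow_mul hv.le]
    norm_num
  rw [this, div_eq_mul_inv (s * _)]

/-- The cubic term of the exponential series bounds e^(-s²/(4v)) by a multiple of v³, which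
outweighs v^(-3/2). -/
theorem exists_subordinator_le_sqrt {s : ℝ} (hs : 0 < s) :
    ∃ C : ℝ, ∀ v, 0 < v → subordinator s v ≤ C * √v ^ 3 := by
  refine ⟨1 / (2 * √Real.pi) * (s * (6 * (4 / s ^ 2) ^ 3)), fun v hv => ?_⟩
  have hx : 0 < s ^ 2 / (4 * v) := by positivity
  have hexp : Real.exp (-s ^ 2 / (4 * v)) ≤ 6 * (4 / s ^ 2) ^ 3 * v ^ 3 := by
    have h1 := Real.pow_div_factorial_le_exp (s ^ 2 / (4 * v)) hx.le 3
    rw [neg_div, Real.exp_neg]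
    calc _ ≤ ((s ^ 2 / (4 * v)) ^ 3 / (Nat.factorial 3 : ℝ))⁻¹ := inv_anti₀ (by positivity) h1
      _ = _ := by simp only [Nat.factorial]; push_cast; field_simp
  have h3 : 0 < √v := Real.sqrt_pos.mpr hv
  rw [subordinator_eq_sqrt s hv]
  calc _ ≤ 1 / (2 * √Real.pi) * (s * (6 * (4 / s ^ 2) ^ 3 * v ^ 3) / √v ^ 3) := by gcongr
    _ = 1 / (2 * √Real.pi) * (s * (6 * (4 / s ^ 2) ^ 3 * (√v ^ 2) ^ 3) / √v ^ 3) := by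
      rw [Real.sq_sqrt hv.le]
    _ = _ := by field_simp

theorem exists_subordinator_le {s : ℝ} (hs : 0 < s) :
    ∃ C : ℝ, ∀ v, 0 < v → subordinator s v ≤ C := by
  obtain ⟨C, hC⟩ := exists_subordinator_le_sqrt hs
  have hC0 : 0 ≤ C := by
    have := (subordinator_nonneg hs.le zero_le_one).trans (hC 1 one_pos)
    simpa using this
  refine ⟨C + 1 / (2 * √Real.pi) * s, fun v hv => ?_⟩
  have h3 : 0 < √v := Real.sqrt_pos.mpr hv
  have hpos : 0 ≤ 1 / (2 * √Real.pi) * s := by positivity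
  rcases le_total v 1 with h | h
  · have : √v ^ 3 ≤ 1 := pow_le_one₀ h3.le (Real.sqrt_le_one.mpr h)
    nlinarith [hC v hv]
  · have h1 : 1 ≤ √v := Real.one_le_sqrt.mpr h
    have : Real.exp (-s ^ 2 / (4 * v)) ≤ 1 := by
      rw [Real.exp_le_one_iff, neg_div, neg_nonpos]; positivity
    rw [subordinator_eq_sqrt s hv]
    calc _ ≤ 1 / (2 * √Real.pi) * (s * 1 / 1 ^ 3) := by gcongr
      _ ≤ _ := by linarith

/-- The integrand has the explicit primitive F. As x goes from 0 to v, `crossRatio r (-s) v` goes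
from -∞ to +∞, while `crossRatio r s v` tends to +∞ at both ends. So the B-term contributes nothing,
and the A-term contributes A times a full Gaussian integral, which is φ_{s+r}(v). -/
theorem integral_subordinator_mul_sub {s r v : ℝ} (hs : 0 < s) (hr : 0 < r) (hv : 0 < v) :
    ∫ x in (0 : ℝ)..v, subordinator s x * subordinator r (v - x) = subordinator (s + r) v := by
  set c := 1 / (4 * v) with hc
  have hc0 : 0 < c := by positivity
  -- The weights s + r and s - r make the algebraic factors of the two derivatives combine into the
  -- single term s r / (x(v - x))^(3/2), up to 4π; see `hfin`. The exponentials cancel the constant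
  -- left over by `crossRatio_sq`.
  set A := (s + r) / (4 * Real.pi * v ^ 2) * Real.exp (-(s + r) ^ 2 / (4 * v)) with hA
  set B := (s - r) / (4 * Real.pi * v ^ 2) * Real.exp (-(r - s) ^ 2 / (4 * v)) with hB
  set F : ℝ → ℝ := fun x => A * gaussPrimitive c (crossRatio r (-s) v x) +
    B * gaussPrimitive c (crossRatio r s v x) with hF
  have hderiv : ∀ x ∈ Ioo 0 v, HasDerivAt F (subordinator s x * subordinator r (v - x)) x := by
    rintro x ⟨h0, h1⟩
    have hvx : 0 < v - x := sub_pos.mpr h1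
    refine ((((hasDerivAt_gaussPrimitive c _).comp x (hasDerivAt_crossRatio r (-s) h0 h1)).const_mul
      A).add (((hasDerivAt_gaussPrimitive c _).comp x (hasDerivAt_crossRatio r s h0 h1)).const_mul
      B)).congr_deriv ?_
    rw [crossRatio_sq r s h0 h1, crossRatio_sq r (-s) h0 h1, subordinator_eq_sqrt s h0,
      subordinator_eq_sqrt r hvx]
    have hX : 0 < √x := Real.sqrt_pos.mpr h0
    have hW : 0 < √(v - x) := Real.sqrt_pos.mpr hvx
    have hsum : √x ^ 2 + √(v - x) ^ 2 = v := by
      rw [Real.sq_sqrt h0.le, Real.sq_sqrt hvx.le]; ring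
    have hpi : √Real.pi ^ 2 = Real.pi := Real.sq_sqrt Real.pi_pos.le
    have e1 : Real.exp (-(s + r) ^ 2 / (4 * v)) *
        Real.exp (-c * (v * (r ^ 2 / (v - x) + (-s) ^ 2 / x) - (r - -s) ^ 2)) =
        Real.exp (-s ^ 2 / (4 * x)) * Real.exp (-r ^ 2 / (4 * (v - x))) := by
      rw [← Real.exp_add, ← Real.exp_add, hc]; congr 1; field_simp; ring
    have e2 : Real.exp (-(r - s) ^ 2 / (4 * v)) *
        Real.exp (-c * (v * (r ^ 2 / (v - x) + s ^ 2 / x) - (r - s) ^ 2)) =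
        Real.exp (-s ^ 2 / (4 * x)) * Real.exp (-r ^ 2 / (4 * (v - x))) := by
      rw [← Real.exp_add, ← Real.exp_add, hc]; congr 1; field_simp; ring
    have hfin : (s + r) / (4 * Real.pi * v ^ 2) *
          (r * (v / (2 * √x * √(v - x) ^ 3)) - -s * (v / (2 * √x ^ 3 * √(v - x)))) +
        (s - r) / (4 * Real.pi * v ^ 2) *
          (r * (v / (2 * √x * √(v - x) ^ 3)) - s * (v / (2 * √x ^ 3 * √(v - x)))) =
        s * r / (4 * Real.pi) / (√x ^ 3 * √(v - x) ^ 3) := by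
      generalize √x = X at *
      generalize √(v - x) = W at *
      rw [← hsum]
      have : X ^ 2 + W ^ 2 ≠ 0 := by positivity
      field_simp
      ring
    have hq : 1 / (2 * √Real.pi) * (1 / (2 * √Real.pi)) = 1 / (4 * Real.pi) := by
      rw [one_div_mul_one_div, mul_mul_mul_comm, ← sq √Real.pi, hpi]; norm_num
    rw [hA, hB]
    calc _ = (s + r) / (4 * Real.pi * v ^ 2) * (Real.exp (-(s + r) ^ 2 / (4 * v)) *
        Real.exp (-c * (v * (r ^ 2 / (v - x) + (-s) ^ 2 / x) - (r - -s) ^ 2))) *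
          (r * (v / (2 * √x * √(v - x) ^ 3)) - -s * (v / (2 * √x ^ 3 * √(v - x)))) +
        (s - r) / (4 * Real.pi * v ^ 2) * (Real.exp (-(r - s) ^ 2 / (4 * v)) *
        Real.exp (-c * (v * (r ^ 2 / (v - x) + s ^ 2 / x) - (r - s) ^ 2))) *
          (r * (v / (2 * √x * √(v - x) ^ 3)) - s * (v / (2 * √x ^ 3 * √(v - x)))) := by ring
      _ = Real.exp (-s ^ 2 / (4 * x)) * Real.exp (-r ^ 2 / (4 * (v - x))) *
          (s * r / (4 * Real.pi) / (√x ^ 3 * √(v - x) ^ 3)) := by rw [e1, e2, ← hfin]; ring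
      _ = (1 / (4 * Real.pi)) * (s * r * Real.exp (-s ^ 2 / (4 * x)) *
          Real.exp (-r ^ 2 / (4 * (v - x))) / (√x ^ 3 * √(v - x) ^ 3)) := by ring
      _ = _ := by rw [← hq]; field_simp
  -- endpoint behaviour of the two square root quotients
  have q0 : Tendsto (fun x => √x / √(v - x)) (𝓝[>] 0) (𝓝 0) := by
    have : ContinuousAt (fun x => √x / √(v - x)) 0 :=
      ContinuousAt.div (by fun_prop) (by fun_prop) (by simpa using (Real.sqrt_pos.mpr hv).ne')
    simpa using this.tendsto.mono_left nhdsWithin_le_nhds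
  have q1 : Tendsto (fun x => √(v - x) / √x) (𝓝[<] v) (𝓝 0) := by
    have : ContinuousAt (fun x => √(v - x) / √x) v :=
      ContinuousAt.div (by fun_prop) (by fun_prop) (Real.sqrt_pos.mpr hv).ne'
    simpa using this.tendsto.mono_left nhdsWithin_le_nhds
  have q0' : Tendsto (fun x => √(v - x) / √x) (𝓝[>] 0) atTop := by
    refine (tendsto_nhdsWithin_iff.mpr ⟨q0, ?_⟩).inv_tendsto_nhdsGT_zero.congr fun x => by simp
    filter_upwards [Ioo_mem_nhdsGT hv] with x hx
    exact div_pos (Real.sqrt_pos.mpr hx.1) (Real.sqrt_pos.mpr (sub_pos.mpr hx.2))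
  have q1' : Tendsto (fun x => √x / √(v - x)) (𝓝[<] v) atTop := by
    refine (tendsto_nhdsWithin_iff.mpr ⟨q1, ?_⟩).inv_tendsto_nhdsGT_zero.congr fun x => by simp
    filter_upwards [Ioo_mem_nhdsLT hv] with x hx
    exact div_pos (Real.sqrt_pos.mpr (sub_pos.mpr hx.2)) (Real.sqrt_pos.mpr hx.1)
  have hTop : ∀ σ : ℝ, Tendsto (crossRatio r σ v) (𝓝[<] v) atTop := fun σ =>
    (q1'.const_mul_atTop hr).atTop_add (q1.const_mul σ)
  have hl1 : Tendsto F (𝓝[<] v) (𝓝 (A * (√(Real.pi / c) / 2) + B * (√(Real.pi / c) / 2))) :=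
    (((tendsto_gaussPrimitive_atTop hc0).comp (hTop (-s))).const_mul A).add
      (((tendsto_gaussPrimitive_atTop hc0).comp (hTop s)).const_mul B)
  have hl0 : Tendsto F (𝓝[>] 0) (𝓝 (A * -(√(Real.pi / c) / 2) + B * (√(Real.pi / c) / 2))) :=
    (((tendsto_gaussPrimitive_atBot hc0).comp
        ((q0.const_mul r).add_atBot (q0'.const_mul_atTop_of_neg (neg_lt_zero.mpr hs)))).const_mul A).add
      (((tendsto_gaussPrimitive_atTop hc0).comp
        ((q0.const_mul r).add_atTop (q0'.const_mul_atTop hs))).const_mul B)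
  have hint : IntervalIntegrable (fun x => subordinator s x * subordinator r (v - x)) volume 0 v := by
    obtain ⟨C, hC⟩ := exists_subordinator_le hs
    have i1 : IntervalIntegrable (subordinator r) volume 0 v := by
      rw [intervalIntegrable_iff_integrableOn_Ioo_of_le hv.le]
      exact (subordinator_integrableOn hr).mono_set fun x hx => hx.1
    have i2 : IntervalIntegrable (fun x => subordinator r (v - x)) volume 0 v := by
      simpa using (i1.comp_sub_left v).symm
    rw [intervalIntegrable_iff_integrableOn_Ioo_of_le hv.le] at i2 ⊢
    refine Integrable.bdd_mul (c := C) i2 ?_ ?_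
    · exact ((subordinator_continuousOn s).mono fun x hx => hx.1).aestronglyMeasurable
        measurableSet_Ioo
    · filter_upwards [ae_restrict_mem measurableSet_Ioo] with x hx
      rw [Real.norm_eq_abs, abs_of_nonneg (subordinator_nonneg hs.le hx.1.le)]
      exact hC x hx.1
  rw [intervalIntegral.integral_eq_sub_of_hasDerivAt_of_tendsto hv hderiv hint hl0 hl1,
    subordinator_eq_sqrt _ hv]
  have hpi : √Real.pi ^ 2 = Real.pi := Real.sq_sqrt Real.pi_pos.le
  have hv2 : √v ^ 2 = v := Real.sq_sqrt hv.le
  have e : √(Real.pi / c) = 2 * (√Real.pi * √v) := by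
    rw [hc, show Real.pi / (1 / (4 * v)) = 2 ^ 2 * (Real.pi * v) by field_simp; norm_num,
      Real.sqrt_mul (by norm_num), Real.sqrt_sq (by norm_num), Real.sqrt_mul Real.pi_pos.le]
  rw [e, hA]
  have h3 : 0 < √v := Real.sqrt_pos.mpr hv
  have h4 : 0 < √Real.pi := Real.sqrt_pos.mpr Real.pi_pos
  have e2 : (s + r) / (4 * Real.pi * v ^ 2) = (s + r) / (4 * √Real.pi ^ 2 * √v ^ 4) := by
    rw [hpi, show √v ^ 4 = (√v ^ 2) ^ 2 by ring, hv2]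
  rw [e2]
  generalize Real.exp (-(s + r) ^ 2 / (4 * v)) = E
  field_simp
  ring

/-- The subordination kernel, extended by `0` to the negative half-line. -/
def subordinatorExt (s : ℝ) : ℝ → ℂ := (Ioi 0).indicator fun v => (subordinator s v : ℂ)

theorem subordinatorExt_integrable {s : ℝ} (hs : 0 < s) : Integrable (subordinatorExt s) :=
  (integrable_indicator_iff measurableSet_Ioi).mpr (subordinator_integrableOn hs).ofReal

theorem integral_subordinatorExt_mul (s : ℝ) (k : ℝ → ℂ) :
    ∫ v, subordinatorExt s v * k v = ∫ v in Ioi 0, (subordinator s v : ℂ) * k v := by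
  rw [← integral_indicator measurableSet_Ioi]
  congr 1; ext v
  by_cases h : v ∈ Ioi (0 : ℝ) <;> simp [subordinatorExt, h]

theorem integral_subordinatorExt_mul_sub {s r : ℝ} (hs : 0 < s) (hr : 0 < r) {v : ℝ} (hv : v ≠ 0) :
    ∫ x, subordinatorExt s x * subordinatorExt r (v - x) = subordinatorExt (s + r) v := by
  rw [integral_subordinatorExt_mul]
  rcases hv.lt_or_gt with hv | hv
  · have : v ∉ Ioi (0 : ℝ) := fun h => (lt_asymm hv h)
    rw [show subordinatorExt (s + r) v = 0 from indicator_of_notMem this _]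
    refine integral_eq_zero_of_ae ?_
    filter_upwards [ae_restrict_mem measurableSet_Ioi] with x hx
    have hx : 0 < x := hx
    have : v - x ∉ Ioi (0 : ℝ) := fun h => by
      have : 0 < v - x := h
      linarith
    simp [subordinatorExt, indicator_of_notMem this]
  · rw [show subordinatorExt (s + r) v = (subordinator (s + r) v : ℂ) from
        indicator_of_mem (mem_Ioi.mpr hv) _, ← integral_subordinator_mul_sub hs hr hv,
      ← intervalIntegral.integral_ofReal, intervalIntegral.integral_of_le hv.le,
      ← integral_indicator measurableSet_Ioi, ← integral_Ioc_eq_integral_Ioo.symm,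
      ← integral_indicator measurableSet_Ioo]
    congr 1; ext x
    by_cases h0 : 0 < x <;> by_cases h1 : x < v <;> simp [subordinatorExt, indicator, h0, h1]

/-- Fubini and a translation reduce this to φ_s * φ_r = φ_{s+r}; it is the scalar form of P_s P_r =
P_{s+r}. -/
theorem integral_integral_subordinator {s r : ℝ} (hs : 0 < s) (hr : 0 < r) {k : ℝ → ℂ}
    (hk : Continuous k) {B : ℝ} (hB : ∀ v, ‖k v‖ ≤ B) :
    ∫ x in Ioi 0, (subordinator s x : ℂ) * ∫ y in Ioi 0, (subordinator r y : ℂ) * k (x + y) =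
      ∫ v in Ioi 0, (subordinator (s + r) v : ℂ) * k v := by
  have hi := (subordinatorExt_integrable hs).convolution_integrand (ContinuousLinearMap.mul ℂ ℂ)
    (subordinatorExt_integrable hr) (μ := volume) (ν := volume)
  have hi2 : Integrable (fun p : ℝ × ℝ =>
      (subordinatorExt s p.2 * subordinatorExt r (p.1 - p.2)) * k p.1) (volume.prod volume) :=
    hi.mul_bdd (c := B) (hk.comp continuous_fst).aestronglyMeasurable
      (Eventually.of_forall fun p => hB _)
  have hswap := integral_integral_swap
    (f := fun v x => (subordinatorExt s x * subordinatorExt r (v - x)) * k v) hi2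
  simp only [integral_mul_const] at hswap
  calc _ = ∫ x, subordinatorExt s x * ∫ v, subordinatorExt r (v - x) * k v := by
        rw [integral_subordinatorExt_mul]
        refine setIntegral_congr_fun measurableSet_Ioi fun x _ => ?_
        rw [← integral_subordinatorExt_mul r fun y => k (x + y),
          ← integral_sub_right_eq_self (fun y => subordinatorExt r y * k (x + y)) x]
        simp
    _ = ∫ x, ∫ v, (subordinatorExt s x * subordinatorExt r (v - x)) * k v := by
        congr 1; ext x
        rw [← integral_const_mul]; simp only [mul_assoc]
    _ = ∫ v, (∫ x, subordinatorExt s x * subordinatorExt r (v - x)) * k v := hswap.symm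
    _ = ∫ v, subordinatorExt (s + r) v * k v := by
        refine integral_congr_ae ?_
        filter_upwards [compl_mem_ae_iff.mpr (measure_singleton (0 : ℝ))] with v hv
        rw [integral_subordinatorExt_mul_sub hs hr hv]
    _ = _ := integral_subordinatorExt_mul _ _

/-! ### Limits and translations -/

theorem subordinator_mul_integrableOn {κ : ℝ → ℝ} (hκ : IntegrableOn κ (Ioi 0)) {k : ℝ → ℂ}
    (hk : ContinuousOn k (Ioi 0)) {B : ℝ} (hB : ∀ v ∈ Ioi (0 : ℝ), ‖k v‖ ≤ B) :
    IntegrableOn (fun v => (κ v : ℂ) * k v) (Ioi 0) := by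
  refine Integrable.mul_bdd (c := B) hκ.ofReal (hk.aestronglyMeasurable measurableSet_Ioi) ?_
  filter_upwards [ae_restrict_mem measurableSet_Ioi] with v hv using hB v hv

theorem norm_integral_mul_le {κ : ℝ → ℝ} (hκ : IntegrableOn κ (Ioi 0)) {k : ℝ → ℂ} {B : ℝ}
    (hB : ∀ v ∈ Ioi (0 : ℝ), ‖k v‖ ≤ B) :
    ‖∫ v in Ioi 0, (κ v : ℂ) * k v‖ ≤ (∫ v in Ioi 0, |κ v|) * B := by
  rw [← integral_mul_const]
  refine norm_integral_le_of_norm_le (hκ.abs.mul_const _) ?_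
  filter_upwards [ae_restrict_mem measurableSet_Ioi] with v hv
  rw [norm_mul, Complex.norm_real, Real.norm_eq_abs]
  exact mul_le_mul_of_nonneg_left (hB v hv) (abs_nonneg _)

theorem norm_integral_subordinator_mul_le {s : ℝ} (hs : 0 < s) {k : ℝ → ℂ} {B : ℝ}
    (hB : ∀ v ∈ Ioi (0 : ℝ), ‖k v‖ ≤ B) :
    ‖∫ v in Ioi 0, (subordinator s v : ℂ) * k v‖ ≤ B := by
  refine (norm_integral_mul_le (subordinator_integrableOn hs) hB).trans (le_of_eq ?_)
  rw [setIntegral_congr_fun measurableSet_Ioi fun v (hv : 0 < v) =>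
    abs_of_nonneg (subordinator_nonneg hs.le hv.le), integral_subordinator hs, one_mul]

/-- After rescaling, the kernel is the fixed probability density φ_1 and the integrand is k(s² x),
so dominated convergence applies. -/
theorem tendsto_integral_subordinator {k : ℝ → ℂ} (hk : ContinuousOn k (Ici 0)) {B : ℝ}
    (hB : ∀ v ∈ Ici (0 : ℝ), ‖k v‖ ≤ B) :
    Tendsto (fun s => ∫ v in Ioi 0, (subordinator s v : ℂ) * k v) (𝓝[>] 0) (𝓝 (k 0)) := by
  have h : Tendsto (fun s : ℝ => ∫ x in Ioi 0, (subordinator 1 x : ℂ) * k (s ^ 2 * x)) (𝓝[>] 0)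
      (𝓝 (∫ x in Ioi 0, (subordinator 1 x : ℂ) * k 0)) := by
    refine tendsto_integral_filter_of_dominated_convergence (fun x => |subordinator 1 x| * B) ?_ ?_
      ((subordinator_integrableOn one_pos).abs.mul_const B) ?_
    · filter_upwards [self_mem_nhdsWithin] with s hs
      have hs : 0 < s := hs
      refine (ContinuousOn.mul (Complex.continuous_ofReal.comp_continuousOn
        (subordinator_continuousOn 1)) (hk.comp (by fun_prop) fun x hx => ?_)).aestronglyMeasurable
        measurableSet_Ioi
      have hx : 0 < x := hx
      exact mem_Ici.mpr (by positivity)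
    · filter_upwards [self_mem_nhdsWithin] with s hs
      have hs : 0 < s := hs
      filter_upwards [ae_restrict_mem measurableSet_Ioi] with x hx
      have hx : 0 < x := hx
      rw [norm_mul, Complex.norm_real, Real.norm_eq_abs]
      exact mul_le_mul_of_nonneg_left (hB _ (mem_Ici.mpr (by positivity))) (abs_nonneg _)
    · filter_upwards [ae_restrict_mem measurableSet_Ioi] with x hx
      have hx : 0 < x := hx
      refine Tendsto.const_mul _ ?_
      have h0 : Tendsto k (𝓝[≥] 0) (𝓝 (k 0)) := hk 0 self_mem_Ici
      refine h0.comp (tendsto_nhdsWithin_iff.mpr ⟨?_, Eventually.of_forall fun s =>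
        mem_Ici.mpr (by positivity)⟩)
      have : Tendsto (fun s : ℝ => s ^ 2 * x) (𝓝 0) (𝓝 (0 ^ 2 * x)) :=
        Continuous.tendsto (by fun_prop) 0
      simpa using this.mono_left nhdsWithin_le_nhds
  rw [integral_mul_const, integral_complex_ofReal, integral_subordinator one_pos,
    Complex.ofReal_one, one_mul] at h
  refine h.congr' ?_
  filter_upwards [self_mem_nhdsWithin] with s hs
  rw [integral_subordinator_mul hs]

/-- The value comes from the convention that 0 to a nonzero real power is 0. It agrees with the
limit at 0⁺, so it can serve as the boundary value in integration by parts. -/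
theorem subordinator_zero_right (s : ℝ) : subordinator s 0 = 0 := by
  unfold subordinator
  rw [Real.zero_rpow (by norm_num)]; simp

theorem tendsto_subordinator_zero {s : ℝ} (hs : 0 < s) :
    Tendsto (subordinator s) (𝓝[>] 0) (𝓝 0) := by
  obtain ⟨C, hC⟩ := exists_subordinator_le_sqrt hs
  have h : Tendsto (fun v => C * √v ^ 3) (𝓝[>] 0) (𝓝 0) := by
    have : Continuous fun v : ℝ => C * √v ^ 3 := by fun_prop
    simpa using (this.tendsto 0).mono_left nhdsWithin_le_nhds
  refine squeeze_zero' ?_ ?_ h <;> filter_upwards [self_mem_nhdsWithin] with v hv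
  · exact subordinator_nonneg hs.le (le_of_lt hv)
  · exact hC v hv

theorem tendsto_subordinator_atTop {s : ℝ} (hs : 0 < s) : Tendsto (subordinator s) atTop (𝓝 0) := by
  have h : Tendsto (fun v : ℝ => 1 / (2 * √Real.pi) * (s * v ^ (-(3 / 2) : ℝ))) atTop (𝓝 0) := by
    simpa using ((tendsto_rpow_neg_atTop (show (0 : ℝ) < 3 / 2 by norm_num)).const_mul s).const_mul
      (1 / (2 * √Real.pi))
  refine squeeze_zero' ?_ ?_ h <;> filter_upwards [eventually_gt_atTop 0] with v hv
  · exact subordinator_nonneg hs.le hv.le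
  · unfold subordinator
    have : Real.exp (-s ^ 2 / (4 * v)) ≤ 1 := by
      rw [Real.exp_le_one_iff, neg_div, neg_nonpos]; positivity
    calc _ ≤ 1 / (2 * √Real.pi) * (s * 1 * v ^ (-(3 / 2) : ℝ)) := by gcongr
      _ = _ := by rw [mul_one]

/-- Integration by parts against D, the primitive of k(v + t) - k(v) that vanishes at 0; φ_s
vanishes at both ends and D is bounded. The gain is |D| ≤ 2Bt, which combines with ∫ |∂_v φ_s| ≲ s⁻²
to give the factor t/s². -/
theorem integral_subordinator_mul_shift_sub {s t : ℝ} (hs : 0 < s) (ht : 0 ≤ t) {k : ℝ → ℂ}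
    (hk : Continuous k) {B : ℝ} (hB : ∀ v, ‖k v‖ ≤ B) :
    ∫ v in Ioi 0, (subordinator s v : ℂ) * (k (v + t) - k v) =
      -∫ v in Ioi 0, (subordinatorDeriv₂ s v : ℂ) * ∫ u in (0 : ℝ)..t, (k (v + u) - k u) := by
  set D : ℝ → ℂ := fun v => ∫ u in (0 : ℝ)..t, (k (v + u) - k u) with hD
  have hDb : ∀ v, ‖D v‖ ≤ 2 * B * t := by
    intro v
    refine (intervalIntegral.norm_integral_le_of_norm_le_const (C := 2 * B) fun u _ =>
      (norm_sub_le _ _).trans (by linarith [hB (v + u), hB u])).trans ?_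
    rw [sub_zero, abs_of_nonneg ht]
  have hkI : ∀ a b : ℝ, IntervalIntegrable k volume a b := fun a b => hk.intervalIntegrable a b
  have hDeq : ∀ v, D v = (∫ u in (0 : ℝ)..(v + t), k u) - (∫ u in (0 : ℝ)..v, k u) -
      ∫ u in (0 : ℝ)..t, k u := by
    intro v
    have h1 : ∫ u in (0 : ℝ)..t, k (v + u) = ∫ u in v..(v + t), k u := by
      rw [intervalIntegral.integral_comp_add_left]; simp
    rw [hD]
    simp only
    have h2 : IntervalIntegrable (fun u => k (v + u)) volume 0 t :=
      (hk.comp (continuous_const.add continuous_id)).intervalIntegrable _ _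
    rw [intervalIntegral.integral_sub h2 (hkI _ _), h1,
      intervalIntegral.integral_interval_sub_left (hkI _ _) (hkI _ _)]
  have hDd : ∀ v, HasDerivAt D (k (v + t) - k v) v := by
    intro v
    have hp : ∀ w, HasDerivAt (fun w => ∫ u in (0 : ℝ)..w, k u) (k w) w := fun w =>
      intervalIntegral.integral_hasDerivAt_right (hkI _ _) (hk.stronglyMeasurableAtFilter _ _)
        hk.continuousAt
    have := (((hp (v + t)).comp_add_const v t).sub (hp v)).sub_const (∫ u in (0 : ℝ)..t, k u)
    exact this.congr_of_eventuallyEq (Eventually.of_forall hDeq)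
  have hDc : Continuous D := continuous_iff_continuousAt.mpr fun v => (hDd v).continuousAt
  have i1 := subordinator_mul_integrableOn (subordinator_integrableOn hs) (k := fun v => k (v + t) - k v)
    (by fun_prop) (B := 2 * B) fun v _ => (norm_sub_le _ _).trans (by linarith [hB (v + t), hB v])
  have i2 := subordinator_mul_integrableOn (subordinatorDeriv₂_integrableOn hs) hDc.continuousOn
    fun v _ => hDb v
  have hlim : ∀ l : Filter ℝ, Tendsto (subordinator s) l (𝓝 0) →
      Tendsto (fun v => (subordinator s v : ℂ) * D v) l (𝓝 0) := by
    intro l hl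
    have hl' : Tendsto (fun v => (subordinator s v : ℂ)) l (𝓝 0) := by
      rw [← Complex.ofReal_zero]
      exact (Complex.continuous_ofReal.tendsto 0).comp hl
    exact hl'.zero_mul_isBoundedUnder_le (isBoundedUnder_of ⟨2 * B * t, fun v => hDb v⟩)
  have h := integral_Ioi_of_hasDerivAt_of_tendsto (a := 0)
    (f := fun v => (subordinator s v : ℂ) * D v)
    (f' := fun v => (subordinatorDeriv₂ s v : ℂ) * D v + (subordinator s v : ℂ) * (k (v + t) - k v))
    (by
      rw [← continuousWithinAt_Ioi_iff_Ici, ContinuousWithinAt, subordinator_zero_right,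
        Complex.ofReal_zero, zero_mul]
      exact hlim _ (tendsto_subordinator_zero hs))
    (fun v hv => (hasDerivAt_subordinator_right s hv).ofReal_comp.mul (hDd v))
    (i2.add i1) (hlim _ (tendsto_subordinator_atTop hs))
  rw [integral_add i2 i1, subordinator_zero_right, Complex.ofReal_zero, zero_mul, sub_zero] at h
  exact eq_neg_of_add_eq_zero_right h

theorem integral_subordinatorDeriv₂ {s : ℝ} (hs : 0 < s) :
    ∫ v in Ioi 0, subordinatorDeriv₂ s v = 0 := by
  have h := integral_Ioi_of_hasDerivAt_of_tendsto (a := 0) (f := subordinator s)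
    (by
      rw [← continuousWithinAt_Ioi_iff_Ici, ContinuousWithinAt, subordinator_zero_right]
      exact tendsto_subordinator_zero hs)
    (fun v hv => hasDerivAt_subordinator_right s hv) (subordinatorDeriv₂_integrableOn hs)
    (tendsto_subordinator_atTop hs)
  rwa [subordinator_zero_right, sub_zero] at h

/-- Fubini in the previous formula. The subtracted k(u) drops out because ∂_v φ_s has integral 0. -/
theorem integral_subordinator_mul_shift_sub' {s t : ℝ} (hs : 0 < s) (ht : 0 ≤ t) {k : ℝ → ℂ}
    (hk : Continuous k) {B : ℝ} (hB : ∀ v, ‖k v‖ ≤ B) :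
    ∫ v in Ioi 0, (subordinator s v : ℂ) * (k (v + t) - k v) =
      -∫ u in (0 : ℝ)..t, ∫ v in Ioi 0, (subordinatorDeriv₂ s v : ℂ) * k (v + u) := by
  have hd := subordinatorDeriv₂_integrableOn hs
  rw [integral_subordinator_mul_shift_sub hs ht hk hB, neg_inj]
  have i1 : Integrable (fun p : ℝ × ℝ => ((subordinatorDeriv₂ s p.1 : ℂ) * 1) * (k (p.1 + p.2) - k p.2))
      ((volume.restrict (Ioi 0)).prod (volume.restrict (Ioc 0 t))) := by
    refine Integrable.mul_bdd (c := 2 * B) (Integrable.mul_prod (f := fun v => (subordinatorDeriv₂ s v : ℂ))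
      (g := fun _ : ℝ => (1 : ℂ)) hd.ofReal (integrable_const 1)) ?_ ?_
    · exact Continuous.aestronglyMeasurable (by fun_prop)
    · exact Eventually.of_forall fun p =>
        (norm_sub_le _ _).trans (by linarith [hB (p.1 + p.2), hB p.2])
  simp only [intervalIntegral.integral_of_le ht]
  simp only [mul_one] at i1
  have hswap := integral_integral_swap
    (f := fun v u => (subordinatorDeriv₂ s v : ℂ) * (k (v + u) - k u)) i1
  simp only [integral_const_mul] at hswap
  rw [hswap]
  congr 1; ext u
  simp only [mul_sub]
  have j1 := subordinator_mul_integrableOn hd (k := fun v => k (v + u)) (by fun_prop) fun v _ => hB _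
  have j2 : IntegrableOn (fun v => (subordinatorDeriv₂ s v : ℂ) * k u) (Ioi 0) :=
    hd.ofReal.mul_const _
  rw [integral_sub j1 j2, integral_mul_const, integral_complex_ofReal,
    integral_subordinatorDeriv₂ hs]
  simp

end SemigroupHolder

namespace SemigroupHolder

/-! ### Differentiation of subordination integrals -/

theorem hasDerivAt_integral_subordinator {k : ℝ → ℂ} (hk : ContinuousOn k (Ioi 0)) {B : ℝ}
    (hB : ∀ v ∈ Ioi (0 : ℝ), ‖k v‖ ≤ B) {s : ℝ} (hs : 0 < s) :
    HasDerivAt (fun s => ∫ v in Ioi 0, (subordinator s v : ℂ) * k v)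
      (∫ v in Ioi 0, (subordinatorDeriv s v : ℂ) * k v) s := by
  have hM := subordinatorMajorant_integrableOn hs
  set M := ∫ v in Ioi 0, |subordinatorMajorant s v|
  rw [hasDerivAt_iff_isLittleO_nhds_zero]
  refine Asymptotics.IsBigO.trans_isLittleO (g := fun h : ℝ => h ^ 2) ?_ ?_
  · refine Asymptotics.IsBigO.of_bound (M * B) ?_
    filter_upwards [Metric.ball_mem_nhds (0 : ℝ) (half_pos hs)] with h hh
    rw [mem_ball_zero_iff, Real.norm_eq_abs] at hh
    have hsh : 0 < s + h := by linarith [(abs_lt.mp hh).1]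
    have i1 := subordinator_mul_integrableOn (subordinator_integrableOn hsh) hk hB
    have i2 := subordinator_mul_integrableOn (subordinator_integrableOn hs) hk hB
    have i3 := (subordinator_mul_integrableOn (subordinatorDeriv_integrableOn hs) hk hB).const_mul
      (h : ℂ)
    have e : (∫ v in Ioi 0, (subordinator (s + h) v : ℂ) * k v) -
        (∫ v in Ioi 0, (subordinator s v : ℂ) * k v) -
        h • (∫ v in Ioi 0, (subordinatorDeriv s v : ℂ) * k v) =
        ∫ v in Ioi 0, (subordinator (s + h) v * k v - subordinator s v * k v -
          h * (subordinatorDeriv s v * k v)) := by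
      have i12 : IntegrableOn (fun v => (subordinator (s + h) v : ℂ) * k v -
        subordinator s v * k v) (Ioi 0) := i1.sub i2
      rw [integral_sub i12 i3, integral_sub i1 i2, integral_const_mul, Complex.real_smul]
    rw [e, norm_pow, Real.norm_eq_abs, sq_abs]
    calc _ ≤ ∫ v in Ioi 0, |subordinatorMajorant s v| * (h ^ 2 * B) := by
          refine norm_integral_le_of_norm_le (hM.abs.mul_const _) ?_
          filter_upwards [ae_restrict_mem measurableSet_Ioi] with v hv
          have h1 := abs_subordinator_sub_sub_le hs hv hh.le
          have h2 : (subordinator (s + h) v : ℂ) * k v - subordinator s v * k v -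
              h * (subordinatorDeriv s v * k v) =
              ((subordinator (s + h) v - subordinator s v - h * subordinatorDeriv s v : ℝ) : ℂ) *
                k v := by push_cast; ring
          rw [h2, norm_mul, Complex.norm_real, Real.norm_eq_abs, ← mul_assoc]
          have h3 : subordinatorMajorant s v * h ^ 2 ≤ |subordinatorMajorant s v| * h ^ 2 := by
            gcongr; exact le_abs_self _
          exact mul_le_mul (h1.trans h3) (hB v hv) (norm_nonneg _) (by positivity)
      _ = M * B * h ^ 2 := by rw [integral_mul_const]; ring
  · exact Asymptotics.isLittleO_pow_id one_lt_two

theorem hasDerivAt_integral_subordinatorDeriv {k : ℝ → ℂ} (hk : ContinuousOn k (Ioi 0)) {B : ℝ}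
    (hB : ∀ v ∈ Ioi (0 : ℝ), ‖k v‖ ≤ B) {s : ℝ} (hs : 0 < s) :
    HasDerivAt (fun s => ∫ v in Ioi 0, (subordinatorDeriv s v : ℂ) * k v)
      (∫ v in Ioi 0, (subordinatorDeriv₂ s v : ℂ) * k v) s := by
  have hnhds : Icc (s / 2) (3 * s / 2) ∈ 𝓝 s := Icc_mem_nhds (by linarith) (by linarith)
  refine (hasDerivAt_integral_of_dominated_loc_of_deriv_le (μ := volume.restrict (Ioi (0 : ℝ)))
    (F := fun s v => (subordinatorDeriv s v : ℂ) * k v)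
    (F' := fun s v => (subordinatorDeriv₂ s v : ℂ) * k v)
    (bound := fun v => subordinatorMajorant s v * B) hnhds ?_ ?_ ?_ ?_ ?_ ?_).2
  · filter_upwards [hnhds] with σ _
    exact ((Complex.continuous_ofReal.comp_continuousOn (subordinatorDeriv_continuousOn σ)).mul
      hk).aestronglyMeasurable measurableSet_Ioi
  · exact subordinator_mul_integrableOn (subordinatorDeriv_integrableOn hs) hk hB
  · exact ((Complex.continuous_ofReal.comp_continuousOn (subordinatorDeriv₂_continuousOn s)).mul
      hk).aestronglyMeasurable measurableSet_Ioi
  · filter_upwards [ae_restrict_mem measurableSet_Ioi] with v hv σ hσ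
    rw [norm_mul, Complex.norm_real, Real.norm_eq_abs]
    have := abs_subordinatorDeriv₂_le hs hv hσ
    exact mul_le_mul this (hB v hv) (norm_nonneg _) ((abs_nonneg _).trans this)
  · exact (subordinatorMajorant_integrableOn hs).mul_const B
  · filter_upwards [ae_restrict_mem measurableSet_Ioi] with v hv σ _
    exact ((hasDerivAt_subordinatorDeriv σ hv).ofReal_comp).mul_const _

/-! ### Operators as weak integrals -/

variable {H : Type*} [NormedAddCommGroup H] [InnerProductSpace ℂ H]

theorem opNorm_le_of_inner_le {A : H →L[ℂ] H} {c : ℝ} (hc : 0 ≤ c)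
    (h : ∀ ξ η : H, ‖⟪ξ, A η⟫_ℂ‖ ≤ c * ‖ξ‖ * ‖η‖) : ‖A‖ ≤ c := by
  refine norm_le_of_inner_le hc fun ξ η => ?_
  nlinarith [h ξ η, mul_nonneg hc (sq_nonneg (‖ξ‖ - ‖η‖))]

theorem norm_inner_apply_le (A : H →L[ℂ] H) (ξ η : H) : ‖⟪ξ, A η⟫_ℂ‖ ≤ ‖A‖ * ‖ξ‖ * ‖η‖ :=
  calc ‖⟪ξ, A η⟫_ℂ‖ ≤ ‖ξ‖ * ‖A η‖ := norm_inner_le_norm _ _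
    _ ≤ ‖ξ‖ * (‖A‖ * ‖η‖) := by gcongr; exact A.le_opNorm _
    _ = _ := by ring

theorem inner_self_eq_ofReal (x : H) : ⟪x, x⟫_ℂ = ((‖x‖ ^ 2 : ℝ) : ℂ) := by
  rw [inner_self_eq_norm_sq_to_K]; push_cast; rfl

theorem inner_self_nonneg' (x : H) : 0 ≤ ⟪x, x⟫_ℂ := by
  rw [inner_self_eq_ofReal]
  exact Complex.zero_le_real.mpr (sq_nonneg _)

/-- The weak integral is a bounded sesquilinear form, hence given by an operator. The kernel κ may
change sign, as needed for the derivative kernel. -/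
theorem exists_weakIntegral [CompleteSpace H] {κ : ℝ → ℝ} (hκ : IntegrableOn κ (Ioi 0))
    {F : ℝ → H →L[ℂ] H} (hF : ∀ ξ η : H, ContinuousOn (fun v => ⟪ξ, F v η⟫_ℂ) (Ioi 0)) {B : ℝ}
    (hB : ∀ v ∈ Ioi (0 : ℝ), ‖F v‖ ≤ B) :
    ∃ g : H →L[ℂ] H, ∀ ξ η : H, ⟪ξ, g η⟫_ℂ = ∫ v in Ioi 0, (κ v : ℂ) * ⟪ξ, F v η⟫_ℂ := by
  have hbd : ∀ ξ η : H, ∀ v ∈ Ioi (0 : ℝ), ‖⟪ξ, F v η⟫_ℂ‖ ≤ B * ‖ξ‖ * ‖η‖ := by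
    intro ξ η v hv
    refine (norm_inner_apply_le _ _ _).trans ?_
    gcongr; exact hB v hv
  have hint : ∀ ξ η : H, IntegrableOn (fun v => (κ v : ℂ) * ⟪ξ, F v η⟫_ℂ) (Ioi 0) := fun ξ η =>
    subordinator_mul_integrableOn hκ (hF ξ η) (hbd ξ η)
  let B₀ : H →ₗ⋆[ℂ] H →ₗ[ℂ] ℂ := LinearMap.mk₂'ₛₗ (starRingEnd ℂ) (RingHom.id ℂ)
    (fun ξ η => ∫ v in Ioi (0 : ℝ), (κ v : ℂ) * ⟪ξ, F v η⟫_ℂ)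
    (fun ξ ξ' η => by
      rw [← integral_add (hint ξ η) (hint ξ' η)]
      simp only [inner_add_left, mul_add])
    (fun c ξ η => by
      rw [smul_eq_mul, ← integral_const_mul]
      congr 1; ext v
      rw [inner_smul_left]; ring)
    (fun ξ η η' => by
      rw [← integral_add (hint ξ η) (hint ξ η')]
      simp only [map_add, inner_add_right, mul_add])
    (fun c ξ η => by
      rw [RingHom.id_apply, smul_eq_mul, ← integral_const_mul]
      congr 1; ext v
      rw [map_smul, inner_smul_right]; ring)
  have hB₀ : ∀ ξ η, ‖B₀ ξ η‖ ≤ (∫ v in Ioi 0, |κ v|) * B * ‖ξ‖ * ‖η‖ := by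
    intro ξ η
    refine (norm_integral_mul_le hκ (hbd ξ η)).trans (le_of_eq ?_)
    ring
  refine ⟨ContinuousLinearMap.adjoint (InnerProductSpace.continuousLinearMapOfBilin (𝕜 := ℂ)
    (LinearMap.mkContinuous₂ B₀ _ hB₀)), fun ξ η => ?_⟩
  rw [ContinuousLinearMap.adjoint_inner_right, InnerProductSpace.continuousLinearMapOfBilin_apply]
  rfl

/-! ### Completely positive maps -/

variable [CompleteSpace H] {M : VonNeumannAlgebra H} {τ : NSFTrace M}

theorem Elem.ext_inner {f g : Elem M}
    (h : ∀ ξ η : H, ⟪ξ, (f : H →L[ℂ] H) η⟫_ℂ = ⟪ξ, (g : H →L[ℂ] H) η⟫_ℂ) : f = g :=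
  Subtype.ext (ContinuousLinearMap.ext fun η => ext_inner_left ℂ fun ξ => h ξ η)

theorem Elem.norm_le_of_inner {f : Elem M} {c : ℝ} (hc : 0 ≤ c)
    (h : ∀ ξ η : H, ‖⟪ξ, (f : H →L[ℂ] H) η⟫_ℂ‖ ≤ c * ‖ξ‖ * ‖η‖) : ‖f‖ ≤ c :=
  opNorm_le_of_inner_le hc h

theorem Elem.norm_inner_le (f : Elem M) (ξ η : H) :
    ‖⟪ξ, (f : H →L[ℂ] H) η⟫_ℂ‖ ≤ ‖f‖ * ‖ξ‖ * ‖η‖ :=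
  norm_inner_apply_le _ _ _

theorem Elem.inner_star (f : Elem M) (ξ η : H) :
    ⟪ξ, ((star f : Elem M) : H →L[ℂ] H) η⟫_ℂ = ⟪(f : H →L[ℂ] H) ξ, η⟫_ℂ :=
  ContinuousLinearMap.adjoint_inner_right _ _ _

theorem Elem.inner_star_mul (f g : Elem M) (ξ η : H) :
    ⟪ξ, ((star f * g : Elem M) : H →L[ℂ] H) η⟫_ℂ =
      ⟪(f : H →L[ℂ] H) ξ, (g : H →L[ℂ] H) η⟫_ℂ :=
  Elem.inner_star f ξ _

theorem Elem.inner_nonneg {f : Elem M} (hf : 0 ≤ f) (ξ : H) : 0 ≤ ⟪ξ, (f : H →L[ℂ] H) ξ⟫_ℂ := by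
  have h : (0 : H →L[ℂ] H) ≤ f := hf
  rw [ContinuousLinearMap.nonneg_iff_isPositive] at h
  exact h.inner_nonneg_right ξ

namespace IsMarkovian

variable {T : Elem M →ₗ[ℂ] Elem M}

theorem inner_nonneg (hT : IsMarkovian τ T) {f : Elem M}
    (hf : ∀ ξ : H, 0 ≤ ⟪ξ, (f : H →L[ℂ] H) ξ⟫_ℂ) (ξ : H) :
    0 ≤ ⟪ξ, (T f : H →L[ℂ] H) ξ⟫_ℂ := by
  have h := hT.completelyPositive 1 (fun _ _ => f) (fun ξ => by simpa using hf (ξ 0)) fun _ => ξ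
  simp only [Fin.sum_univ_one] at h
  exact h

theorem inner_star_mul_self_nonneg (hT : IsMarkovian τ T) (f : Elem M) (ξ : H) :
    0 ≤ ⟪ξ, (T (star f * f) : H →L[ℂ] H) ξ⟫_ℂ := by
  refine hT.inner_nonneg (fun ξ => ?_) ξ
  rw [Elem.inner_star_mul]
  exact inner_self_nonneg' _

/-- The matrix with rows (f*f, f*) and (f, 1) is R*R for the row R = (f, 1), so it is positive and
stays positive under T applied entrywise. -/
theorem two_positive (hT : IsMarkovian τ T) (f : Elem M) (ξ η : H) :
    0 ≤ ⟪ξ, (T (star f * f) : H →L[ℂ] H) ξ⟫_ℂ + ⟪ξ, (T (star f) : H →L[ℂ] H) η⟫_ℂ +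
      (⟪η, (T f : H →L[ℂ] H) ξ⟫_ℂ + ⟪η, η⟫_ℂ) := by
  have h := hT.completelyPositive 2 !![star f * f, star f; f, 1] (fun ζ => by
    have e : ∑ i, ∑ j, ⟪ζ i, ((!![star f * f, star f; f, 1] : Matrix (Fin 2) (Fin 2) (Elem M)) i j :
        H →L[ℂ] H) (ζ j)⟫_ℂ = ⟪(f : H →L[ℂ] H) (ζ 0) + ζ 1, (f : H →L[ℂ] H) (ζ 0) + ζ 1⟫_ℂ := by
      simp only [Fin.sum_univ_two]
      change ⟪ζ 0, ((star f * f : Elem M) : H →L[ℂ] H) (ζ 0)⟫_ℂ +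
        ⟪ζ 0, ((star f : Elem M) : H →L[ℂ] H) (ζ 1)⟫_ℂ + (⟪ζ 1, (f : H →L[ℂ] H) (ζ 0)⟫_ℂ +
        ⟪ζ 1, ζ 1⟫_ℂ) = _
      rw [Elem.inner_star_mul, Elem.inner_star, inner_add_left, inner_add_right, inner_add_right]
    rw [e]
    exact inner_self_nonneg' _) ![ξ, η]
  simp only [Fin.sum_univ_two] at h
  change 0 ≤ ⟪ξ, (T (star f * f) : H →L[ℂ] H) ξ⟫_ℂ + ⟪ξ, (T (star f) : H →L[ℂ] H) η⟫_ℂ +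
      (⟪η, (T f : H →L[ℂ] H) ξ⟫_ℂ + ⟪η, (T 1 : H →L[ℂ] H) η⟫_ℂ) at h
  rwa [hT.map_one] at h

/-- Positivity in ℂ forces imaginary parts to vanish. Testing `two_positive` with η and with iη
determines both the real and the imaginary part of the coefficient. -/
theorem map_star (hT : IsMarkovian τ T) (f : Elem M) : T (star f) = star (T f) := by
  have key : ∀ ξ η : H, (⟪ξ, (T (star f) : H →L[ℂ] H) η⟫_ℂ + ⟪η, (T f : H →L[ℂ] H) ξ⟫_ℂ).im = 0 := by
    intro ξ η
    have h1 := (Complex.le_def.mp (hT.two_positive f ξ η)).2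
    have h2 := (Complex.le_def.mp (hT.inner_star_mul_self_nonneg f ξ)).2
    have h3 : (⟪η, η⟫_ℂ).im = 0 := inner_self_im (𝕜 := ℂ) η
    simp only [Complex.add_im, Complex.zero_im] at h1 h2 h3 ⊢
    linarith
  refine Elem.ext_inner fun ξ η => ?_
  rw [Elem.inner_star, ← inner_conj_symm ((T f : H →L[ℂ] H) ξ) η]
  have h1 := key ξ η
  have h2 := key ξ (Complex.I • η)
  rw [map_smul, inner_smul_right, inner_smul_left] at h2
  generalize ⟪ξ, (T (star f) : H →L[ℂ] H) η⟫_ℂ = a at *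
  generalize ⟪η, (T f : H →L[ℂ] H) ξ⟫_ℂ = b at *
  refine Complex.ext ?_ ?_
  · simp at h2 ⊢; linarith
  · simp at h1 ⊢; linarith

/-- The Kadison-Schwarz inequality. -/
theorem norm_apply_sq_le (hT : IsMarkovian τ T) (f : Elem M) (ξ : H) :
    ‖(T f : H →L[ℂ] H) ξ‖ ^ 2 ≤ (⟪ξ, (T (star f * f) : H →L[ℂ] H) ξ⟫_ℂ).re := by
  -- The choice η = -(T f)ξ completes the square: the terms involving η add up to -‖(T f)ξ‖².
  have h := hT.two_positive f ξ (-(T f : H →L[ℂ] H) ξ)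
  rw [hT.map_star, Elem.inner_star, inner_neg_right, inner_neg_left, inner_neg_neg,
    neg_add_cancel, add_zero, inner_self_eq_norm_sq_to_K] at h
  have h' := (Complex.le_def.mp h).1
  rw [Complex.add_re, Complex.neg_re] at h'
  have e : (((‖(T f : H →L[ℂ] H) ξ‖ : ℝ) : ℂ) ^ 2).re = ‖(T f : H →L[ℂ] H) ξ‖ ^ 2 := by norm_cast
  simp only [Complex.coe_algebraMap, e, Complex.zero_re] at h'
  linarith

end IsMarkovian

/-! ### Norm estimates for the Poisson semigroup on Hölder elements, and part (i) -/

namespace MarkovSemigroup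

variable (T : MarkovSemigroup τ)

theorem norm_op_le {t : ℝ} (ht : 0 ≤ t) (f : Elem M) : ‖T.op t f‖ ≤ ‖f‖ :=
  (T.markovian t ht).norm_le f

theorem op_op {s t : ℝ} (hs : 0 ≤ s) (ht : 0 ≤ t) (f : Elem M) :
    T.op s (T.op t f) = T.op (s + t) f := by
  rw [T.op_add s t hs ht]; rfl

theorem op_zero_apply (f : Elem M) : T.op 0 f = f := by rw [T.op_zero]; rfl

theorem norm_inner_op_le (f : Elem M) (ξ η : H) {v : ℝ} (hv : 0 ≤ v) :
    ‖⟪ξ, (T.op v f : H →L[ℂ] H) η⟫_ℂ‖ ≤ ‖f‖ * ‖ξ‖ * ‖η‖ := by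
  refine (Elem.norm_inner_le _ ξ η).trans ?_
  gcongr; exact T.norm_op_le hv f

theorem inner_poisson_integrableOn {κ : ℝ → ℝ} (hκ : IntegrableOn κ (Ioi 0)) (f : Elem M)
    (ξ η : H) :
    IntegrableOn (fun v => (κ v : ℂ) * ⟪ξ, (T.op v f : H →L[ℂ] H) η⟫_ℂ) (Ioi 0) :=
  subordinator_mul_integrableOn hκ ((T.continuousOn_inner f ξ η).mono Ioi_subset_Ici_self)
    fun _ hv => T.norm_inner_op_le f ξ η (le_of_lt hv)

theorem norm_poisson_le {s : ℝ} (hs : 0 < s) (f : Elem M) : ‖T.poisson s f‖ ≤ ‖f‖ := by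
  refine Elem.norm_le_of_inner (norm_nonneg _) fun ξ η => ?_
  rw [T.inner_poisson hs]
  exact norm_integral_subordinator_mul_le hs fun v hv => T.norm_inner_op_le f ξ η (le_of_lt hv)

theorem poisson_sub {s : ℝ} (hs : 0 < s) (f g : Elem M) :
    T.poisson s (f - g) = T.poisson s f - T.poisson s g := by
  refine Elem.ext_inner fun ξ η => ?_
  have e : ⟪ξ, ((T.poisson s f - T.poisson s g : Elem M) : H →L[ℂ] H) η⟫_ℂ =
      ⟪ξ, (T.poisson s f : H →L[ℂ] H) η⟫_ℂ - ⟪ξ, (T.poisson s g : H →L[ℂ] H) η⟫_ℂ :=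
    inner_sub_right _ _ _
  rw [e]
  simp only [T.inner_poisson hs]
  rw [← integral_sub (T.inner_poisson_integrableOn (subordinator_integrableOn hs) f ξ η)
    (T.inner_poisson_integrableOn (subordinator_integrableOn hs) g ξ η)]
  congr 1; ext v
  rw [map_sub, ← mul_sub]
  congr 1
  exact inner_sub_right _ _ _

theorem poisson_star {s : ℝ} (hs : 0 < s) (f : Elem M) :
    T.poisson s (star f) = star (T.poisson s f) := by
  refine Elem.ext_inner fun ξ η => ?_
  rw [Elem.inner_star, ← inner_conj_symm ((T.poisson s f : H →L[ℂ] H) ξ) η, T.inner_poisson hs,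
    T.inner_poisson hs, ← integral_conj]
  refine setIntegral_congr_fun measurableSet_Ioi fun v hv => ?_
  rw [(T.markovian v (le_of_lt hv)).map_star, Elem.inner_star, map_mul, inner_conj_symm,
    Complex.conj_ofReal]

/-- The second-order remainder of s ↦ φ_s is O(h²) in L¹(dv), and T_v is contractive, so the
difference quotients converge in operator norm. Hence the `deriv` in `holder` is a genuine
derivative and never the default value 0. -/
theorem differentiableAt_poisson {s : ℝ} (hs : 0 < s) (f : Elem M) :
    DifferentiableAt ℝ (fun r : ℝ => (T.poisson r f : H →L[ℂ] H)) s := by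
  obtain ⟨g, hg⟩ := exists_weakIntegral (subordinatorDeriv_integrableOn hs)
    (F := fun v => (T.op v f : H →L[ℂ] H))
    (fun ξ η => (T.continuousOn_inner f ξ η).mono Ioi_subset_Ici_self)
    (fun v hv => T.norm_op_le (le_of_lt hv) f)
  have hM := subordinatorMajorant_integrableOn hs
  set K := ∫ v in Ioi 0, |subordinatorMajorant s v| with hK
  have hK0 : 0 ≤ K := integral_nonneg fun v => abs_nonneg _
  refine HasDerivAt.differentiableAt (f' := g) ?_
  rw [hasDerivAt_iff_isLittleO_nhds_zero]
  refine Asymptotics.IsBigO.trans_isLittleO (g := fun h : ℝ => h ^ 2) ?_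
    (Asymptotics.isLittleO_pow_id one_lt_two)
  refine Asymptotics.IsBigO.of_bound (K * ‖f‖) ?_
  filter_upwards [Metric.ball_mem_nhds (0 : ℝ) (half_pos hs)] with h hh
  rw [mem_ball_zero_iff, Real.norm_eq_abs] at hh
  rw [norm_pow, Real.norm_eq_abs, sq_abs]
  have hsh : 0 < s + h := by linarith [(abs_lt.mp hh).1]
  refine opNorm_le_of_inner_le (by positivity) fun ξ η => ?_
  have hb : ∀ v ∈ Ioi (0 : ℝ), ‖⟪ξ, (T.op v f : H →L[ℂ] H) η⟫_ℂ‖ ≤ ‖f‖ * ‖ξ‖ * ‖η‖ :=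
    fun v hv => T.norm_inner_op_le f ξ η (le_of_lt hv)
  have e : ⟪ξ, ((T.poisson (s + h) f : H →L[ℂ] H) - (T.poisson s f : H →L[ℂ] H) - h • g) η⟫_ℂ =
      ∫ v in Ioi 0, (((subordinator (s + h) v - subordinator s v - h * subordinatorDeriv s v : ℝ)) : ℂ)
        * ⟪ξ, (T.op v f : H →L[ℂ] H) η⟫_ℂ := by
    have e1 : ⟪ξ, ((T.poisson (s + h) f : H →L[ℂ] H) - (T.poisson s f : H →L[ℂ] H) - h • g) η⟫_ℂ =
        ⟪ξ, (T.poisson (s + h) f : H →L[ℂ] H) η⟫_ℂ - ⟪ξ, (T.poisson s f : H →L[ℂ] H) η⟫_ℂ -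
        h * ⟪ξ, g η⟫_ℂ := by
      simp only [sub_apply, smul_apply, inner_sub_right]
      congr 1
      rw [← Complex.coe_smul, inner_smul_right]
    have i1 := T.inner_poisson_integrableOn (subordinator_integrableOn hsh) f ξ η
    have i2 := T.inner_poisson_integrableOn (subordinator_integrableOn hs) f ξ η
    have i3 := (T.inner_poisson_integrableOn (subordinatorDeriv_integrableOn hs) f ξ η).const_mul
      (h : ℂ)
    have i12 : IntegrableOn (fun v => (subordinator (s + h) v : ℂ) * ⟪ξ, (T.op v f : H →L[ℂ] H) η⟫_ℂ -
        subordinator s v * ⟪ξ, (T.op v f : H →L[ℂ] H) η⟫_ℂ) (Ioi 0) := i1.sub i2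
    rw [e1, T.inner_poisson hsh, T.inner_poisson hs, hg, ← integral_const_mul, ← integral_sub i1 i2,
      ← integral_sub i12 i3]
    congr 1; ext v; push_cast; ring
  have iR : IntegrableOn (fun v => subordinator (s + h) v - subordinator s v -
      h * subordinatorDeriv s v) (Ioi 0) :=
    ((subordinator_integrableOn hsh).sub (subordinator_integrableOn hs)).sub
      ((subordinatorDeriv_integrableOn hs).const_mul h)
  rw [e]
  refine (norm_integral_mul_le iR hb).trans ?_
  have h2 : ∫ v in Ioi 0, |subordinator (s + h) v - subordinator s v - h * subordinatorDeriv s v| ≤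
      K * h ^ 2 := by
    rw [hK, ← integral_mul_const]
    refine setIntegral_mono_on iR.abs (hM.abs.mul_const _) measurableSet_Ioi fun v hv => ?_
    refine (abs_subordinator_sub_sub_le hs hv hh.le).trans ?_
    gcongr; exact le_abs_self _
  calc _ ≤ K * h ^ 2 * (‖f‖ * ‖ξ‖ * ‖η‖) := by gcongr
    _ = _ := by ring

theorem norm_deriv_poisson_le {α : ℝ} {f : Elem M} (hf : T.holder α f ≠ ∞) {s : ℝ} (hs : 0 < s) :
    ‖deriv (fun r : ℝ => (T.poisson r f : H →L[ℂ] H)) s‖ ≤ (T.holder α f).toReal * s ^ (α - 1) := by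
  have h1 : ENNReal.ofReal (s ^ (1 - α) * ‖deriv (fun r : ℝ => (T.poisson r f : H →L[ℂ] H)) s‖) ≤
      T.holder α f := le_iSup₂ (f := fun (s : ℝ) (_ : 0 < s) => ENNReal.ofReal (s ^ (1 - α) *
        ‖deriv (fun r : ℝ => (T.poisson r f : H →L[ℂ] H)) s‖)) s hs
  have h2 := (ENNReal.ofReal_le_iff_le_toReal hf).mp h1
  have h3 : s ^ (α - 1) * s ^ (1 - α) = 1 := by
    rw [← Real.rpow_add hs]; simp
  have hp : 0 < s ^ (α - 1) := Real.rpow_pos_of_pos hs _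
  calc _ = s ^ (α - 1) * (s ^ (1 - α) * ‖deriv (fun r : ℝ => (T.poisson r f : H →L[ℂ] H)) s‖) := by
        rw [← mul_assoc, h3, one_mul]
    _ ≤ s ^ (α - 1) * (T.holder α f).toReal := by gcongr
    _ = _ := mul_comm _ _

/-- Integration of ‖(d/ds) P_s f‖ ≤ K s^(α-1), carried out by comparison with the boundary function
(K/α)(x^α - a^α). -/
theorem norm_poisson_sub_poisson_le {α : ℝ} (hα : 0 < α) {f : Elem M} (hf : T.holder α f ≠ ∞)
    {a b : ℝ} (ha : 0 < a) (hab : a ≤ b) :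
    ‖T.poisson b f - T.poisson a f‖ ≤ (T.holder α f).toReal / α * (b ^ α - a ^ α) := by
  set K := (T.holder α f).toReal with hK
  have hK0 : 0 ≤ K := ENNReal.toReal_nonneg
  set F : ℝ → H →L[ℂ] H := fun r => (T.poisson r f : H →L[ℂ] H) with hF
  have hd : ∀ s, 0 < s → HasDerivAt F (deriv F s) s := fun s hs =>
    (T.differentiableAt_poisson hs f).hasDerivAt
  have hB : ∀ s, 0 < s → HasDerivAt (fun s => K / α * s ^ α) (K * s ^ (α - 1)) s := by
    intro s hs
    refine ((Real.hasDerivAt_rpow_const (Or.inl hs.ne')).const_mul (K / α)).congr_deriv ?_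
    field_simp
  have hpos : ∀ x ∈ Icc a b, 0 < x := fun x hx => ha.trans_le hx.1
  have := image_norm_le_of_norm_deriv_right_le_deriv_boundary' (f := fun x => F x - F a)
    (f' := deriv F) (B := fun x => K / α * (x ^ α - a ^ α)) (B' := fun x => K * x ^ (α - 1))
    (a := a) (b := b)
    (fun x hx => ((hd x (hpos x hx)).continuousAt.sub continuousAt_const).continuousWithinAt)
    (fun x hx => ((hd x (ha.trans_le hx.1)).sub_const _).hasDerivWithinAt) (by simp)
    (fun x hx => by
      have := (hB x (hpos x hx)).continuousAt.sub (continuousAt_const (y := K / α * a ^ α))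
      simp only [mul_sub]
      exact this.continuousWithinAt)
    (fun x hx => by
      have := (hB x (ha.trans_le hx.1)).sub_const (K / α * a ^ α)
      simp only [mul_sub]
      exact this.hasDerivWithinAt)
    (fun x hx => T.norm_deriv_poisson_le hf (ha.trans_le hx.1)) (right_mem_Icc.mpr hab)
  exact this

theorem tendsto_inner_poisson (f : Elem M) (ξ η : H) :
    Tendsto (fun s => ⟪ξ, (T.poisson s f : H →L[ℂ] H) η⟫_ℂ) (𝓝[>] 0)
      (𝓝 ⟪ξ, (f : H →L[ℂ] H) η⟫_ℂ) := by
  have h := tendsto_integral_subordinator (T.continuousOn_inner f ξ η)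
    fun v hv => T.norm_inner_op_le f ξ η hv
  rw [T.op_zero_apply] at h
  refine h.congr' ?_
  filter_upwards [self_mem_nhdsWithin] with s hs
  rw [T.inner_poisson hs]

/-- The case a → 0 of the preceding bound. P_a f need not converge to f in norm, so the limit is
taken in matrix coefficients, where the norm bound survives. -/
theorem norm_sub_poisson_le {α : ℝ} (hα : 0 < α) {f : Elem M} (hf : T.holder α f ≠ ∞)
    {s : ℝ} (hs : 0 < s) :
    ‖f - T.poisson s f‖ ≤ (T.holder α f).toReal / α * s ^ α := by
  have hK0 : 0 ≤ (T.holder α f).toReal := ENNReal.toReal_nonneg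
  refine Elem.norm_le_of_inner (by positivity) fun ξ η => ?_
  have e : ∀ a b : Elem M, ⟪ξ, ((a - b : Elem M) : H →L[ℂ] H) η⟫_ℂ =
      ⟪ξ, (a : H →L[ℂ] H) η⟫_ℂ - ⟪ξ, (b : H →L[ℂ] H) η⟫_ℂ := fun a b => inner_sub_right _ _ _
  have hlim : Tendsto (fun a => ‖⟪ξ, ((T.poisson a f - T.poisson s f : Elem M) : H →L[ℂ] H) η⟫_ℂ‖)
      (𝓝[>] 0) (𝓝 ‖⟪ξ, ((f - T.poisson s f : Elem M) : H →L[ℂ] H) η⟫_ℂ‖) := by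
    simp only [e]
    exact ((T.tendsto_inner_poisson f ξ η).sub_const _).norm
  refine le_of_tendsto hlim ?_
  filter_upwards [Ioo_mem_nhdsGT hs] with a ha
  refine (Elem.norm_inner_le _ ξ η).trans ?_
  have h := T.norm_poisson_sub_poisson_le hα hf ha.1 ha.2.le
  rw [norm_sub_rev] at h
  have h2 : (T.holder α f).toReal / α * (s ^ α - a ^ α) ≤ (T.holder α f).toReal / α * s ^ α := by
    have : 0 < a ^ α := Real.rpow_pos_of_pos ha.1 _
    gcongr; linarith
  gcongr
  exact h.trans h2

theorem deriv_poisson_star (f : Elem M) {s : ℝ} (hs : 0 < s) :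
    ‖deriv (fun r : ℝ => (T.poisson r (star f) : H →L[ℂ] H)) s‖ =
      ‖deriv (fun r : ℝ => (T.poisson r f : H →L[ℂ] H)) s‖ := by
  have h : (fun r : ℝ => (T.poisson r (star f) : H →L[ℂ] H)) =ᶠ[𝓝 s]
      fun r => star (T.poisson r f : H →L[ℂ] H) := by
    filter_upwards [Ioi_mem_nhds hs] with r hr
    rw [T.poisson_star hr]; rfl
  rw [h.deriv_eq, (T.differentiableAt_poisson hs f).hasDerivAt.star.deriv, norm_star]

theorem holder_star (α : ℝ) (f : Elem M) : T.holder α (star f) = T.holder α f := by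
  unfold holder
  refine iSup_congr fun s => iSup_congr fun hs => ?_
  rw [T.deriv_poisson_star f hs]

theorem bigLipColumn_le {α : ℝ} (hα : 0 < α) (f : Elem M) :
    T.bigLipColumn α f ≤ (Real.toNNReal (1 / α) : ℝ≥0∞) * T.holder α f := by
  by_cases hf : T.holder α f = ∞
  -- The right side is ∞ only because the constant is nonzero: in `ℝ≥0∞`, 0 · ∞ = 0.
  · rw [hf, ENNReal.mul_top (by simpa using hα)]; exact le_top
  refine iSup₂_le fun s hs => ?_
  have hK0 : 0 ≤ (T.holder α f).toReal := ENNReal.toReal_nonneg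
  have h1 := T.norm_sub_poisson_le hα hf hs
  have h2 : ‖T.poisson s (star (f - T.poisson s f) * (f - T.poisson s f))‖ ≤
      ((T.holder α f).toReal / α * s ^ α) ^ 2 := by
    refine (T.norm_poisson_le hs _).trans ?_
    rw [CStarRing.norm_star_mul_self, ← sq]
    gcongr
  have h3 : √‖T.poisson s (star (f - T.poisson s f) * (f - T.poisson s f))‖ ≤
      (T.holder α f).toReal / α * s ^ α := Real.sqrt_le_iff.mpr ⟨by positivity, h2⟩
  have h4 : s ^ (-α) * s ^ α = 1 := by rw [← Real.rpow_add hs]; simp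
  have hp : 0 < s ^ (-α) := Real.rpow_pos_of_pos hs _
  calc _ ≤ ENNReal.ofReal (1 / α * (T.holder α f).toReal) := by
        refine ENNReal.ofReal_le_ofReal ?_
        calc _ ≤ s ^ (-α) * ((T.holder α f).toReal / α * s ^ α) := by gcongr; exact h3
          _ = (T.holder α f).toReal / α * (s ^ (-α) * s ^ α) := by ring
          _ = _ := by rw [h4]; ring
    _ = _ := by
        rw [ENNReal.ofReal_mul (by positivity), ENNReal.ofReal_toReal hf]; rfl

end MarkovSemigroup

theorem Side.version_le {E : Type*} [Star E] {p q : E → ℝ≥0∞} {C : ℝ≥0∞} (hpq : ∀ f, p f ≤ C * q f)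
    (hq : ∀ f, q (star f) = q f) (d : Side) (f : E) : d.version p f ≤ C * q f := by
  cases d with
  | column => exact hpq f
  | row => exact hq f ▸ hpq (star f)
  | symmetric => exact max_le (hpq f) (hq f ▸ hpq (star f))

end SemigroupHolder

namespace SemigroupHolder

variable {H : Type*} [NormedAddCommGroup H] [InnerProductSpace ℂ H] [CompleteSpace H]
  {M : VonNeumannAlgebra H} {τ : NSFTrace M}

/-! ### Normal functionals -/

/-- The diagonal action of `M` on `ℓ²(ℕ; H)`. -/
def Elem.amplify (f : Elem M) (η : lp (fun _ : ℕ => H) 2) : lp (fun _ : ℕ => H) 2 :=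
  ⟨fun n => (f : H →L[ℂ] H) (η n), by
    have h := (lp.memℓp η).summable (by norm_num)
    refine memℓp_gen (Summable.of_nonneg_of_le (fun n => by positivity) (fun n => ?_)
      (h.mul_left (‖f‖ ^ (2 : ℝ≥0∞).toReal)))
    rw [← Real.mul_rpow (norm_nonneg _) (norm_nonneg _)]
    exact Real.rpow_le_rpow (norm_nonneg _) ((f : H →L[ℂ] H).le_opNorm _) (by norm_num)⟩

theorem Elem.amplify_add (f g : Elem M) (η : lp (fun _ : ℕ => H) 2) :
    (f + g).amplify η = f.amplify η + g.amplify η := by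
  ext n; rfl

theorem Elem.amplify_sub (f g : Elem M) (η : lp (fun _ : ℕ => H) 2) :
    (f - g).amplify η = f.amplify η - g.amplify η := by
  ext n; rfl

theorem Elem.amplify_smul (c : ℂ) (f : Elem M) (η : lp (fun _ : ℕ => H) 2) :
    (c • f).amplify η = c • f.amplify η := by
  ext n; rfl

theorem normalFunctional_eq_inner (ξ η : lp (fun _ : ℕ => H) 2) (f : Elem M) :
    normalFunctional M ξ η f = ⟪ξ, f.amplify η⟫_ℂ := by
  rw [lp.inner_eq_tsum]; rfl

theorem hasSum_normalFunctional (ξ η : lp (fun _ : ℕ => H) 2) (f : Elem M) :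
    HasSum (fun n => ⟪ξ n, (f : H →L[ℂ] H) (η n)⟫_ℂ) (normalFunctional M ξ η f) :=
  (lp.summable_inner ξ (f.amplify η)).hasSum

theorem normalFunctional_star_mul (ξ η : lp (fun _ : ℕ => H) 2) (f g : Elem M) :
    normalFunctional M ξ η (star f * g) = ⟪f.amplify ξ, g.amplify η⟫_ℂ := by
  rw [lp.inner_eq_tsum, normalFunctional]
  congr 1; ext n
  exact Elem.inner_star_mul f g _ _

/-- `normalFunctional` as a linear functional. -/
def normalLinear (M : VonNeumannAlgebra H) (ξ η : lp (fun _ : ℕ => H) 2) : Elem M →ₗ[ℂ] ℂ where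
  toFun := normalFunctional M ξ η
  map_add' f g := by
    simp only [normalFunctional_eq_inner, Elem.amplify_add, inner_add_right]
  map_smul' c f := by
    simp only [normalFunctional_eq_inner, Elem.amplify_smul, inner_smul_right, RingHom.id_apply,
      smul_eq_mul]

theorem normalFunctional_single (ξ η : H) (f : Elem M) :
    normalFunctional M (lp.single 2 0 ξ) (lp.single 2 0 η) f = ⟪ξ, (f : H →L[ℂ] H) η⟫_ℂ := by
  simp only [normalFunctional]
  rw [tsum_eq_single 0]
  · simp
  · intro n hn
    simp [lp.single_apply, hn]

theorem normalFunctional_continuous (ξ η : lp (fun _ : ℕ => H) 2) :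
    @Continuous _ _ (weakStar M) _ (normalFunctional M ξ η) :=
  continuous_iff_le_induced.mpr (iInf₂_le _ _)

theorem tendsto_weakStar_iff {ι : Type*} {F : ι → Elem M} {l : Filter ι} {g : Elem M} :
    Tendsto F l (@nhds _ (weakStar M) g) ↔ ∀ ξ η : lp (fun _ : ℕ => H) 2,
      Tendsto (fun i => normalFunctional M ξ η (F i)) l (𝓝 (normalFunctional M ξ η g)) := by
  simp only [nhds_iInf, nhds_induced, tendsto_iInf, tendsto_comap_iff]
  rfl

/-- The sequence that alternates between two given ones. -/
def interleave (ξ ξ' : lp (fun _ : ℕ => H) 2) : lp (fun _ : ℕ => H) 2 :=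
  ⟨fun n => if Even n then ξ (n / 2) else ξ' (n / 2), by
    refine memℓp_gen (HasSum.summable (HasSum.even_add_odd
      (m := ∑' n, ‖ξ n‖ ^ (2 : ℝ≥0∞).toReal) (m' := ∑' n, ‖ξ' n‖ ^ (2 : ℝ≥0∞).toReal) ?_ ?_))
    · simpa using ((lp.memℓp ξ).summable (by norm_num)).hasSum
    · simpa [Nat.mul_add_div] using ((lp.memℓp ξ').summable (by norm_num)).hasSum⟩

theorem interleave_even (ξ ξ' : lp (fun _ : ℕ => H) 2) (n : ℕ) :
    interleave ξ ξ' (2 * n) = ξ n := by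
  change (if Even (2 * n) then ξ (2 * n / 2) else ξ' (2 * n / 2)) = ξ n
  simp

theorem interleave_odd (ξ ξ' : lp (fun _ : ℕ => H) 2) (n : ℕ) :
    interleave ξ ξ' (2 * n + 1) = ξ' n := by
  change (if Even (2 * n + 1) then ξ ((2 * n + 1) / 2) else ξ' ((2 * n + 1) / 2)) = ξ' n
  simp [Nat.mul_add_div]

/-- Interleaving realises a sum of two normal functionals as a single one. -/
theorem normalFunctional_interleave (ξ ξ' η η' : lp (fun _ : ℕ => H) 2) (f : Elem M) :
    normalFunctional M (interleave ξ ξ') (interleave η η') f =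
      normalFunctional M ξ η f + normalFunctional M ξ' η' f := by
  refine (hasSum_normalFunctional _ _ _).unique (HasSum.even_add_odd ?_ ?_)
  · simpa only [interleave_even] using hasSum_normalFunctional ξ η f
  · simpa only [interleave_odd] using hasSum_normalFunctional ξ' η' f

/-- A functional continuous for an initial topology lies in the linear span of the defining
functionals, and the family of normal functionals is closed under sums and scalars. -/
theorem exists_eq_normalFunctional (ω : Elem M →ₗ[ℂ] ℂ)
    (hω : @Continuous _ _ (weakStar M) _ ω) :
    ∃ ξ η : lp (fun _ : ℕ => H) 2, ∀ f, ω f = normalFunctional M ξ η f := by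
  have h : ω ∈ Submodule.span ℂ (range fun p : lp (fun _ : ℕ => H) 2 × lp (fun _ : ℕ => H) 2 =>
      normalLinear M p.1 p.2) := by
    rw [LinearMap.mem_span_iff_continuous]
    rw [weakStar] at hω
    rw [iInf_prod]
    exact hω
  clear hω
  induction h using Submodule.span_induction with
  | mem x hx =>
    obtain ⟨p, rfl⟩ := hx
    exact ⟨p.1, p.2, fun f => rfl⟩
  | zero => exact ⟨0, 0, fun f => by simp [normalFunctional_eq_inner]⟩
  | add x y hx hy ihx ihy =>
    obtain ⟨ξ, η, h⟩ := ihx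
    obtain ⟨ξ', η', h'⟩ := ihy
    exact ⟨interleave ξ ξ', interleave η η', fun f => by
      rw [normalFunctional_interleave, LinearMap.add_apply, h, h']⟩
  | smul c x hx ih =>
    obtain ⟨ξ, η, h⟩ := ih
    exact ⟨starRingEnd ℂ c • ξ, η, fun f => by
      rw [normalFunctional_eq_inner, inner_smul_left, Complex.conj_conj, LinearMap.smul_apply, h,
        normalFunctional_eq_inner, smul_eq_mul]⟩

theorem Elem.norm_amplify_le (f : Elem M) (η : lp (fun _ : ℕ => H) 2) :
    ‖f.amplify η‖ ≤ ‖f‖ * ‖η‖ := by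
  refine lp.norm_le_of_forall_sum_le (by norm_num) (by positivity) fun s => ?_
  calc ∑ i ∈ s, ‖f.amplify η i‖ ^ (2 : ℝ≥0∞).toReal
      ≤ ∑ i ∈ s, ‖f‖ ^ (2 : ℝ≥0∞).toReal * ‖η i‖ ^ (2 : ℝ≥0∞).toReal := by
        refine Finset.sum_le_sum fun i _ => ?_
        rw [← Real.mul_rpow (norm_nonneg _) (norm_nonneg _)]
        exact Real.rpow_le_rpow (norm_nonneg _) ((f : H →L[ℂ] H).le_opNorm _) (by norm_num)
    _ ≤ ‖f‖ ^ (2 : ℝ≥0∞).toReal * ‖η‖ ^ (2 : ℝ≥0∞).toReal := by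
        rw [← Finset.mul_sum]
        gcongr
        exact lp.sum_rpow_le_norm_rpow (by norm_num) η s
    _ = _ := (Real.mul_rpow (norm_nonneg _) (norm_nonneg _)).symm

theorem norm_normalFunctional_le (ξ η : lp (fun _ : ℕ => H) 2) (f : Elem M) :
    ‖normalFunctional M ξ η f‖ ≤ ‖f‖ * ‖ξ‖ * ‖η‖ := by
  rw [normalFunctional_eq_inner]
  calc _ ≤ ‖ξ‖ * ‖f.amplify η‖ := norm_inner_le_norm _ _
    _ ≤ ‖ξ‖ * (‖f‖ * ‖η‖) := by gcongr; exact f.norm_amplify_le η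
    _ = _ := by ring

theorem tendsto_weakStar_of_tendsto {ι : Type*} {F : ι → Elem M} {l : Filter ι} {g : Elem M}
    (h : Tendsto F l (𝓝 g)) : Tendsto F l (@nhds _ (weakStar M) g) := by
  refine tendsto_weakStar_iff.mpr fun ξ η => ?_
  rw [tendsto_iff_norm_sub_tendsto_zero] at h ⊢
  refine squeeze_zero (fun _ => norm_nonneg _) (fun i => ?_) (by simpa using h.mul_const (‖ξ‖ * ‖η‖))
  have e := (normalLinear M ξ η).map_sub (F i) g
  change ‖normalLinear M ξ η (F i) - normalLinear M ξ η g‖ ≤ _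
  rw [← e, ← mul_assoc]
  exact norm_normalFunctional_le ξ η _

theorem eq_of_tendsto_weakStar {ι : Type*} {F : ι → Elem M} {l : Filter ι} [l.NeBot] {g g' : Elem M}
    (h : Tendsto F l (@nhds _ (weakStar M) g)) (h' : Tendsto F l (@nhds _ (weakStar M) g')) :
    g = g' := by
  refine Elem.ext_inner fun ξ η => ?_
  rw [← normalFunctional_single, ← normalFunctional_single]
  exact tendsto_nhds_unique (tendsto_weakStar_iff.mp h _ _) (tendsto_weakStar_iff.mp h' _ _)

/-- Uniform boundedness, once for the functionals and once for the operators. It is stated for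
sequences because a convergent net may be unbounded. -/
theorem bounded_of_tendsto_inner {F : ℕ → Elem M} {g : Elem M}
    (h : ∀ ξ η : H, Tendsto (fun n => ⟪ξ, (F n : H →L[ℂ] H) η⟫_ℂ) atTop
      (𝓝 ⟪ξ, (g : H →L[ℂ] H) η⟫_ℂ)) : ∃ C : ℝ, ∀ n, ‖F n‖ ≤ C := by
  refine banach_steinhaus (g := fun n => (F n : H →L[ℂ] H)) fun η => ?_
  obtain ⟨C, hC⟩ := banach_steinhaus (g := fun n => innerSL ℂ ((F n : H →L[ℂ] H) η)) fun ξ => by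
    obtain ⟨C, hC⟩ := (h ξ η).norm.bddAbove_range
    refine ⟨C, fun n => ?_⟩
    rw [innerSL_apply_apply, norm_inner_symm]
    exact hC (mem_range_self n)
  exact ⟨C, fun n => by simpa using hC n⟩

/-! ### Interplay of P_s and T_t, the semigroup law, and the bound for T_t P_s - P_s -/

namespace MarkovSemigroup

variable (T : MarkovSemigroup τ)

/-- Extends the weak integral formula from vector functionals to all normal ones, by exchanging sum
and integral. It is needed because composing a vector functional with T_u gives a normal functional
that need not be a vector functional. -/
theorem normalFunctional_poisson {s : ℝ} (hs : 0 < s) (f : Elem M) (ξ η : lp (fun _ : ℕ => H) 2) :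
    normalFunctional M ξ η (T.poisson s f) =
      ∫ v in Ioi 0, (subordinator s v : ℂ) * normalFunctional M ξ η (T.op v f) := by
  have hφ := subordinator_integrableOn hs
  have hsum : Summable fun n => ‖ξ n‖ * ‖η n‖ := by
    have h := lp.summable_mul (p := 2) (q := 2) (by
      rw [ENNReal.toReal_ofNat]; exact Real.HolderConjugate.two_two) ξ η
    exact h
  have h := hasSum_integral_of_summable_integral_norm
    (F := fun n v => (subordinator s v : ℂ) * ⟪ξ n, (T.op v f : H →L[ℂ] H) (η n)⟫_ℂ)
    (μ := volume.restrict (Ioi (0 : ℝ)))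
    (fun n => T.inner_poisson_integrableOn hφ f (ξ n) (η n)) (by
      refine Summable.of_nonneg_of_le (fun n => integral_nonneg fun v => norm_nonneg _) (fun n => ?_)
        (hsum.mul_left ‖f‖)
      calc _ ≤ ∫ v in Ioi 0, subordinator s v * (‖f‖ * ‖ξ n‖ * ‖η n‖) := by
            refine setIntegral_mono_on (T.inner_poisson_integrableOn hφ f (ξ n) (η n)).norm
              (hφ.mul_const _) measurableSet_Ioi fun v hv => ?_
            rw [norm_mul, Complex.norm_real, Real.norm_eq_abs,
              abs_of_nonneg (subordinator_nonneg hs.le (le_of_lt hv))]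
            exact mul_le_mul_of_nonneg_left (T.norm_inner_op_le f _ _ (le_of_lt hv))
              (subordinator_nonneg hs.le (le_of_lt hv))
        _ = _ := by rw [integral_mul_const, integral_subordinator hs]; ring)
  refine (hasSum_normalFunctional ξ η _).unique ?_
  simp only [fun v : ℝ => ((hasSum_normalFunctional ξ η (T.op v f)).mul_left
    (subordinator s v : ℂ)).tsum_eq, ← T.inner_poisson hs] at h
  exact h

theorem exists_inner_op_eq {u : ℝ} (hu : 0 ≤ u) (ξ η : H) :
    ∃ ζ ζ' : lp (fun _ : ℕ => H) 2, ∀ f : Elem M,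
      ⟪ξ, (T.op u f : H →L[ℂ] H) η⟫_ℂ = normalFunctional M ζ ζ' f := by
  obtain ⟨ζ, ζ', h⟩ := exists_eq_normalFunctional
    (normalLinear M (lp.single 2 0 ξ) (lp.single 2 0 η) ∘ₗ T.op u)
    (@Continuous.comp _ _ _ (weakStar M) (weakStar M) _ (T.op u)
      (normalFunctional M (lp.single 2 0 ξ) (lp.single 2 0 η)) (normalFunctional_continuous _ _)
      (T.markovian u hu).weakStar_continuous)
  exact ⟨ζ, ζ', fun f => by rw [← h, ← normalFunctional_single]; rfl⟩

theorem inner_op_poisson {u s : ℝ} (hu : 0 ≤ u) (hs : 0 < s) (f : Elem M) (ξ η : H) :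
    ⟪ξ, (T.op u (T.poisson s f) : H →L[ℂ] H) η⟫_ℂ =
      ∫ v in Ioi 0, (subordinator s v : ℂ) * ⟪ξ, (T.op (u + v) f : H →L[ℂ] H) η⟫_ℂ := by
  obtain ⟨ζ, ζ', h⟩ := T.exists_inner_op_eq hu ξ η
  rw [h, T.normalFunctional_poisson hs]
  refine setIntegral_congr_fun measurableSet_Ioi fun v hv => ?_
  rw [← h, T.op_op hu (le_of_lt hv)]

theorem poisson_op {u s : ℝ} (hu : 0 ≤ u) (hs : 0 < s) (f : Elem M) :
    T.poisson s (T.op u f) = T.op u (T.poisson s f) := by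
  refine Elem.ext_inner fun ξ η => ?_
  rw [T.inner_op_poisson hu hs, T.inner_poisson hs]
  refine setIntegral_congr_fun measurableSet_Ioi fun v hv => ?_
  rw [T.op_op (le_of_lt hv) hu, add_comm]

/-- The matrix coefficient `v ↦ ⟪ξ, T_v f η⟫`, frozen for negative times. -/
def coeff (f : Elem M) (ξ η : H) (v : ℝ) : ℂ := ⟪ξ, (T.op (max v 0) f : H →L[ℂ] H) η⟫_ℂ

theorem coeff_of_nonneg (f : Elem M) (ξ η : H) {v : ℝ} (hv : 0 ≤ v) :
    T.coeff f ξ η v = ⟪ξ, (T.op v f : H →L[ℂ] H) η⟫_ℂ := by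
  rw [coeff, max_eq_left hv]

theorem continuous_coeff (f : Elem M) (ξ η : H) : Continuous (T.coeff f ξ η) :=
  (T.continuousOn_inner f ξ η).comp_continuous (f := fun v : ℝ => max v 0) (by fun_prop)
    fun v => le_max_right v 0

theorem norm_coeff_le (f : Elem M) (ξ η : H) (v : ℝ) : ‖T.coeff f ξ η v‖ ≤ ‖f‖ * ‖ξ‖ * ‖η‖ :=
  T.norm_inner_op_le f ξ η (le_max_right v 0)

theorem inner_op_poisson_eq_coeff {u s : ℝ} (hu : 0 ≤ u) (hs : 0 < s) (f : Elem M) (ξ η : H) :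
    ⟪ξ, (T.op u (T.poisson s f) : H →L[ℂ] H) η⟫_ℂ =
      ∫ v in Ioi 0, (subordinator s v : ℂ) * T.coeff f ξ η (u + v) := by
  rw [T.inner_op_poisson hu hs]
  refine setIntegral_congr_fun measurableSet_Ioi fun v hv => ?_
  rw [T.coeff_of_nonneg f ξ η (add_nonneg hu (le_of_lt hv))]

theorem poisson_poisson {s r : ℝ} (hs : 0 < s) (hr : 0 < r) (f : Elem M) :
    T.poisson s (T.poisson r f) = T.poisson (s + r) f := by
  refine Elem.ext_inner fun ξ η => ?_
  have e : ⟪ξ, (T.poisson (s + r) f : H →L[ℂ] H) η⟫_ℂ =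
      ∫ v in Ioi 0, (subordinator (s + r) v : ℂ) * T.coeff f ξ η v := by
    have := T.inner_op_poisson_eq_coeff le_rfl (add_pos hs hr) f ξ η
    simpa only [T.op_zero_apply, zero_add] using this
  rw [e, ← integral_integral_subordinator hs hr (T.continuous_coeff f ξ η) (T.norm_coeff_le f ξ η),
    T.inner_poisson hs]
  refine setIntegral_congr_fun measurableSet_Ioi fun v hv => ?_
  rw [T.inner_op_poisson_eq_coeff (le_of_lt hv) hr]

theorem inner_op_poisson_sub {s t : ℝ} (hs : 0 < s) (ht : 0 ≤ t) (f : Elem M) (ξ η : H) :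
    ⟪ξ, ((T.op t (T.poisson s f) - T.poisson s f : Elem M) : H →L[ℂ] H) η⟫_ℂ =
      ∫ v in Ioi 0, (subordinator s v : ℂ) * (T.coeff f ξ η (v + t) - T.coeff f ξ η v) := by
  have hc := T.continuous_coeff f ξ η
  have e : ⟪ξ, ((T.op t (T.poisson s f) - T.poisson s f : Elem M) : H →L[ℂ] H) η⟫_ℂ =
      ⟪ξ, (T.op t (T.poisson s f) : H →L[ℂ] H) η⟫_ℂ -
        ⟪ξ, (T.op 0 (T.poisson s f) : H →L[ℂ] H) η⟫_ℂ := by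
    rw [T.op_zero_apply]; exact inner_sub_right _ _ _
  rw [e, T.inner_op_poisson_eq_coeff ht hs, T.inner_op_poisson_eq_coeff le_rfl hs, ← integral_sub
    (subordinator_mul_integrableOn (subordinator_integrableOn hs) (k := fun v => T.coeff f ξ η (t + v))
      (by fun_prop) fun v _ => T.norm_coeff_le f ξ η _)
    (subordinator_mul_integrableOn (subordinator_integrableOn hs) (k := fun v => T.coeff f ξ η (0 + v))
      (by fun_prop) fun v _ => T.norm_coeff_le f ξ η _)]
  congr 1; ext v
  rw [zero_add, add_comm t v, mul_sub]

/-- Obtained from `integral_subordinator_mul_shift_sub` and ∫ |∂_v φ_s| ≲ s⁻². The constant stems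
from the kernel alone, so it is chosen before the algebra and the semigroup. -/
theorem exists_norm_op_poisson_sub_le : ∃ C : ℝ, 0 ≤ C ∧ ∀ (H : Type*) [NormedAddCommGroup H]
    [InnerProductSpace ℂ H] [CompleteSpace H] (M : VonNeumannAlgebra H) (τ : NSFTrace M)
    (T : MarkovSemigroup τ) {s t : ℝ}, 0 < s → 0 ≤ t → ∀ f : Elem M,
      ‖T.op t (T.poisson s f) - T.poisson s f‖ ≤ C * (t / s ^ 2) * ‖f‖ := by
  obtain ⟨C, hC0, hC⟩ := exists_integral_abs_subordinatorDeriv₂_le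
  refine ⟨C * 2, by positivity, fun H _ _ _ M τ T s t hs ht f =>
    Elem.norm_le_of_inner (by positivity) fun ξ η => ?_⟩
  rw [T.inner_op_poisson_sub hs ht, integral_subordinator_mul_shift_sub hs ht
    (T.continuous_coeff f ξ η) (T.norm_coeff_le f ξ η), norm_neg]
  have hb : ∀ v ∈ Ioi (0 : ℝ), ‖∫ u in (0 : ℝ)..t, (T.coeff f ξ η (v + u) - T.coeff f ξ η u)‖ ≤
      2 * (‖f‖ * ‖ξ‖ * ‖η‖) * t := by
    intro v _
    refine (intervalIntegral.norm_integral_le_of_norm_le_const (C := 2 * (‖f‖ * ‖ξ‖ * ‖η‖))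
      fun u _ => (norm_sub_le _ _).trans ?_).trans ?_
    · linarith [T.norm_coeff_le f ξ η (v + u), T.norm_coeff_le f ξ η u]
    · rw [sub_zero, abs_of_nonneg ht]
  refine (norm_integral_mul_le (subordinatorDeriv₂_integrableOn hs) hb).trans ?_
  calc _ ≤ C / s ^ 2 * (2 * (‖f‖ * ‖ξ‖ * ‖η‖) * t) := by gcongr; exact hC s hs
    _ = _ := by ring

end MarkovSemigroup

end SemigroupHolder

namespace SemigroupHolder

variable {H : Type*} [NormedAddCommGroup H] [InnerProductSpace ℂ H] [CompleteSpace H]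
  {M : VonNeumannAlgebra H} {τ : NSFTrace M}

theorem isLittleO_sub_sq (a : ℝ) (s : Set ℝ) :
    (fun x : ℝ => (x - a) ^ 2) =o[𝓝[s] a] fun x => x - a := by
  have h := Asymptotics.isLittleO_pow_sub_sub a one_lt_two
  simp only [Real.norm_eq_abs, sq_abs] at h
  exact h.mono nhdsWithin_le_nhds

namespace MarkovSemigroup

variable (T : MarkovSemigroup τ)

/-! ### The generator on a test algebra -/

theorem tendsto_inner_op {u : ℝ} (hu : 0 ≤ u) {ι : Type*} {F : ι → Elem M} {l : Filter ι}
    {g : Elem M} (h : Tendsto F l (@nhds _ (weakStar M) g)) (ξ η : H) :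
    Tendsto (fun i => ⟪ξ, (T.op u (F i) : H →L[ℂ] H) η⟫_ℂ) l
      (𝓝 ⟪ξ, (T.op u g : H →L[ℂ] H) η⟫_ℂ) := by
  obtain ⟨ζ, ζ', he⟩ := T.exists_inner_op_eq hu ξ η
  simp only [he]
  exact tendsto_weakStar_iff.mp h ζ ζ'

/-- For each v the integrand converges by weak-* continuity of T_{u+v}. Norm boundedness of the
sequence gives the dominating function. -/
theorem tendsto_inner_op_poisson {u s : ℝ} (hu : 0 ≤ u) (hs : 0 < s) {F : ℕ → Elem M}
    {g : Elem M} (h : Tendsto F atTop (@nhds _ (weakStar M) g)) (ξ η : H) :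
    Tendsto (fun n => ⟪ξ, (T.op u (T.poisson s (F n)) : H →L[ℂ] H) η⟫_ℂ) atTop
      (𝓝 ⟪ξ, (T.op u (T.poisson s g) : H →L[ℂ] H) η⟫_ℂ) := by
  obtain ⟨C, hC⟩ := bounded_of_tendsto_inner fun ξ η => by
    have := T.tendsto_inner_op le_rfl h ξ η
    simpa only [T.op_zero_apply] using this
  simp only [T.inner_op_poisson hu hs]
  refine tendsto_integral_of_dominated_convergence
    (fun v => |subordinator s v| * (C * ‖ξ‖ * ‖η‖)) (fun n => ?_)
    ((subordinator_integrableOn hs).abs.mul_const _) (fun n => ?_) ?_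
  · refine (ContinuousOn.mul (Complex.continuous_ofReal.comp_continuousOn
      (subordinator_continuousOn s)) ((T.continuousOn_inner (F n) ξ η).comp
      (f := fun v : ℝ => u + v) (by fun_prop) fun v hv => ?_)).aestronglyMeasurable
        measurableSet_Ioi
    exact mem_Ici.mpr (add_nonneg hu (le_of_lt hv))
  · filter_upwards [ae_restrict_mem measurableSet_Ioi] with v hv
    rw [norm_mul, Complex.norm_real, Real.norm_eq_abs]
    have h1 := T.norm_inner_op_le (F n) ξ η (add_nonneg hu (le_of_lt (mem_Ioi.mp hv)))
    have h2 : ‖F n‖ * ‖ξ‖ * ‖η‖ ≤ C * ‖ξ‖ * ‖η‖ := by gcongr; exact hC n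
    exact mul_le_mul_of_nonneg_left (h1.trans h2) (abs_nonneg _)
  · filter_upwards [ae_restrict_mem measurableSet_Ioi] with v hv
    exact (T.tendsto_inner_op (add_nonneg hu (le_of_lt hv)) h ξ η).const_mul _

theorem poisson_smul {s : ℝ} (hs : 0 < s) (c : ℂ) (f : Elem M) :
    T.poisson s (c • f) = c • T.poisson s f := by
  refine Elem.ext_inner fun ξ η => ?_
  have e : ∀ g : Elem M, ⟪ξ, ((c • g : Elem M) : H →L[ℂ] H) η⟫_ℂ = c * ⟪ξ, (g : H →L[ℂ] H) η⟫_ℂ :=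
    fun g => inner_smul_right _ _ _
  rw [e]
  simp only [T.inner_poisson hs]
  rw [← integral_const_mul]
  congr 1; ext v
  rw [map_smul, e]; ring

/-- The derivative exists because the kernel is differentiable, so it can be identified along one
sequence r → 0⁺. There (P_{s+r} f - P_s f)/r = -P_s((f - P_r f)/r), which tends weakly to -P_s g. -/
theorem hasDerivAt_inner_op_poisson {u s : ℝ} (hu : 0 ≤ u) (hs : 0 < s) {f g : Elem M}
    (hfg : HasGenerator T.poisson f g) (ξ η : H) :
    HasDerivAt (fun s => ∫ v in Ioi 0, (subordinator s v : ℂ) * T.coeff f ξ η (u + v))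
      (-⟪ξ, (T.op u (T.poisson s g) : H →L[ℂ] H) η⟫_ℂ) s := by
  have hc := T.continuous_coeff f ξ η
  have hd := hasDerivAt_integral_subordinator (k := fun v => T.coeff f ξ η (u + v)) (by fun_prop)
    (fun v _ => T.norm_coeff_le f ξ η _) hs
  convert hd using 1
  have hr : Tendsto (fun n : ℕ => (1 : ℝ) / (n + 1)) atTop (𝓝[>] 0) :=
    tendsto_nhdsWithin_iff.mpr ⟨tendsto_one_div_add_atTop_nhds_zero_nat,
      Eventually.of_forall fun n => mem_Ioi.mpr (by positivity)⟩
  have h1 := (T.tendsto_inner_op_poisson hu hs (hfg.comp hr) ξ η).neg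
  have h2 := (hasDerivAt_iff_tendsto_slope_zero.mp hd).comp
    (hr.mono_right (nhdsWithin_mono _ fun x (hx : 0 < x) => hx.ne'))
  refine tendsto_nhds_unique (h1.congr fun n => ?_) h2
  have hrn : (0 : ℝ) < 1 / (n + 1) := by positivity
  simp only [Function.comp]
  generalize (1 : ℝ) / (n + 1) = r at hrn
  rw [← T.inner_op_poisson_eq_coeff hu (add_pos hs hrn), ← T.inner_op_poisson_eq_coeff hu hs,
    T.poisson_smul hs, map_smul, T.poisson_sub hs, T.poisson_poisson hs hrn, map_sub]
  have e : ⟪ξ, (((r : ℂ)⁻¹ • (T.op u (T.poisson s f) - T.op u (T.poisson (s + r) f)) : Elem M) :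
      H →L[ℂ] H) η⟫_ℂ = (r : ℂ)⁻¹ * (⟪ξ, (T.op u (T.poisson s f) : H →L[ℂ] H) η⟫_ℂ -
        ⟪ξ, (T.op u (T.poisson (s + r) f) : H →L[ℂ] H) η⟫_ℂ) := by
    rw [← inner_sub_right, ← inner_smul_right]; rfl
  rw [e, Complex.real_smul]
  push_cast; ring

theorem integral_subordinatorDeriv₂_mul_coeff {u s : ℝ} (hu : 0 ≤ u) (hs : 0 < s) {f g h : Elem M}
    (hfg : HasGenerator T.poisson f g) (hgh : HasGenerator T.poisson g h) (ξ η : H) :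
    ∫ v in Ioi 0, (subordinatorDeriv₂ s v : ℂ) * T.coeff f ξ η (u + v) =
      ⟪ξ, (T.op u (T.poisson s h) : H →L[ℂ] H) η⟫_ℂ := by
  have hc := T.continuous_coeff f ξ η
  have hd := hasDerivAt_integral_subordinatorDeriv (k := fun v => T.coeff f ξ η (u + v))
    (by fun_prop) (fun v _ => T.norm_coeff_le f ξ η _) hs
  have hd2 := (T.hasDerivAt_inner_op_poisson hu hs hgh ξ η).neg
  rw [neg_neg] at hd2
  refine hd.unique (hd2.congr_of_eventuallyEq ?_)
  filter_upwards [Ioi_mem_nhds hs] with σ hσ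
  have h1 := hasDerivAt_integral_subordinator (k := fun v => T.coeff f ξ η (u + v)) (by fun_prop)
    (fun v _ => T.norm_coeff_le f ξ η _) hσ
  rw [h1.unique (T.hasDerivAt_inner_op_poisson hu hσ hfg ξ η), Pi.neg_apply,
    T.inner_op_poisson_eq_coeff hu hσ]

/-- The integrated form of `A f = h`: weakly, `f - T_t f = ∫₀ᵗ T_u h du`. -/
def HasIntegralGenerator (f h : Elem M) : Prop :=
  ∀ (ξ η : H) (t : ℝ), 0 ≤ t →
    ⟪ξ, ((f - T.op t f : Elem M) : H →L[ℂ] H) η⟫_ℂ =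
      ∫ u in (0 : ℝ)..t, ⟪ξ, (T.op u h : H →L[ℂ] H) η⟫_ℂ

/-- This is A = (A^{1/2})² in integrated form. After smoothing by P_s, the time increment is an
integral against ∂_v φ_s = ∂_s² φ_s, and two s-derivatives turn f into h. The smoothing is then
removed by s → 0. -/
theorem hasIntegralGenerator_of_poisson {f g h : Elem M} (hfg : HasGenerator T.poisson f g)
    (hgh : HasGenerator T.poisson g h) : T.HasIntegralGenerator f h := by
  intro ξ η t ht
  have key : ∀ s, 0 < s → ⟪ξ, ((T.poisson s (f - T.op t f) : Elem M) : H →L[ℂ] H) η⟫_ℂ =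
      ∫ u in (0 : ℝ)..t, ⟪ξ, (T.op u (T.poisson s h) : H →L[ℂ] H) η⟫_ℂ := by
    intro s hs
    have h1 := T.inner_op_poisson_sub hs ht f ξ η
    rw [integral_subordinator_mul_shift_sub' hs ht (T.continuous_coeff f ξ η)
      (T.norm_coeff_le f ξ η)] at h1
    rw [T.poisson_sub hs, T.poisson_op ht hs, ← neg_sub]
    have e : ∀ a : Elem M, ⟪ξ, ((-a : Elem M) : H →L[ℂ] H) η⟫_ℂ = -⟪ξ, (a : H →L[ℂ] H) η⟫_ℂ :=
      fun a => inner_neg_right _ _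
    rw [e, h1, neg_neg]
    refine intervalIntegral.integral_congr fun u hu => ?_
    rw [uIcc_of_le ht] at hu
    rw [← T.integral_subordinatorDeriv₂_mul_coeff hu.1 hs hfg hgh ξ η]
    simp only [add_comm u]
  refine tendsto_nhds_unique (T.tendsto_inner_poisson (f - T.op t f) ξ η) ?_
  have hlim : Tendsto (fun s => ∫ u in (0 : ℝ)..t, ⟪ξ, (T.op u (T.poisson s h) : H →L[ℂ] H) η⟫_ℂ)
      (𝓝[>] 0) (𝓝 (∫ u in (0 : ℝ)..t, ⟪ξ, (T.op u h : H →L[ℂ] H) η⟫_ℂ)) := by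
    refine intervalIntegral.tendsto_integral_filter_of_dominated_convergence
      (fun _ => ‖h‖ * ‖ξ‖ * ‖η‖) ?_ ?_ intervalIntegrable_const ?_
    · filter_upwards with s
      rw [uIoc_of_le ht]
      exact ((T.continuousOn_inner (T.poisson s h) ξ η).mono fun u hu => le_of_lt hu.1
        ).aestronglyMeasurable measurableSet_Ioc
    · filter_upwards [self_mem_nhdsWithin] with s hs
      refine Eventually.of_forall fun u hu => ?_
      rw [uIoc_of_le ht] at hu
      refine (T.norm_inner_op_le _ ξ η hu.1.le).trans ?_
      gcongr; exact T.norm_poisson_le hs h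
    · refine Eventually.of_forall fun u hu => ?_
      rw [uIoc_of_le ht] at hu
      refine (T.tendsto_inner_poisson (T.op u h) ξ η).congr' ?_
      filter_upwards [self_mem_nhdsWithin] with s hs
      rw [T.poisson_op hu.1.le hs]
  refine hlim.congr' ?_
  filter_upwards [self_mem_nhdsWithin] with s hs using (key s hs).symm

/-! ### Norm differentiability of orbits -/

namespace HasIntegralGenerator

variable {T}

theorem intervalIntegrable_inner (h : Elem M) (ξ η : H) {a b : ℝ} (ha : 0 ≤ a) (hb : 0 ≤ b) :
    IntervalIntegrable (fun u => ⟪ξ, (T.op u h : H →L[ℂ] H) η⟫_ℂ) volume a b :=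
  ((T.continuousOn_inner h ξ η).mono fun _ hu => (le_min ha hb).trans hu.1).intervalIntegrable

theorem op {f h : Elem M} (hf : T.HasIntegralGenerator f h) {u : ℝ} (hu : 0 ≤ u) :
    T.HasIntegralGenerator (T.op u f) (T.op u h) := by
  intro ξ η t ht
  have h1 := hf ξ η u hu
  have h2 := hf ξ η (u + t) (add_nonneg hu ht)
  have e : ⟪ξ, ((T.op u f - T.op t (T.op u f) : Elem M) : H →L[ℂ] H) η⟫_ℂ =
      ⟪ξ, ((f - T.op (u + t) f : Elem M) : H →L[ℂ] H) η⟫_ℂ -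
      ⟪ξ, ((f - T.op u f : Elem M) : H →L[ℂ] H) η⟫_ℂ := by
    rw [← inner_sub_right, T.op_op ht hu, add_comm t u,
      show T.op u f - T.op (u + t) f = (f - T.op (u + t) f) - (f - T.op u f) by abel]
    rfl
  rw [e, h1, h2, intervalIntegral.integral_interval_sub_left
    (intervalIntegrable_inner h ξ η le_rfl (add_nonneg hu ht)) (intervalIntegrable_inner h ξ η le_rfl hu)]
  have := intervalIntegral.integral_comp_add_right (a := 0) (b := t)
    (fun r => ⟪ξ, (T.op r h : H →L[ℂ] H) η⟫_ℂ) u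
  rw [zero_add, add_comm t u] at this
  rw [← this]
  refine intervalIntegral.integral_congr fun r hr => ?_
  rw [uIcc_of_le ht] at hr
  rw [T.op_op hr.1 hu]

theorem norm_op_sub_le {f h : Elem M} (hf : T.HasIntegralGenerator f h) {t : ℝ} (ht : 0 ≤ t) :
    ‖f - T.op t f‖ ≤ t * ‖h‖ := by
  refine Elem.norm_le_of_inner (by positivity) fun ξ η => ?_
  rw [hf ξ η t ht]
  refine (intervalIntegral.norm_integral_le_of_norm_le_const (C := ‖h‖ * ‖ξ‖ * ‖η‖)
    fun u hu => ?_).trans (le_of_eq ?_)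
  · rw [uIoc_of_le ht] at hu
    exact T.norm_inner_op_le h ξ η hu.1.le
  · rw [sub_zero, abs_of_nonneg ht]; ring

/-- The error is the integral of T_u h - h over [0, t]. A generator for h bounds the integrand by
u‖k‖, so weak information yields an expansion in norm. -/
theorem norm_op_sub_sub_le {f h k : Elem M} (hf : T.HasIntegralGenerator f h)
    (hh : T.HasIntegralGenerator h k) {t : ℝ} (ht : 0 ≤ t) :
    ‖f - T.op t f - (t : ℂ) • h‖ ≤ ‖k‖ * t ^ 2 := by
  refine Elem.norm_le_of_inner (by positivity) fun ξ η => ?_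
  have e : ⟪ξ, ((f - T.op t f - (t : ℂ) • h : Elem M) : H →L[ℂ] H) η⟫_ℂ =
      ∫ u in (0 : ℝ)..t, -⟪ξ, ((h - T.op u h : Elem M) : H →L[ℂ] H) η⟫_ℂ := by
    have e1 : ⟪ξ, ((f - T.op t f - (t : ℂ) • h : Elem M) : H →L[ℂ] H) η⟫_ℂ =
        ⟪ξ, ((f - T.op t f : Elem M) : H →L[ℂ] H) η⟫_ℂ - t * ⟪ξ, (h : H →L[ℂ] H) η⟫_ℂ := by
      rw [← inner_smul_right, ← inner_sub_right]; rfl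
    have e2 : ∀ u, -⟪ξ, ((h - T.op u h : Elem M) : H →L[ℂ] H) η⟫_ℂ =
        ⟪ξ, (T.op u h : H →L[ℂ] H) η⟫_ℂ - ⟪ξ, (h : H →L[ℂ] H) η⟫_ℂ := fun u => by
      rw [neg_eq_iff_eq_neg, neg_sub]; exact inner_sub_right _ _ _
    simp only [e2]
    rw [e1, hf ξ η t ht, intervalIntegral.integral_sub (intervalIntegrable_inner h ξ η le_rfl ht)
      intervalIntegrable_const, intervalIntegral.integral_const, sub_zero, Complex.real_smul]
  rw [e]
  refine (intervalIntegral.norm_integral_le_of_norm_le_const (C := t * ‖k‖ * ‖ξ‖ * ‖η‖)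
    fun u hu => ?_).trans (le_of_eq ?_)
  · rw [uIoc_of_le ht] at hu
    rw [norm_neg]
    refine (Elem.norm_inner_le _ ξ η).trans ?_
    gcongr
    refine (hh.norm_op_sub_le hu.1.le).trans ?_
    gcongr; exact hu.2
  · rw [sub_zero, abs_of_nonneg ht]; ring

theorem norm_op_sub_op_le {f h : Elem M} (hf : T.HasIntegralGenerator f h) {a b : ℝ} (ha : 0 ≤ a)
    (hb : 0 ≤ b) : ‖T.op b f - T.op a f‖ ≤ |b - a| * ‖h‖ := by
  wlog hab : a ≤ b generalizing a b
  · rw [norm_sub_rev, abs_sub_comm]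
    exact this hb ha (le_of_not_ge hab)
  have hd := sub_nonneg.mpr hab
  have e : T.op b f = T.op a (T.op (b - a) f) := by rw [T.op_op ha hd]; congr 2; ring
  rw [e, ← map_sub, abs_of_nonneg hd]
  refine (T.norm_op_le ha _).trans ?_
  rw [norm_sub_rev]
  exact hf.norm_op_sub_le hd

/-- For b < a the expansion is made at b. Replacing T_b h by T_a h then costs a second term of the
same order, hence the factor 2. -/
theorem norm_op_sub_op_add_le {f h k : Elem M} (hf : T.HasIntegralGenerator f h)
    (hh : T.HasIntegralGenerator h k) {a b : ℝ} (ha : 0 ≤ a) (hb : 0 ≤ b) :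
    ‖T.op b f - T.op a f - ((b - a : ℝ) : ℂ) • (-T.op a h)‖ ≤ 2 * ‖k‖ * (b - a) ^ 2 := by
  have hk : 0 ≤ ‖k‖ * (b - a) ^ 2 := by positivity
  rcases le_total a b with hab | hab
  · have hd := sub_nonneg.mpr hab
    have e : T.op b f - T.op a f - ((b - a : ℝ) : ℂ) • (-T.op a h) =
        -T.op a (f - T.op (b - a) f - ((b - a : ℝ) : ℂ) • h) := by
      rw [map_sub, map_sub, T.op_op ha hd, map_smul, show a + (b - a) = b by ring, smul_neg]
      abel
    rw [e, norm_neg]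
    exact (T.norm_op_le ha _).trans ((hf.norm_op_sub_sub_le hh hd).trans (by linarith))
  · have hd := sub_nonneg.mpr hab
    have e : T.op b f - T.op a f - ((b - a : ℝ) : ℂ) • (-T.op a h) =
        T.op b (f - T.op (a - b) f - ((a - b : ℝ) : ℂ) • h) +
          ((a - b : ℝ) : ℂ) • (T.op b h - T.op a h) := by
      rw [map_sub, map_sub, T.op_op hb hd, map_smul, show b + (a - b) = a by ring,
        show ((b - a : ℝ) : ℂ) = -((a - b : ℝ) : ℂ) by push_cast; ring, neg_smul_neg, smul_sub]
      abel
    rw [e]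
    refine (norm_add_le _ _).trans ?_
    have h1 := (T.norm_op_le hb _).trans (hf.norm_op_sub_sub_le hh hd)
    have h2 := hh.norm_op_sub_op_le ha hb
    rw [norm_smul, Complex.norm_real, Real.norm_of_nonneg hd]
    rw [abs_sub_comm, abs_of_nonneg hd] at h2
    nlinarith

theorem tendsto_smul {f h k : Elem M} (hf : T.HasIntegralGenerator f h)
    (hh : T.HasIntegralGenerator h k) :
    Tendsto (fun t : ℝ => ((t : ℂ)⁻¹) • (f - T.op t f)) (𝓝[>] 0) (𝓝 h) := by
  rw [tendsto_iff_norm_sub_tendsto_zero]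
  have h0 : Tendsto (fun t : ℝ => ‖k‖ * t) (𝓝[>] 0) (𝓝 0) := by
    have : Tendsto (fun t : ℝ => ‖k‖ * t) (𝓝 0) (𝓝 (‖k‖ * 0)) := Continuous.tendsto (by fun_prop) 0
    simpa using this.mono_left nhdsWithin_le_nhds
  refine squeeze_zero' (Eventually.of_forall fun _ => norm_nonneg _) ?_ h0
  filter_upwards [self_mem_nhdsWithin] with t ht
  have ht : 0 < t := ht
  have htc : (t : ℂ) ≠ 0 := by exact_mod_cast ht.ne'
  have e : ((t : ℂ)⁻¹) • (f - T.op t f) - h = ((t : ℂ)⁻¹) • (f - T.op t f - (t : ℂ) • h) := by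
    rw [smul_sub _ _ ((t : ℂ) • h), smul_smul, inv_mul_cancel₀ htc, one_smul]
  rw [e, norm_smul, norm_inv, Complex.norm_real, Real.norm_of_nonneg ht.le]
  calc _ ≤ t⁻¹ * (‖k‖ * t ^ 2) := by gcongr; exact hf.norm_op_sub_sub_le hh ht.le
    _ = _ := by field_simp

theorem generator_eq {f h k : Elem M} (hf : T.HasIntegralGenerator f h)
    (hh : T.HasIntegralGenerator h k) : T.generator f = h := by
  have h1 : HasGenerator (fun t => T.op t) f h := tendsto_weakStar_of_tendsto (hf.tendsto_smul hh)
  have hex : ∃ g, HasGenerator (fun t => T.op t) f g := ⟨h, h1⟩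
  rw [generator, dif_pos hex]
  exact eq_of_tendsto_weakStar hex.choose_spec h1

theorem hasDerivWithinAt {f h k : Elem M} (hf : T.HasIntegralGenerator f h)
    (hh : T.HasIntegralGenerator h k) {a : ℝ} (ha : 0 ≤ a) :
    HasDerivWithinAt (fun a => T.op a f) (-T.op a h) (Ici 0) a := by
  rw [hasDerivWithinAt_iff_isLittleO]
  refine Asymptotics.IsBigO.trans_isLittleO (g := fun b : ℝ => (b - a) ^ 2) ?_ ?_
  · refine Asymptotics.IsBigO.of_bound (2 * ‖k‖) ?_
    filter_upwards [self_mem_nhdsWithin] with b hb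
    rw [norm_pow, Real.norm_eq_abs, sq_abs]
    exact hf.norm_op_sub_op_add_le hh ha hb
  · exact isLittleO_sub_sq a _

/-- The product rule for `u ↦ T_{L-u} y(u)`. -/
theorem hasDerivWithinAt_op_sub {L u : ℝ} (hu : u ∈ Icc 0 L) {y : ℝ → Elem M} {y' h k l : Elem M}
    (hf : T.HasIntegralGenerator (y u) h) (hh : T.HasIntegralGenerator h k)
    (hy' : T.HasIntegralGenerator y' l) (hy : HasDerivWithinAt y y' (Icc 0 L) u) :
    HasDerivWithinAt (fun u => T.op (L - u) (y u)) (T.op (L - u) (h + y')) (Icc 0 L) u := by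
  have hLu : 0 ≤ L - u := sub_nonneg.mpr hu.2
  rw [hasDerivWithinAt_iff_isLittleO] at hy ⊢
  -- Three errors of order o(w - u): the remainder of y carried by the contraction T_{L-w}, the
  -- variation of the orbit of y', and the remainder of the orbit of y(u).
  have e : ∀ w, T.op (L - w) (y w) - T.op (L - u) (y u) - (w - u) • T.op (L - u) (h + y') =
      T.op (L - w) (y w - y u - (w - u) • y') +
      ((w - u) • (T.op (L - w) y' - T.op (L - u) y') +
      (T.op (L - w) (y u) - T.op (L - u) (y u) -
        (((L - w) - (L - u) : ℝ) : ℂ) • (-T.op (L - u) h))) := by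
    intro w
    have e1 : ∀ (r : ℝ) (a : Elem M), r • a = (r : ℂ) • a := fun r a => (Complex.coe_smul r a).symm
    rw [show (((L - w) - (L - u) : ℝ) : ℂ) = -((w - u : ℝ) : ℂ) by push_cast; ring, neg_smul_neg]
    simp only [e1, map_sub, map_add, map_smul, smul_add, smul_sub]
    abel
  simp only [e]
  refine Asymptotics.IsLittleO.add ?_ (Asymptotics.IsLittleO.add ?_ ?_)
  · refine Asymptotics.IsBigO.trans_isLittleO (Asymptotics.IsBigO.of_bound 1 ?_) hy
    filter_upwards [self_mem_nhdsWithin] with w hw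
    rw [one_mul]
    exact T.norm_op_le (sub_nonneg.mpr hw.2) _
  · refine Asymptotics.IsBigO.trans_isLittleO (g := fun w : ℝ => (w - u) ^ 2)
      (Asymptotics.IsBigO.of_bound ‖l‖ ?_)
      (isLittleO_sub_sq u _)
    filter_upwards [self_mem_nhdsWithin] with w hw
    have h1 := hy'.norm_op_sub_op_le hLu (sub_nonneg.mpr hw.2)
    rw [show L - w - (L - u) = -(w - u) by ring, abs_neg] at h1
    rw [norm_smul, norm_pow, Real.norm_eq_abs, sq]
    calc _ ≤ |w - u| * (|w - u| * ‖l‖) := by gcongr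
      _ = _ := by ring
  · refine Asymptotics.IsBigO.trans_isLittleO (g := fun w : ℝ => (w - u) ^ 2)
      (Asymptotics.IsBigO.of_bound (2 * ‖k‖) ?_)
      (isLittleO_sub_sq u _)
    filter_upwards [self_mem_nhdsWithin] with w hw
    have h1 := hf.norm_op_sub_op_add_le hh hLu (sub_nonneg.mpr hw.2)
    rw [show L - w - (L - u) = -(w - u) by ring] at h1 ⊢
    rwa [norm_pow, Real.norm_eq_abs, sq_abs, ← neg_sq (w - u)]

end HasIntegralGenerator

end MarkovSemigroup

end SemigroupHolder

namespace SemigroupHolder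

variable {H : Type*} [NormedAddCommGroup H] [InnerProductSpace ℂ H] [CompleteSpace H]
  {M : VonNeumannAlgebra H} {τ : NSFTrace M}

namespace MarkovSemigroup

variable {T : MarkovSemigroup τ} {S : NonUnitalStarSubalgebra ℂ (Elem M)}

/-! ### Convexity of u ↦ T_{L-u}|T_u f|² on the test algebra -/

namespace IsTestAlgebra

theorem exists_hasIntegralGenerator (hS : T.IsTestAlgebra S) {f : Elem M} (hf : f ∈ S) :
    ∃ h ∈ S, T.HasIntegralGenerator f h := by
  obtain ⟨g, hg, hfg⟩ := hS.sqrt_generator_mem f hf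
  obtain ⟨h, hh, hgh⟩ := hS.sqrt_generator_mem g hg
  exact ⟨h, hh, T.hasIntegralGenerator_of_poisson hfg hgh⟩

/-- Invariance of S under A^{1/2} supplies one more iterate, which makes (f - T_t f)/t converge in
norm and so identifies its weak-* limit. -/
theorem generator_eq (hS : T.IsTestAlgebra S) {f h : Elem M} (hf : T.HasIntegralGenerator f h)
    (hh : h ∈ S) : T.generator f = h := by
  obtain ⟨k, _, hk⟩ := hS.exists_hasIntegralGenerator hh
  exact hf.generator_eq hk

theorem generator_mem (hS : T.IsTestAlgebra S) {f : Elem M} (hf : f ∈ S) : T.generator f ∈ S := by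
  obtain ⟨h, hh, hfh⟩ := hS.exists_hasIntegralGenerator hf
  rwa [hS.generator_eq hfh hh]

theorem hasIntegralGenerator (hS : T.IsTestAlgebra S) {f : Elem M} (hf : f ∈ S) :
    T.HasIntegralGenerator f (T.generator f) := by
  obtain ⟨h, hh, hfh⟩ := hS.exists_hasIntegralGenerator hf
  rwa [hS.generator_eq hfh hh]

theorem op_mem' (hS : T.IsTestAlgebra S) {f : Elem M} (hf : f ∈ S) {t : ℝ} (ht : 0 ≤ t) :
    T.op t f ∈ S := by
  rcases ht.eq_or_lt with rfl | ht
  · rwa [T.op_zero_apply]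
  · exact hS.op_mem t ht f hf

theorem generator_op (hS : T.IsTestAlgebra S) {f : Elem M} (hf : f ∈ S) {t : ℝ} (ht : 0 ≤ t) :
    T.generator (T.op t f) = T.op t (T.generator f) :=
  hS.generator_eq ((hS.hasIntegralGenerator hf).op ht) (hS.op_mem' (hS.generator_mem hf) ht)

theorem star_mul_mem {f g : Elem M} (hf : f ∈ S) (hg : g ∈ S) : star f * g ∈ S :=
  mul_mem (star_mem hf) hg

theorem gradientForm_one_mem (hS : T.IsTestAlgebra S) {f g : Elem M} (hf : f ∈ S) (hg : g ∈ S) :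
    T.gradientForm 1 f g ∈ S :=
  SMulMemClass.smul_mem _ (sub_mem (add_mem (star_mul_mem (hS.generator_mem hf) hg)
    (star_mul_mem hf (hS.generator_mem hg))) (hS.generator_mem (star_mul_mem hf hg)))

theorem two_smul_gradientForm_succ (T : MarkovSemigroup τ) (k : ℕ) (f g : Elem M) :
    (2 : ℂ) • T.gradientForm (k + 1) f g = T.gradientForm k (T.generator f) g +
      T.gradientForm k f (T.generator g) - T.generator (T.gradientForm k f g) := by
  change (2 : ℂ) • ((2 : ℂ)⁻¹ • _) = _
  rw [smul_smul, mul_inv_cancel₀ two_ne_zero, one_smul]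

/-- The derivative of `u ↦ T_{L-u} ((T_u f)* T_u g)`. -/
theorem hasDerivWithinAt_interpolation (hS : T.IsTestAlgebra S) {f g : Elem M} (hf : f ∈ S)
    (hg : g ∈ S) {L u : ℝ} (hu : u ∈ Icc 0 L) :
    HasDerivWithinAt (fun u => T.op (L - u) (star (T.op u f) * T.op u g))
      (-((2 : ℂ) • T.op (L - u) (T.gradientForm 1 (T.op u f) (T.op u g)))) (Icc 0 L) u := by
  have hfu := hS.op_mem' hf hu.1
  have hgu := hS.op_mem' hg hu.1
  have hAf := hS.generator_mem hf
  have hAg := hS.generator_mem hg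
  have df := ((hS.hasIntegralGenerator hf).hasDerivWithinAt (hS.hasIntegralGenerator hAf) hu.1).mono
    (s := Icc 0 L) fun _ h => h.1
  have dg := ((hS.hasIntegralGenerator hg).hasDerivWithinAt (hS.hasIntegralGenerator hAg) hu.1).mono
    (s := Icc 0 L) fun _ h => h.1
  have hy := df.star.mul dg
  have hmem : star (-T.op u (T.generator f)) * T.op u g + star (T.op u f) * -T.op u (T.generator g) ∈ S :=
    add_mem (star_mul_mem (neg_mem (hS.op_mem' hAf hu.1)) hgu)
      (star_mul_mem hfu (neg_mem (hS.op_mem' hAg hu.1)))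
  have hfg := star_mul_mem hfu hgu
  have h := HasIntegralGenerator.hasDerivWithinAt_op_sub
    (y := fun u => star (T.op u f) * T.op u g) hu (hS.hasIntegralGenerator hfg)
    (hS.hasIntegralGenerator (hS.generator_mem hfg)) (hS.hasIntegralGenerator hmem) hy
  refine h.congr_deriv ?_
  rw [← map_smul, two_smul_gradientForm_succ, hS.generator_op hf hu.1,
    hS.generator_op hg hu.1, ← map_neg (T.op (L - u))]
  congr 1
  simp only [gradientForm, star_neg]
  noncomm_ring

theorem hasDerivWithinAt_comp_interpolation (hS : T.IsTestAlgebra S) (φ : Elem M →L[ℂ] ℂ)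
    {f g : Elem M} (hf : f ∈ S) (hg : g ∈ S) {L u : ℝ} (hu : u ∈ Icc 0 L) :
    HasDerivWithinAt (fun u => φ (T.op (L - u) (star (T.op u f) * T.op u g)))
      (-(2 * φ (T.op (L - u) (T.gradientForm 1 (T.op u f) (T.op u g))))) (Icc 0 L) u := by
  have h := (φ.restrictScalars ℝ).hasFDerivAt.comp_hasDerivWithinAt u
    (hS.hasDerivWithinAt_interpolation hf hg hu)
  refine h.congr_deriv ?_
  simp

/-- The first derivative of the interpolation contains A applied to a product depending on u, and A
is unbounded. Asking that φ ∘ T_a ∘ A agree on S with ψ ∘ T_a, for a bounded ψ, makes this term an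
interpolation for ψ. The first derivative is then a combination of terms that differentiate by the
same formula, and the second is 4φ(T_{L-u} Γ²(T_u f, T_u f)). -/
theorem interpolation_inequality (hS : T.IsTestAlgebra S) (hΓ : T.GammaTwoNonneg S)
    {φ ψ : Elem M →L[ℂ] ℂ} (hpos : ∀ a : ℝ, 0 ≤ a → ∀ y : Elem M, 0 ≤ y → 0 ≤ (φ (T.op a y)).re)
    (hψ : ∀ a : ℝ, 0 ≤ a → ∀ y ∈ S, φ (T.op a (T.generator y)) = ψ (T.op a y))
    {f : Elem M} (hf : f ∈ S) {v t : ℝ} (hv : 0 < v) (ht : 0 < t) :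
    (v + t) * (φ (T.op v (star (T.op t f) * T.op t f))).re ≤
      v * (φ (T.op (v + t) (star f * f))).re +
        t * (φ (star (T.op (v + t) f) * T.op (v + t) f)).re := by
  set L := v + t with hL
  have hL0 : 0 < L := by positivity
  have hAf := hS.generator_mem hf
  set F : (Elem M →L[ℂ] ℂ) → Elem M → Elem M → ℝ → ℂ := fun φ f g u =>
    φ (T.op (L - u) (star (T.op u f) * T.op u g)) with hF
  have d1 : ∀ u ∈ Icc 0 L, HasDerivWithinAt (F φ f f)
      (F ψ f f u - F φ (T.generator f) f u - F φ f (T.generator f) u) (Icc 0 L) u := by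
    intro u hu
    have hfu := hS.op_mem' hf hu.1
    refine (hS.hasDerivWithinAt_comp_interpolation φ hf hf hu).congr_deriv ?_
    rw [← smul_eq_mul, ← map_smul, ← map_smul, two_smul_gradientForm_succ, map_sub, map_add, map_sub,
      map_add, hS.generator_op hf hu.1]
    simp only [hF, gradientForm]
    rw [← hψ _ (sub_nonneg.mpr hu.2) _ (star_mul_mem hfu hfu)]
    ring
  have d2 : ∀ u ∈ Icc 0 L, HasDerivWithinAt
      (fun u => F ψ f f u - F φ (T.generator f) f u - F φ f (T.generator f) u)
      (4 * φ (T.op (L - u) (T.gradientForm 2 (T.op u f) (T.op u f)))) (Icc 0 L) u := by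
    intro u hu
    have hfu := hS.op_mem' hf hu.1
    refine (((hS.hasDerivWithinAt_comp_interpolation ψ hf hf hu).sub
      (hS.hasDerivWithinAt_comp_interpolation φ hAf hf hu)).sub
      (hS.hasDerivWithinAt_comp_interpolation φ hf hAf hu)).congr_deriv ?_
    rw [show (4 : ℂ) = 2 * 2 by norm_num, mul_assoc, ← smul_eq_mul (2 : ℂ) (φ (T.op (L - u)
      (T.gradientForm 2 (T.op u f) (T.op u f)))), ← map_smul, ← map_smul, two_smul_gradientForm_succ,
      map_sub, map_add, map_sub, map_add, hS.generator_op hf hu.1,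
      ← hψ _ (sub_nonneg.mpr hu.2) _ (hS.gradientForm_one_mem hfu hfu)]
    ring
  have hre : ∀ {G G' : ℝ → ℂ}, (∀ u ∈ Icc 0 L, HasDerivWithinAt G (G' u) (Icc 0 L) u) →
      ∀ u ∈ Icc 0 L, HasDerivWithinAt (fun u => (G u).re) (G' u).re (Icc 0 L) u := by
    intro G G' h u hu
    exact Complex.reCLM.hasFDerivAt.comp_hasDerivWithinAt u (h u hu)
  have hconv : ConvexOn ℝ (Icc 0 L) fun u => (F φ f f u).re := by
    refine convexOn_of_hasDerivWithinAt2_nonneg (convex_Icc 0 L)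
      (fun u hu => (hre d1 u hu).continuousWithinAt)
      (fun u hu => (hre d1 u (interior_subset hu)).mono interior_subset)
      (fun u hu => (hre d2 u (interior_subset hu)).mono interior_subset) fun u hu => ?_
    have hu := interior_subset hu
    have := hpos (L - u) (sub_nonneg.mpr hu.2) _ (hΓ _ (hS.op_mem' hf hu.1))
    rw [show (4 : ℂ) = ((4 : ℝ) : ℂ) by norm_num, Complex.re_ofReal_mul]
    positivity
  -- The point t is the convex combination (v/L)·0 + (t/L)·L. The endpoint values come from T_L|f|²
  -- at u = 0 and |T_L f|² at u = L.
  have h := hconv.2 (left_mem_Icc.mpr hL0.le) (right_mem_Icc.mpr hL0.le)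
    (show 0 ≤ v / L by positivity) (show 0 ≤ t / L by positivity)
    (by rw [← add_div, div_self hL0.ne'])
  simp only [smul_eq_mul, mul_zero, zero_add, hF, div_mul_cancel₀ _ hL0.ne', sub_zero, sub_self,
    T.op_zero_apply] at h
  rw [show L - t = v by rw [hL]; ring] at h
  calc _ ≤ L * (v / L * (φ (T.op L (star f * f))).re +
        t / L * (φ (star (T.op L f) * T.op L f)).re) := by gcongr
    _ = _ := by field_simp

end IsTestAlgebra

/-! ### Time-averaged vector functionals, whose composition with A is bounded -/

variable (T) in
/-- The functional `y ↦ ε⁻¹ ∫₀^ε ⟪x, T_v y x⟫ dv`. -/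
def averageCLM (x : H) (ε : ℝ) : Elem M →L[ℂ] ℂ :=
  LinearMap.mkContinuous
    { toFun := fun y => (ε : ℂ)⁻¹ * ∫ v in (0 : ℝ)..ε, T.coeff y x x v
      map_add' := fun y z => by
        rw [← mul_add, ← intervalIntegral.integral_add
          ((T.continuous_coeff y x x).intervalIntegrable _ _)
          ((T.continuous_coeff z x x).intervalIntegrable _ _)]
        congr 2; ext v
        simp only [coeff, map_add]
        exact inner_add_right _ _ _
      map_smul' := fun c y => by
        have h : ∀ v, T.coeff (c • y) x x v = c * T.coeff y x x v := fun v => by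
          simp only [coeff, map_smul]
          exact inner_smul_right _ _ _
        simp only [h]
        rw [RingHom.id_apply, smul_eq_mul, mul_left_comm, intervalIntegral.integral_const_mul] } (|ε|⁻¹ * (|ε| * ‖x‖ ^ 2)) fun y => by
      change ‖(ε : ℂ)⁻¹ * ∫ v in (0 : ℝ)..ε, T.coeff y x x v‖ ≤ _
      rw [norm_mul, norm_inv, Complex.norm_real, Real.norm_eq_abs, mul_assoc]
      gcongr
      refine (intervalIntegral.norm_integral_le_of_norm_le_const (C := ‖y‖ * ‖x‖ * ‖x‖)
        fun v _ => T.norm_coeff_le y x x v).trans (le_of_eq ?_)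
      rw [sub_zero]; ring

theorem averageCLM_apply (x : H) (ε : ℝ) (y : Elem M) :
    T.averageCLM x ε y = (ε : ℂ)⁻¹ * ∫ v in (0 : ℝ)..ε, T.coeff y x x v := rfl

theorem tendsto_averageCLM (x : H) (y : Elem M) :
    Tendsto (fun ε => T.averageCLM x ε y) (𝓝[>] 0) (𝓝 ⟪x, (y : H →L[ℂ] H) x⟫_ℂ) := by
  have hc := T.continuous_coeff y x x
  have h : HasDerivAt (fun w => ∫ v in (0 : ℝ)..w, T.coeff y x x v) (T.coeff y x x 0) 0 :=
    intervalIntegral.integral_hasDerivAt_right (hc.intervalIntegrable _ _)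
      (hc.stronglyMeasurableAtFilter _ _) hc.continuousAt
  have h2 := (hasDerivAt_iff_tendsto_slope_zero.mp h).mono_left
    (nhdsWithin_mono 0 fun x (hx : 0 < x) => hx.ne')
  rw [T.coeff_of_nonneg y x x le_rfl, T.op_zero_apply] at h2
  refine h2.congr fun ε => ?_
  rw [zero_add, intervalIntegral.integral_same, sub_zero, averageCLM_apply, Complex.real_smul,
    Complex.ofReal_inv]

theorem averageCLM_nonneg (x : H) {ε : ℝ} (hε : 0 < ε) {a : ℝ} (ha : 0 ≤ a) {y : Elem M}
    (hy : 0 ≤ y) : 0 ≤ (T.averageCLM x ε (T.op a y)).re := by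
  rw [averageCLM_apply, ← Complex.ofReal_inv, Complex.re_ofReal_mul]
  refine mul_nonneg (by positivity) ?_
  have hc := T.continuous_coeff (T.op a y) x x
  have e : (∫ v in (0 : ℝ)..ε, T.coeff (T.op a y) x x v).re =
      ∫ v in (0 : ℝ)..ε, (T.coeff (T.op a y) x x v).re :=
    (Complex.reCLM.intervalIntegral_comp_comm (hc.intervalIntegrable _ _)).symm
  rw [e]
  refine intervalIntegral.integral_nonneg hε.le fun v hv => ?_
  rw [T.coeff_of_nonneg _ _ _ hv.1, T.op_op hv.1 ha]
  exact (Complex.le_def.mp ((T.markovian _ (add_nonneg hv.1 ha)).inner_nonneg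
    (Elem.inner_nonneg hy) x)).1

variable (T) in
/-- The functional `y ↦ ε⁻¹ ⟪x, (y - T_ε y) x⟫`. -/
def differenceCLM (x : H) (ε : ℝ) : Elem M →L[ℂ] ℂ :=
  LinearMap.mkContinuous
    -- The absolute value makes the functional bounded for every real ε, since only T_t with t ≥ 0
    -- is contractive.
    { toFun := fun y => (ε : ℂ)⁻¹ * ⟪x, ((y - T.op |ε| y : Elem M) : H →L[ℂ] H) x⟫_ℂ
      map_add' := fun y z => by
        rw [← mul_add, map_add, add_sub_add_comm]
        congr 1
        exact inner_add_right _ _ _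
      map_smul' := fun c y => by
        rw [RingHom.id_apply, smul_eq_mul, mul_left_comm, map_smul, ← smul_sub]
        congr 1
        exact inner_smul_right _ _ _ } (|ε|⁻¹ * (2 * ‖x‖ ^ 2)) fun y => by
      change ‖(ε : ℂ)⁻¹ * ⟪x, ((y - T.op |ε| y : Elem M) : H →L[ℂ] H) x⟫_ℂ‖ ≤ _
      rw [norm_mul, norm_inv, Complex.norm_real, Real.norm_eq_abs, mul_assoc]
      gcongr
      refine (Elem.norm_inner_le _ x x).trans ?_
      have h : ‖y - T.op |ε| y‖ ≤ 2 * ‖y‖ :=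
        (norm_sub_le _ _).trans (by linarith [T.norm_op_le (abs_nonneg ε) y])
      calc _ ≤ 2 * ‖y‖ * ‖x‖ * ‖x‖ := by gcongr
        _ = _ := by ring

/-- Averaging over [0, ε] integrates the generator: ∫₀^ε T_v A y dv = y - T_ε y, an expression
bounded in y. -/
theorem IsTestAlgebra.averageCLM_op_generator (hS : T.IsTestAlgebra S) (x : H) {ε : ℝ} (hε : 0 < ε)
    {a : ℝ} (ha : 0 ≤ a) {y : Elem M} (hy : y ∈ S) :
    T.averageCLM x ε (T.op a (T.generator y)) = T.differenceCLM x ε (T.op a y) := by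
  change _ = (ε : ℂ)⁻¹ * ⟪x, ((T.op a y - T.op |ε| (T.op a y) : Elem M) : H →L[ℂ] H) x⟫_ℂ
  rw [averageCLM_apply, abs_of_pos hε, ((hS.hasIntegralGenerator hy).op ha) x x ε hε.le]
  congr 1
  refine intervalIntegral.integral_congr fun v hv => ?_
  rw [uIcc_of_le hε.le] at hv
  rw [T.coeff_of_nonneg _ _ _ hv.1]

theorem IsTestAlgebra.inner_inequality_of_mem (hS : T.IsTestAlgebra S) (hΓ : T.GammaTwoNonneg S)
    {f : Elem M} (hf : f ∈ S) {v t : ℝ} (hv : 0 < v) (ht : 0 < t) (x : H) :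
    (v + t) * (⟪x, (T.op v (star (T.op t f) * T.op t f) : H →L[ℂ] H) x⟫_ℂ).re ≤
      v * (⟪x, (T.op (v + t) (star f * f) : H →L[ℂ] H) x⟫_ℂ).re +
        t * ‖(T.op (v + t) f : H →L[ℂ] H) x‖ ^ 2 := by
  have e : (⟪x, ((star (T.op (v + t) f) * T.op (v + t) f : Elem M) : H →L[ℂ] H) x⟫_ℂ).re =
      ‖(T.op (v + t) f : H →L[ℂ] H) x‖ ^ 2 := by
    rw [Elem.inner_star_mul, inner_self_eq_ofReal, Complex.ofReal_re]
  rw [← e]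
  have hlim : ∀ y : Elem M, Tendsto (fun ε => (T.averageCLM x ε y).re) (𝓝[>] 0)
      (𝓝 (⟪x, (y : H →L[ℂ] H) x⟫_ℂ).re) := fun y =>
    (Complex.continuous_re.tendsto _).comp (tendsto_averageCLM x y)
  refine le_of_tendsto_of_tendsto ((hlim _).const_mul _)
    (((hlim _).const_mul v).add ((hlim _).const_mul t)) ?_
  filter_upwards [self_mem_nhdsWithin] with ε hε
  exact hS.interpolation_inequality hΓ (fun a ha y hy => averageCLM_nonneg x hε ha hy)
    (fun a ha y hy => hS.averageCLM_op_generator x hε ha hy) hf hv ht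

end MarkovSemigroup

end SemigroupHolder

namespace SemigroupHolder

/-! ### Positive semidefinite forms -/

section Core

variable {F : Type*} [AddCommGroup F] [Module ℂ F]

/-- The seminorm of a positive semidefinite form. -/
def coreNorm (c : PreInnerProductSpace.Core ℂ F) (f : F) : ℝ := √(c.inner f f).re

theorem coreNorm_add_le (c : PreInnerProductSpace.Core ℂ F) (f g : F) :
    coreNorm c (f + g) ≤ coreNorm c f + coreNorm c g := by
  let := InnerProductSpace.Core.toSeminormedAddCommGroup (c := c)
  exact norm_add_le f g

theorem coreNorm_sub_rev (c : PreInnerProductSpace.Core ℂ F) (f g : F) :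
    coreNorm c (f - g) = coreNorm c (g - f) := by
  let := InnerProductSpace.Core.toSeminormedAddCommGroup (c := c)
  exact norm_sub_rev f g

theorem norm_inner_le_coreNorm (c : PreInnerProductSpace.Core ℂ F) (f g : F) :
    ‖c.inner f g‖ ≤ coreNorm c f * coreNorm c g :=
  InnerProductSpace.Core.norm_inner_le_norm f g

theorem coreNorm_sq (c : PreInnerProductSpace.Core ℂ F) (f : F) :
    coreNorm c f ^ 2 = (c.inner f f).re := Real.sq_sqrt (c.re_inner_nonneg f)

theorem coreNorm_nonneg (c : PreInnerProductSpace.Core ℂ F) (f : F) : 0 ≤ coreNorm c f :=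
  Real.sqrt_nonneg _

theorem abs_coreNorm_sub_le (c : PreInnerProductSpace.Core ℂ F) (f g : F) :
    |coreNorm c f - coreNorm c g| ≤ coreNorm c (f - g) := by
  have h1 := coreNorm_add_le c (f - g) g
  have h2 := coreNorm_add_le c (g - f) f
  rw [sub_add_cancel] at h1 h2
  rw [coreNorm_sub_rev] at h2
  exact abs_le.mpr ⟨by linarith, by linarith⟩

end Core

variable {H : Type*} [NormedAddCommGroup H] [InnerProductSpace ℂ H] [CompleteSpace H]
  {M : VonNeumannAlgebra H} {τ : NSFTrace M}

theorem Elem.inner_add (f g : Elem M) (ξ η : H) : ⟪ξ, ((f + g : Elem M) : H →L[ℂ] H) η⟫_ℂ =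
    ⟪ξ, (f : H →L[ℂ] H) η⟫_ℂ + ⟪ξ, (g : H →L[ℂ] H) η⟫_ℂ := inner_add_right _ _ _

theorem Elem.inner_sub (f g : Elem M) (ξ η : H) : ⟪ξ, ((f - g : Elem M) : H →L[ℂ] H) η⟫_ℂ =
    ⟪ξ, (f : H →L[ℂ] H) η⟫_ℂ - ⟪ξ, (g : H →L[ℂ] H) η⟫_ℂ := inner_sub_right _ _ _

theorem Elem.inner_smul (c : ℂ) (f : Elem M) (ξ η : H) :
    ⟪ξ, ((c • f : Elem M) : H →L[ℂ] H) η⟫_ℂ = c * ⟪ξ, (f : H →L[ℂ] H) η⟫_ℂ :=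
  inner_smul_right _ _ _

theorem IsMarkovian.conj_inner_star_mul {T : Elem M →ₗ[ℂ] Elem M} (hT : IsMarkovian τ T)
    (f g : Elem M) (x : H) :
    starRingEnd ℂ ⟪x, (T (star g * f) : H →L[ℂ] H) x⟫_ℂ =
      ⟪x, (T (star f * g) : H →L[ℂ] H) x⟫_ℂ := by
  rw [inner_conj_symm, ← Elem.inner_star, ← hT.map_star, star_mul, star_star]

/-- The form `(f, g) ↦ ⟪x, U((T f)* T g) x⟫`. -/
@[reducible]
def compositionCore {T U : Elem M →ₗ[ℂ] Elem M} (hU : IsMarkovian τ U) (x : H) :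
    PreInnerProductSpace.Core ℂ (Elem M) where
  inner f g := ⟪x, (U (star (T f) * T g) : H →L[ℂ] H) x⟫_ℂ
  conj_inner_symm f g := hU.conj_inner_star_mul _ _ x
  re_inner_nonneg f := (Complex.le_def.mp (hU.inner_star_mul_self_nonneg (T f) x)).1
  add_left f g h := by
    rw [map_add, star_add, add_mul, map_add, Elem.inner_add]
  smul_left f g c := by
    rw [map_smul, star_smul, smul_mul_assoc, map_smul, Elem.inner_smul]
    rfl

/-- The form `(f, g) ↦ ⟪x, (T(f* g) - (T f)* T g) x⟫`. -/
@[reducible]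
def schwarzCore {T : Elem M →ₗ[ℂ] Elem M} (hT : IsMarkovian τ T) (x : H) :
    PreInnerProductSpace.Core ℂ (Elem M) where
  inner f g := ⟪x, (T (star f * g) : H →L[ℂ] H) x⟫_ℂ -
    ⟪(T f : H →L[ℂ] H) x, (T g : H →L[ℂ] H) x⟫_ℂ
  conj_inner_symm f g := by
    rw [map_sub, hT.conj_inner_star_mul, inner_conj_symm]
  re_inner_nonneg f := by
    change 0 ≤ (_ - _ : ℂ).re
    rw [Complex.sub_re, inner_self_eq_ofReal, Complex.ofReal_re]
    exact sub_nonneg.mpr (hT.norm_apply_sq_le f x)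
  add_left f g h := by
    have e : (T (f + g) : H →L[ℂ] H) x = (T f : H →L[ℂ] H) x + (T g : H →L[ℂ] H) x := by
      rw [map_add]; rfl
    rw [star_add, add_mul, map_add, Elem.inner_add, e, inner_add_left]
    ring
  smul_left f g c := by
    have e : (T (c • f) : H →L[ℂ] H) x = c • (T f : H →L[ℂ] H) x := by
      rw [map_smul]; rfl
    rw [star_smul, smul_mul_assoc, map_smul, Elem.inner_smul, e, inner_smul_left, mul_sub]
    rfl

theorem schwarzCore_sq {T : Elem M →ₗ[ℂ] Elem M} (hT : IsMarkovian τ T) (x : H) (f : Elem M) :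
    coreNorm (schwarzCore hT x) f ^ 2 = (⟪x, (T (star f * f) : H →L[ℂ] H) x⟫_ℂ).re -
      ‖(T f : H →L[ℂ] H) x‖ ^ 2 := by
  rw [coreNorm_sq]
  change (_ - _ : ℂ).re = _
  rw [Complex.sub_re, inner_self_eq_ofReal, Complex.ofReal_re]

theorem IsMarkovian.re_inner_star_mul_self_le {T : Elem M →ₗ[ℂ] Elem M} (hT : IsMarkovian τ T)
    (f : Elem M) (x : H) :
    (⟪x, (T (star f * f) : H →L[ℂ] H) x⟫_ℂ).re ≤ (‖f‖ * ‖x‖) ^ 2 := by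
  calc _ ≤ ‖⟪x, (T (star f * f) : H →L[ℂ] H) x⟫_ℂ‖ := Complex.re_le_norm _
    _ ≤ ‖T (star f * f)‖ * ‖x‖ * ‖x‖ := Elem.norm_inner_le _ x x
    _ ≤ ‖star f * f‖ * ‖x‖ * ‖x‖ := by gcongr; exact hT.norm_le _
    _ = _ := by rw [CStarRing.norm_star_mul_self]; ring

theorem schwarzCore_le {T : Elem M →ₗ[ℂ] Elem M} (hT : IsMarkovian τ T) (x : H) (f : Elem M) :
    coreNorm (schwarzCore hT x) f ≤ ‖f‖ * ‖x‖ := by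
  refine abs_le_of_sq_le_sq' ?_ (by positivity) |>.2
  rw [schwarzCore_sq]
  linarith [hT.re_inner_star_mul_self_le f x, sq_nonneg ‖(T f : H →L[ℂ] H) x‖]

/-- Weak and norm closures of a subspace agree: a vector orthogonal to all g ζ with g in S defines a
normal functional vanishing on S, hence on M by weak-* density. So f ζ lies in the norm closure of
Sζ. -/
theorem exists_amplify_near {S : NonUnitalStarSubalgebra ℂ (Elem M)}
    (hS : @Dense _ (weakStar M) (S : Set (Elem M))) (ζ : lp (fun _ : ℕ => H) 2) (f : Elem M)
    {ε : ℝ} (hε : 0 < ε) : ∃ g ∈ S, ‖(f - g).amplify ζ‖ < ε := by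
  let A : Elem M →ₗ[ℂ] lp (fun _ : ℕ => H) 2 :=
    { toFun := fun g => g.amplify ζ
      map_add' := fun g h => Elem.amplify_add g h ζ
      map_smul' := fun c g => Elem.amplify_smul c g ζ }
  set V := S.toSubmodule.map A with hV
  have hmem : f.amplify ζ ∈ V.topologicalClosure := by
    rw [← Submodule.orthogonal_orthogonal_eq_closure, Submodule.mem_orthogonal]
    intro η hη
    rw [Submodule.mem_orthogonal'] at hη
    rw [← normalFunctional_eq_inner]
    have h0 : EqOn (normalFunctional M η ζ) (fun _ => 0) S := fun g hg => by
      rw [normalFunctional_eq_inner]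
      exact hη _ ⟨g, hg, rfl⟩
    exact congrFun (@Continuous.ext_on ℂ (Elem M) _ (weakStar M) _ S hS _ _
      (normalFunctional_continuous η ζ) (@continuous_const _ _ (weakStar M) _ 0) h0) f
  obtain ⟨b, hb, hlt⟩ := Metric.mem_closure_iff.mp hmem ε hε
  obtain ⟨g, hg, rfl⟩ := hb
  refine ⟨g, hg, ?_⟩
  rw [Elem.amplify_sub]
  rwa [dist_eq_norm] at hlt

/-! ### From the test algebra to all of M, and the Schwarz seminorm of P_w f -/

namespace MarkovSemigroup

variable {T : MarkovSemigroup τ}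

variable (T) in
-- The normal functional has the form ⟨gξ, gη⟩ on g*g, and |⟨a, b⟩| ≤ ‖a‖² + ‖b‖²; interleaving ξ
-- and η produces the single ζ. It provides the seminorm for approximation by S.
theorem exists_inner_op_star_mul_le {u : ℝ} (hu : 0 ≤ u) (x : H) :
    ∃ ζ : lp (fun _ : ℕ => H) 2, ∀ g : Elem M,
      (⟪x, (T.op u (star g * g) : H →L[ℂ] H) x⟫_ℂ).re ≤ ‖g.amplify ζ‖ ^ 2 := by
  obtain ⟨ξ, η, h⟩ := T.exists_inner_op_eq hu x x
  refine ⟨interleave ξ η, fun g => ?_⟩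
  have e : ∀ ζ : lp (fun _ : ℕ => H) 2, (normalFunctional M ζ ζ (star g * g)).re =
      ‖g.amplify ζ‖ ^ 2 := fun ζ => by
    rw [normalFunctional_star_mul, inner_self_eq_ofReal, Complex.ofReal_re]
  rw [h, ← e, normalFunctional_interleave, Complex.add_re, e, e, normalFunctional_star_mul]
  have h1 := (Complex.re_le_norm _).trans (norm_inner_le_norm (𝕜 := ℂ) (g.amplify ξ) (g.amplify η))
  nlinarith [sq_nonneg (‖g.amplify ξ‖ - ‖g.amplify η‖), sq_nonneg ‖g.amplify ξ‖,
    sq_nonneg ‖g.amplify η‖]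

variable (T) in
theorem re_inner_op_star_op_mul_le {v t : ℝ} (hv : 0 ≤ v) (ht : 0 ≤ t) (f : Elem M) (x : H) :
    (⟪x, (T.op v (star (T.op t f) * T.op t f) : H →L[ℂ] H) x⟫_ℂ).re ≤
      (⟪x, (T.op (v + t) (star f * f) : H →L[ℂ] H) x⟫_ℂ).re := by
  have h := (Complex.le_def.mp ((T.markovian v hv).inner_nonneg
    (f := T.op t (star f * f) - star (T.op t f) * T.op t f) (fun ξ => by
      rw [Elem.inner_sub, Elem.inner_star_mul, inner_self_eq_ofReal, sub_nonneg, Complex.le_def,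
        Complex.ofReal_re, Complex.ofReal_im]
      exact ⟨(T.markovian t ht).norm_apply_sq_le f ξ,
        (Complex.le_def.mp ((T.markovian t ht).inner_star_mul_self_nonneg f ξ)).2⟩) x)).1
  rw [map_sub, T.op_op hv ht, Elem.inner_sub, Complex.sub_re, Complex.zero_re] at h
  linarith

variable {S : NonUnitalStarSubalgebra ℂ (Elem M)}

/-- Each term is the square of a seminorm of f, and by the Kadison-Schwarz inequality all three
seminorms are at most ‖f ζ‖ for one ζ. Approximation by S in that seminorm carries the inequality
over. -/
theorem IsTestAlgebra.inner_inequality (hS : T.IsTestAlgebra S) (hΓ : T.GammaTwoNonneg S)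
    (f : Elem M) {v t : ℝ} (hv : 0 < v) (ht : 0 < t) (x : H) :
    (v + t) * (⟪x, (T.op v (star (T.op t f) * T.op t f) : H →L[ℂ] H) x⟫_ℂ).re ≤
      v * (⟪x, (T.op (v + t) (star f * f) : H →L[ℂ] H) x⟫_ℂ).re +
        t * ‖(T.op (v + t) f : H →L[ℂ] H) x‖ ^ 2 := by
  have hvt : 0 ≤ v + t := by positivity
  have hM := T.markovian (v + t) hvt
  set c₁ := compositionCore (T := T.op t) (T.markovian v hv.le) x with hc₁
  set c₃ := compositionCore (T := LinearMap.id) hM x with hc₃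
  obtain ⟨ζ, hζ⟩ := T.exists_inner_op_star_mul_le hvt x
  have hn : ∀ n : ℕ, (0 : ℝ) < 1 / (n + 1) := fun n => by positivity
  choose g hgS hg using fun n : ℕ => exists_amplify_near hS.dense ζ f (hn n)
  have b3 : ∀ n, coreNorm c₃ (f - g n) ≤ 1 / (n + 1) := fun n => by
    refine (abs_le_of_sq_le_sq' ?_ (hn n).le).2
    rw [coreNorm_sq]
    exact (hζ (f - g n)).trans (by gcongr; exact (hg n).le)
  have b1 : ∀ n, coreNorm c₁ (f - g n) ≤ 1 / (n + 1) := fun n => by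
    refine (Real.sqrt_le_sqrt ?_).trans (b3 n)
    exact T.re_inner_op_star_op_mul_le hv.le ht.le (f - g n) x
  have b2 : ∀ n, ‖(T.op (v + t) (f - g n) : H →L[ℂ] H) x‖ ≤ 1 / (n + 1) := fun n => by
    refine (abs_le_of_sq_le_sq' ?_ (hn n).le).2
    refine (hM.norm_apply_sq_le _ x).trans ((hζ (f - g n)).trans ?_)
    gcongr; exact (hg n).le
  have hlim : ∀ {p : Elem M → ℝ}, (∀ n, |p f - p (g n)| ≤ 1 / (n + 1)) →
      Tendsto (fun n => p (g n)) atTop (𝓝 (p f)) := fun {p} hp => by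
    rw [tendsto_iff_norm_sub_tendsto_zero]
    refine squeeze_zero (fun _ => norm_nonneg _) (fun n => ?_)
      tendsto_one_div_add_atTop_nhds_zero_nat
    rw [norm_sub_rev]
    exact hp n
  have l1 := hlim fun n => (abs_coreNorm_sub_le c₁ f (g n)).trans (b1 n)
  have l3 := hlim fun n => (abs_coreNorm_sub_le c₃ f (g n)).trans (b3 n)
  have l2 := hlim (p := fun f => ‖(T.op (v + t) f : H →L[ℂ] H) x‖) fun n =>
    (abs_norm_sub_norm_le _ _).trans (by
      have := b2 n
      rw [map_sub] at this
      exact this)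
  have h := le_of_tendsto_of_tendsto' ((l1.pow 2).const_mul (v + t))
    (((l3.pow 2).const_mul v).add ((l2.pow 2).const_mul t)) fun n => by
      rw [coreNorm_sq, coreNorm_sq]
      exact hS.inner_inequality_of_mem hΓ (hgS n) hv ht x
  rw [coreNorm_sq, coreNorm_sq] at h
  exact h

/-- With a = ⟨x, T_v|T_t f|² x⟩ and b = ‖(T_{v+t} f) x‖², `inner_inequality` gives (v + t)(a - b) ≤
v‖f‖²‖x‖², hence a - b ≤ (v/t)‖f‖²‖x‖². The power of t is written so as to match the moment of order
-1/2. -/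
theorem IsTestAlgebra.schwarzCore_op_le (hS : T.IsTestAlgebra S) (hΓ : T.GammaTwoNonneg S)
    (f : Elem M) {v t : ℝ} (hv : 0 < v) (ht : 0 < t) (x : H) :
    coreNorm (schwarzCore (T.markovian v hv.le) x) (T.op t f) ≤
      √v * t ^ (-(1 / 2) : ℝ) * (‖f‖ * ‖x‖) := by
  have e : √v * t ^ (-(1 / 2) : ℝ) = √(v / t) := by
    rw [Real.sqrt_div hv.le, Real.rpow_neg ht.le, ← Real.sqrt_eq_rpow]; rfl
  rw [e]
  refine (abs_le_of_sq_le_sq' ?_ (by positivity)).2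
  rw [schwarzCore_sq, T.op_op hv.le ht.le, mul_pow, Real.sq_sqrt (by positivity)]
  have h1 := hS.inner_inequality hΓ f hv ht x
  have h2 := (T.markovian (v + t) (by positivity)).re_inner_star_mul_self_le f x
  set a := (⟪x, (T.op v (star (T.op t f) * T.op t f) : H →L[ℂ] H) x⟫_ℂ).re
  set b := ‖(T.op (v + t) f : H →L[ℂ] H) x‖ ^ 2 with hb
  have hb0 : 0 ≤ b := sq_nonneg _
  rw [div_mul_eq_mul_div, le_div_iff₀ ht]
  have h3 : (v + t) * (a - b) ≤ v * (‖f‖ * ‖x‖) ^ 2 := by nlinarith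
  rcases le_total a b with hab | hab
  · have : (a - b) * t ≤ 0 := mul_nonpos_of_nonpos_of_nonneg (sub_nonpos.mpr hab) ht.le
    have : 0 ≤ v * (‖f‖ * ‖x‖) ^ 2 := by positivity
    linarith
  · nlinarith [mul_nonneg hv.le (sub_nonneg.mpr hab)]

variable (T) in
-- Normality in the second variable lets the form be taken inside the integral defining P_w.
theorem exists_schwarzCore_inner_eq {v : ℝ} (hv : 0 ≤ v) (x : H) (h : Elem M) :
    ∃ ξ η : lp (fun _ : ℕ => H) 2, ∀ g : Elem M,
      (schwarzCore (T.markovian v hv) x).inner h g = normalFunctional M ξ η g := by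
  obtain ⟨ξ, η, h1⟩ := T.exists_inner_op_eq hv x x
  obtain ⟨ξ', η', h2⟩ := T.exists_inner_op_eq hv ((T.op v h : H →L[ℂ] H) x) x
  refine ⟨interleave (h.amplify ξ) (-ξ'), interleave η η', fun g => ?_⟩
  change ⟪x, (T.op v (star h * g) : H →L[ℂ] H) x⟫_ℂ -
    ⟪(T.op v h : H →L[ℂ] H) x, (T.op v g : H →L[ℂ] H) x⟫_ℂ = _
  rw [normalFunctional_interleave, h1, h2, normalFunctional_star_mul, normalFunctional_eq_inner,
    normalFunctional_eq_inner, normalFunctional_eq_inner, inner_neg_left, sub_eq_add_neg]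

/-- Minkowski's integral inequality by duality: q² is the form at (P_w f, P_w f), the integral is
pulled out of one argument, Cauchy-Schwarz bounds the integrand by q times the seminorm of T_t f,
and one factor q is cancelled. -/
theorem IsTestAlgebra.schwarzCore_poisson_le (hS : T.IsTestAlgebra S) (hΓ : T.GammaTwoNonneg S)
    (f : Elem M) {v w : ℝ} (hv : 0 < v) (hw : 0 < w) (x : H) :
    coreNorm (schwarzCore (T.markovian v hv.le) x) (T.poisson w f) ≤
      subordinatorMoment (-(1 / 2)) * ‖x‖ * (√v / w) * ‖f‖ := by
  set c := schwarzCore (T.markovian v hv.le) x with hc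
  set q := coreNorm c (T.poisson w f) with hq
  have hm := subordinatorMoment_nonneg (p := -(1 / 2)) (by norm_num)
  have hq0 : 0 ≤ q := coreNorm_nonneg _ _
  obtain ⟨ξ, η, h⟩ := T.exists_schwarzCore_inner_eq hv.le x (T.poisson w f)
  have key : q ^ 2 ≤ q * (subordinatorMoment (-(1 / 2)) * ‖x‖ * (√v / w) * ‖f‖) := by
    calc q ^ 2 = (c.inner (T.poisson w f) (T.poisson w f)).re := coreNorm_sq _ _
      _ ≤ ‖c.inner (T.poisson w f) (T.poisson w f)‖ := Complex.re_le_norm _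
      _ = ‖∫ t in Ioi 0, (subordinator w t : ℂ) * c.inner (T.poisson w f) (T.op t f)‖ := by
          simp only [h]
          rw [T.normalFunctional_poisson hw]
      _ ≤ ∫ t in Ioi 0, subordinator w t * t ^ (-(1 / 2) : ℝ) * (q * √v * (‖f‖ * ‖x‖)) := by
          refine norm_integral_le_of_norm_le
            ((subordinator_mul_rpow_integrableOn hw (by norm_num)).mul_const _) ?_
          filter_upwards [ae_restrict_mem measurableSet_Ioi] with t ht
          have ht : 0 < t := ht
          have h0 := subordinator_nonneg hw.le ht.le
          rw [norm_mul, Complex.norm_real, Real.norm_of_nonneg h0]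
          have h1 := norm_inner_le_coreNorm c (T.poisson w f) (T.op t f)
          have h2 := hS.schwarzCore_op_le hΓ f hv ht x
          calc _ ≤ subordinator w t * (q * (√v * t ^ (-(1 / 2) : ℝ) * (‖f‖ * ‖x‖))) := by
                gcongr
                exact h1.trans (mul_le_mul_of_nonneg_left h2 hq0)
            _ = _ := by ring
      _ = _ := by
          rw [integral_mul_const, integral_subordinator_mul_rpow hw (by norm_num),
            show (2 * -(1 / 2) : ℝ) = -1 by norm_num, Real.rpow_neg_one]
          field_simp
  rcases hq0.eq_or_lt with h0 | h0
  · rw [← h0]; positivity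
  · rw [sq] at key
    exact le_of_mul_le_mul_left key h0

/-! ### Hölder functions and seminorms improved by the Poisson semigroup -/

/-- The constant in `seminorm_le_of_poisson_le`. -/
def campanatoConst (α : ℝ) : ℝ := 1 / α * (1 + 4 / (1 - 2 ^ (α - 1)))

theorem one_sub_two_rpow_pos {α : ℝ} (hα1 : α < 1) : 0 < 1 - (2 : ℝ) ^ (α - 1) :=
  sub_pos.mpr (Real.rpow_lt_one_of_one_lt_of_neg one_lt_two (by linarith))

theorem campanatoConst_nonneg {α : ℝ} (hα : 0 < α) (hα1 : α < 1) : 0 ≤ campanatoConst α := by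
  have := one_sub_two_rpow_pos hα1
  unfold campanatoConst; positivity

theorem norm_poisson_half_sub_le {α : ℝ} (hα : 0 < α) (hα1 : α < 1) {f : Elem M}
    (hf : T.holder α f ≠ ∞) {u : ℝ} (hu : 0 < u) :
    ‖T.poisson (u / 2) f - T.poisson (3 * u / 2) f‖ ≤ (T.holder α f).toReal / α * (2 * u ^ α) := by
  have hK0 : 0 ≤ (T.holder α f).toReal := ENNReal.toReal_nonneg
  rw [norm_sub_rev]
  refine (T.norm_poisson_sub_poisson_le hα hf (half_pos hu) (by linarith)).trans ?_
  have h1 : (3 * u / 2) ^ α ≤ (2 * u) ^ α := Real.rpow_le_rpow (by positivity) (by linarith) hα.le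
  have h2 : (2 * u) ^ α ≤ 2 * u ^ α := by
    rw [Real.mul_rpow two_pos.le hu.le]
    have : (2 : ℝ) ^ α ≤ 2 ^ (1 : ℝ) := Real.rpow_le_rpow_of_exponent_le one_le_two hα1.le
    rw [Real.rpow_one] at this
    gcongr
  have h3 : 0 ≤ (u / 2) ^ α := by positivity
  gcongr
  linarith

/-- Write P_u f - P_{2u} f = P_{u/2}(P_{u/2} f - P_{3u/2} f). The smoothing bound contributes 2√v/u
and the Hölder bound 2(K/α)u^α, so N of this difference is at most 4A(K/α)√v u^(α-1). Along u = 2^n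
√v this is a geometric series of ratio 2^(α-1) < 1. -/
theorem seminorm_le_of_poisson_le {α : ℝ} (hα : 0 < α) (hα1 : α < 1) {f : Elem M}
    (hf : T.holder α f ≠ ∞) {N : Elem M → ℝ} (hadd : ∀ f g, N (f + g) ≤ N f + N g) {A v : ℝ}
    (hA : 0 ≤ A) (hv : 0 < v) (hN : ∀ f, N f ≤ A * ‖f‖)
    (hP : ∀ w, 0 < w → ∀ f, N (T.poisson w f) ≤ A * (√v / w) * ‖f‖) :
    N f ≤ A * campanatoConst α * (T.holder α f).toReal * v ^ (α / 2) := by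
  set K := (T.holder α f).toReal with hK
  have hK0 : 0 ≤ K := ENNReal.toReal_nonneg
  set D := K / α with hD
  have hD0 : 0 ≤ D := by positivity
  have hsv : 0 < √v := Real.sqrt_pos.mpr hv
  set θ := (2 : ℝ) ^ (α - 1) with hθ
  have hθ1 : 0 < 1 - θ := one_sub_two_rpow_pos hα1
  -- The sum of the geometric series; it satisfies B(1 - θ) + Bθ = B, which closes the induction in
  -- `iter`.
  set B := 4 * A * D * √v / (1 - θ) with hB
  have hB0 : 0 ≤ B := by positivity
  have step : ∀ u, 0 < u → N (T.poisson u f) ≤ 4 * A * D * √v * u ^ (α - 1) +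
      N (T.poisson (2 * u) f) := by
    intro u hu
    have hu2 := half_pos hu
    have h1 : T.poisson u f = T.poisson (u / 2) (T.poisson (u / 2) f - T.poisson (3 * u / 2) f) +
        T.poisson (2 * u) f := by
      rw [T.poisson_sub hu2, T.poisson_poisson hu2 hu2, T.poisson_poisson hu2 (by positivity),
        add_halves, show u / 2 + 3 * u / 2 = 2 * u by ring, sub_add_cancel]
    have h2 := norm_poisson_half_sub_le hα hα1 hf hu
    rw [h1]
    refine (hadd _ _).trans ?_
    gcongr
    calc _ ≤ A * (√v / (u / 2)) * ‖T.poisson (u / 2) f - T.poisson (3 * u / 2) f‖ := hP _ hu2 _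
      _ ≤ A * (√v / (u / 2)) * (D * (2 * u ^ α)) := by gcongr
      _ = 4 * A * D * √v * (u ^ α / u) := by field_simp; ring
      _ = _ := by rw [Real.rpow_sub_one hu.ne']
  have iter : ∀ n : ℕ, ∀ u, 0 < u → N (T.poisson u f) ≤ B * u ^ (α - 1) +
      N (T.poisson (2 ^ n * u) f) := by
    intro n
    induction n with
    | zero =>
      intro u hu
      rw [pow_zero, one_mul]
      have : 0 ≤ B * u ^ (α - 1) := by positivity
      linarith
    | succ n ih =>
      intro u hu
      have h1 := step u hu
      have h2 := ih (2 * u) (by positivity)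
      rw [Real.mul_rpow two_pos.le hu.le, show (2 : ℝ) ^ n * (2 * u) = 2 ^ (n + 1) * u by ring] at h2
      have h3 : 4 * A * D * √v = B * (1 - θ) := by rw [hB, div_mul_cancel₀ _ hθ1.ne']
      rw [h3] at h1
      calc _ ≤ _ := h1
        _ ≤ B * (1 - θ) * u ^ (α - 1) + (B * (θ * u ^ (α - 1)) + N (T.poisson (2 ^ (n + 1) * u) f)) := by
            gcongr
        _ = _ := by ring
  -- The remainder N(P_{2^n √v} f) is at most A‖f‖ 2^(-n), so it disappears in the limit.
  have hpois : N (T.poisson (√v) f) ≤ B * √v ^ (α - 1) := by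
    have hlim : Tendsto (fun n : ℕ => B * √v ^ (α - 1) + A * ‖f‖ * (1 / 2) ^ n) atTop
        (𝓝 (B * √v ^ (α - 1) + A * ‖f‖ * 0)) :=
      ((tendsto_pow_atTop_nhds_zero_of_lt_one (by norm_num) (by norm_num)).const_mul _).const_add _
    rw [mul_zero, add_zero] at hlim
    refine ge_of_tendsto' hlim fun n => (iter n _ hsv).trans ?_
    gcongr
    refine (hP _ (by positivity) f).trans (le_of_eq ?_)
    rw [one_div, inv_pow]
    field_simp
  -- The scale √v balances the two pieces: both are of order v^(α/2).
  have hsplit : N f ≤ N (f - T.poisson (√v) f) + N (T.poisson (√v) f) := by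
    have := hadd (f - T.poisson (√v) f) (T.poisson (√v) f)
    rwa [sub_add_cancel] at this
  have e1 : √v ^ α = v ^ (α / 2) := by
    rw [Real.sqrt_eq_rpow, ← Real.rpow_mul hv.le]; congr 1; ring
  calc N f ≤ A * (D * √v ^ α) + B * √v ^ (α - 1) := by
        refine hsplit.trans (add_le_add ((hN _).trans ?_) hpois)
        gcongr
        exact T.norm_sub_poisson_le hα hf hsv
    _ = _ := by
        rw [Real.rpow_sub_one hsv.ne', hB, hD, e1, campanatoConst, ← hθ]
        field_simp

end MarkovSemigroup

end SemigroupHolder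

/-! ### The estimate of P_s|f|² - |P_s f|² and part (ii) -/

namespace SemigroupHolder

/-- Cauchy-Schwarz for the positive form ⟨ξ, Dη⟩ turns a bound on the quadratic form into a bound on
the norm with no loss of constant. -/
theorem norm_le_of_re_inner_le {H : Type*} [NormedAddCommGroup H] [InnerProductSpace ℂ H]
    [CompleteSpace H] {D : H →L[ℂ] H} {c : ℝ} (hc : 0 ≤ c) (hsymm : ∀ ξ η, ⟪D ξ, η⟫_ℂ = ⟪ξ, D η⟫_ℂ)
    (hpos : ∀ ξ, 0 ≤ (⟪ξ, D ξ⟫_ℂ).re) (hle : ∀ ξ, (⟪ξ, D ξ⟫_ℂ).re ≤ c * ‖ξ‖ ^ 2) : ‖D‖ ≤ c := by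
  let k : PreInnerProductSpace.Core ℂ H :=
    { inner := fun ξ η => ⟪ξ, D η⟫_ℂ
      conj_inner_symm := fun ξ η => by rw [inner_conj_symm, hsymm]
      re_inner_nonneg := hpos
      add_left := fun ξ η ζ => inner_add_left _ _ _
      smul_left := fun ξ η r => inner_smul_left _ _ _ }
  have hk : ∀ ξ, coreNorm k ξ ≤ √c * ‖ξ‖ := fun ξ => by
    refine Real.sqrt_le_iff.mpr ⟨by positivity, ?_⟩
    rw [mul_pow, Real.sq_sqrt hc]
    exact hle ξ
  refine opNorm_le_of_inner_le hc fun ξ η => ?_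
  calc _ ≤ coreNorm k ξ * coreNorm k η := norm_inner_le_coreNorm k ξ η
    _ ≤ (√c * ‖ξ‖) * (√c * ‖η‖) :=
        mul_le_mul (hk ξ) (hk η) (coreNorm_nonneg _ _) (by positivity)
    _ = (√c * √c) * ‖ξ‖ * ‖η‖ := by ring
    _ = _ := by rw [Real.mul_self_sqrt hc]

variable {H : Type*} [NormedAddCommGroup H] [InnerProductSpace ℂ H] [CompleteSpace H]
  {M : VonNeumannAlgebra H} {τ : NSFTrace M}

namespace MarkovSemigroup

variable {T : MarkovSemigroup τ} {S : NonUnitalStarSubalgebra ℂ (Elem M)}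

variable (T) in
theorem re_inner_op_integrableOn {s : ℝ} (hs : 0 < s) (f : Elem M) (ξ η : H) :
    IntegrableOn (fun v => subordinator s v * (⟪ξ, (T.op v f : H →L[ℂ] H) η⟫_ℂ).re) (Ioi 0) := by
  have h := (T.inner_poisson_integrableOn (subordinator_integrableOn hs) f ξ η).re
  simpa [IntegrableOn] using h

variable (T) in
theorem re_inner_poisson {s : ℝ} (hs : 0 < s) (f : Elem M) (ξ η : H) :
    (⟪ξ, (T.poisson s f : H →L[ℂ] H) η⟫_ℂ).re =
      ∫ v in Ioi (0 : ℝ), subordinator s v * (⟪ξ, (T.op v f : H →L[ℂ] H) η⟫_ℂ).re := by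
  rw [T.inner_poisson hs]
  have h := integral_re (𝕜 := ℂ)
    (T.inner_poisson_integrableOn (subordinator_integrableOn hs) f ξ η)
  simp at h
  exact h.symm

variable (T) in
theorem norm_op_sub_le {α : ℝ} (hα : 0 < α) (hα1 : α < 1) {f : Elem M} (hf : T.holder α f ≠ ∞)
    {C : ℝ} (hC : 0 ≤ C)
    (hT : ∀ {s t : ℝ}, 0 < s → 0 ≤ t → ∀ f : Elem M,
      ‖T.op t (T.poisson s f) - T.poisson s f‖ ≤ C * (t / s ^ 2) * ‖f‖) {v : ℝ} (hv : 0 < v) :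
    ‖T.op v f - f‖ ≤ (2 + C) * campanatoConst α * (T.holder α f).toReal * v ^ (α / 2) := by
  have h2 : ∀ g : Elem M, ‖T.op v g - g‖ ≤ 2 * ‖g‖ := fun g => by
    have := norm_sub_le (T.op v g) g
    have := T.norm_op_le hv.le g
    linarith
  refine seminorm_le_of_poisson_le hα hα1 hf (N := fun f => ‖T.op v f - f‖) ?_ (by positivity) hv
    ?_ ?_
  · intro f g
    rw [map_add, add_sub_add_comm]
    exact norm_add_le _ _
  · intro g
    have : 0 ≤ C * ‖g‖ := by positivity
    linarith [h2 g]
  · intro w hw g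
    have hr : 0 ≤ √v / w := by positivity
    have hr2 : v / w ^ 2 = (√v / w) ^ 2 := by rw [div_pow, Real.sq_sqrt hv.le]
    -- Only the first power of √v/w is wanted. If it is at most 1, it dominates its square v/w²;
    -- otherwise the trivial bound 2‖g‖ suffices.
    rcases le_total (√v / w) 1 with h | h
    · calc _ ≤ C * (v / w ^ 2) * ‖g‖ := hT hw hv.le g
        _ ≤ (2 + C) * (√v / w) * ‖g‖ := by
            rw [hr2]
            gcongr
            · linarith
            · nlinarith
    · calc _ ≤ 2 * ‖T.poisson w g‖ := h2 _
        _ ≤ 2 * ‖g‖ := by gcongr; exact T.norm_poisson_le hw g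
        _ ≤ (2 + C) * (√v / w) * ‖g‖ := by
            gcongr
            nlinarith

theorem IsTestAlgebra.schwarzCore_le_holder (hS : T.IsTestAlgebra S) (hΓ : T.GammaTwoNonneg S)
    {α : ℝ} (hα : 0 < α) (hα1 : α < 1) {f : Elem M} (hf : T.holder α f ≠ ∞) {v : ℝ} (hv : 0 < v)
    (x : H) : coreNorm (schwarzCore (T.markovian v hv.le) x) f ≤
      (1 + subordinatorMoment (-(1 / 2))) * ‖x‖ * campanatoConst α * (T.holder α f).toReal *
        v ^ (α / 2) := by
  have hm := subordinatorMoment_nonneg (p := -(1 / 2)) (by norm_num)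
  refine seminorm_le_of_poisson_le hα hα1 hf (coreNorm_add_le _) (by positivity) hv ?_ ?_
  · intro g
    refine (schwarzCore_le _ x g).trans ?_
    have : 0 ≤ subordinatorMoment (-(1 / 2)) * ‖x‖ * ‖g‖ := by positivity
    linarith
  · intro w hw g
    refine (hS.schwarzCore_poisson_le hΓ g hv hw x).trans ?_
    gcongr
    linarith

/-- The constant in `norm_poisson_star_mul_self_sub_le`. -/
def littleLipConst (α C : ℝ) : ℝ :=
  (((1 + subordinatorMoment (-(1 / 2))) * campanatoConst α) ^ 2 +
    2 * ((2 + C) * campanatoConst α) ^ 2) * subordinatorMoment α + 2 / α ^ 2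

theorem littleLipConst_pos {α C : ℝ} (hα : 0 < α) (hα2 : α < 1 / 2) : 0 < littleLipConst α C := by
  have := subordinatorMoment_nonneg hα2
  unfold littleLipConst; positivity

/-- Completing the square, the left side is the Schwarz form of T_v at f plus ‖(T_v f - P_s f)x‖².
The latter is split through f, and (a + b)² ≤ 2a² + 2b² accounts for the factors 2. -/
theorem IsTestAlgebra.re_inner_op_star_mul_self_le (hS : T.IsTestAlgebra S)
    (hΓ : T.GammaTwoNonneg S) {α : ℝ} (hα : 0 < α) (hα1 : α < 1) {f : Elem M}
    (hf : T.holder α f ≠ ∞) {C : ℝ} (hC : 0 ≤ C)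
    (hT : ∀ {s t : ℝ}, 0 < s → 0 ≤ t → ∀ f : Elem M,
      ‖T.op t (T.poisson s f) - T.poisson s f‖ ≤ C * (t / s ^ 2) * ‖f‖)
    {s v : ℝ} (hs : 0 < s) (hv : 0 < v) (x : H) :
    (⟪x, (T.op v (star f * f) : H →L[ℂ] H) x⟫_ℂ).re -
        2 * (⟪(T.poisson s f : H →L[ℂ] H) x, (T.op v f : H →L[ℂ] H) x⟫_ℂ).re +
        ‖(T.poisson s f : H →L[ℂ] H) x‖ ^ 2 ≤
      ((T.holder α f).toReal * ‖x‖) ^ 2 *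
        ((((1 + subordinatorMoment (-(1 / 2))) * campanatoConst α) ^ 2 +
          2 * ((2 + C) * campanatoConst α) ^ 2) * v ^ α + 2 / α ^ 2 * s ^ (2 * α)) := by
  have hm := subordinatorMoment_nonneg (p := -(1 / 2)) (by norm_num)
  have hc := campanatoConst_nonneg hα hα1
  have hK0 : 0 ≤ (T.holder α f).toReal := ENNReal.toReal_nonneg
  have h1 := hS.schwarzCore_le_holder hΓ hα hα1 hf hv x
  have h2 := T.norm_op_sub_le hα hα1 hf hC hT hv
  have h3 := T.norm_sub_poisson_le hα hf hs
  have h4 : ‖(T.op v f : H →L[ℂ] H) x - (T.poisson s f : H →L[ℂ] H) x‖ ≤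
      ((2 + C) * campanatoConst α * (T.holder α f).toReal * v ^ (α / 2) +
        (T.holder α f).toReal / α * s ^ α) * ‖x‖ := by
    have e : (T.op v f : H →L[ℂ] H) x - (T.poisson s f : H →L[ℂ] H) x =
        ((T.op v f - T.poisson s f : Elem M) : H →L[ℂ] H) x := rfl
    rw [e]
    refine (ContinuousLinearMap.le_opNorm _ x).trans ?_
    gcongr
    calc _ = ‖(T.op v f - f) + (f - T.poisson s f)‖ := by rw [sub_add_sub_cancel]; rfl
      _ ≤ _ := (norm_add_le _ _).trans (add_le_add h2 h3)
  have h5 := pow_le_pow_left₀ (coreNorm_nonneg _ _) h1 2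
  rw [schwarzCore_sq] at h5
  have h6 := pow_le_pow_left₀ (norm_nonneg _) h4 2
  have h7 := @norm_sub_sq ℂ _ _ _ _ ((T.op v f : H →L[ℂ] H) x) ((T.poisson s f : H →L[ℂ] H) x)
  have h8 : RCLike.re ⟪(T.op v f : H →L[ℂ] H) x, (T.poisson s f : H →L[ℂ] H) x⟫_ℂ =
      (⟪(T.poisson s f : H →L[ℂ] H) x, (T.op v f : H →L[ℂ] H) x⟫_ℂ).re := inner_re_symm _ _
  rw [h8] at h7
  rw [h7] at h6
  have ev : v ^ α = (v ^ (α / 2)) ^ 2 := by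
    rw [← Real.rpow_natCast, ← Real.rpow_mul hv.le]; congr 1; push_cast; ring
  have es : s ^ (2 * α) = (s ^ α) ^ 2 := by
    rw [← Real.rpow_natCast, ← Real.rpow_mul hs.le]; congr 1; push_cast; ring
  rw [ev, es]
  set K := (T.holder α f).toReal
  have h9 : (((2 + C) * campanatoConst α * K * v ^ (α / 2) + K / α * s ^ α) * ‖x‖) ^ 2 ≤
      2 * ((2 + C) * campanatoConst α * K * v ^ (α / 2) * ‖x‖) ^ 2 +
        2 * (K / α * s ^ α * ‖x‖) ^ 2 := by
    nlinarith [sq_nonneg ((2 + C) * campanatoConst α * K * v ^ (α / 2) * ‖x‖ -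
      K / α * s ^ α * ‖x‖)]
  calc _ ≤ ((1 + subordinatorMoment (-(1 / 2))) * ‖x‖ * campanatoConst α * K * v ^ (α / 2)) ^ 2 +
        (2 * ((2 + C) * campanatoConst α * K * v ^ (α / 2) * ‖x‖) ^ 2 +
        2 * (K / α * s ^ α * ‖x‖) ^ 2) := by linarith
    _ = _ := by field_simp; ring

/-- The variance identity: since φ_s has mass 1 and averages T_v f to P_s f, integrating the
expression of `re_inner_op_star_mul_self_le` against φ_s gives exactly the quadratic form of P_s|f|²
- |P_s f|². -/
theorem IsTestAlgebra.norm_poisson_star_mul_self_sub_le (hS : T.IsTestAlgebra S)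
    (hΓ : T.GammaTwoNonneg S) {α : ℝ} (hα : 0 < α) (hα2 : α < 1 / 2) {f : Elem M}
    (hf : T.holder α f ≠ ∞) {C : ℝ} (hC : 0 ≤ C)
    (hT : ∀ {s t : ℝ}, 0 < s → 0 ≤ t → ∀ f : Elem M,
      ‖T.op t (T.poisson s f) - T.poisson s f‖ ≤ C * (t / s ^ 2) * ‖f‖) {s : ℝ} (hs : 0 < s) :
    ‖T.poisson s (star f * f) - star (T.poisson s f) * T.poisson s f‖ ≤
      littleLipConst α C * ((T.holder α f).toReal * s ^ α) ^ 2 := by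
  have hΛ := (littleLipConst_pos (C := C) hα hα2).le
  set K := (T.holder α f).toReal with hK
  set D := T.poisson s (star f * f) - star (T.poisson s f) * T.poisson s f with hD
  have hstar : star D = D := by
    rw [hD, star_sub, ← T.poisson_star hs, star_mul, star_mul, star_star, star_star]
  set A := ((1 + subordinatorMoment (-(1 / 2))) * campanatoConst α) ^ 2 +
    2 * ((2 + C) * campanatoConst α) ^ 2 with hA
  have key : ∀ x : H, (⟪x, (D : H →L[ℂ] H) x⟫_ℂ).re = ∫ v in Ioi (0 : ℝ), subordinator s v *
      ((⟪x, (T.op v (star f * f) : H →L[ℂ] H) x⟫_ℂ).re -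
        2 * (⟪(T.poisson s f : H →L[ℂ] H) x, (T.op v f : H →L[ℂ] H) x⟫_ℂ).re +
        ‖(T.poisson s f : H →L[ℂ] H) x‖ ^ 2) ∧ IntegrableOn (fun v => subordinator s v *
      ((⟪x, (T.op v (star f * f) : H →L[ℂ] H) x⟫_ℂ).re -
        2 * (⟪(T.poisson s f : H →L[ℂ] H) x, (T.op v f : H →L[ℂ] H) x⟫_ℂ).re +
        ‖(T.poisson s f : H →L[ℂ] H) x‖ ^ 2)) (Ioi 0) := by
    intro x
    set p := (T.poisson s f : H →L[ℂ] H) x with hp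
    have i1 := T.re_inner_op_integrableOn hs (star f * f) x x
    have i2 := (T.re_inner_op_integrableOn hs f p x).const_mul 2
    have i3 := (subordinator_integrableOn hs).mul_const (‖p‖ ^ 2)
    have e : (fun v => subordinator s v * ((⟪x, (T.op v (star f * f) : H →L[ℂ] H) x⟫_ℂ).re -
        2 * (⟪p, (T.op v f : H →L[ℂ] H) x⟫_ℂ).re + ‖p‖ ^ 2)) = fun v =>
        subordinator s v * (⟪x, (T.op v (star f * f) : H →L[ℂ] H) x⟫_ℂ).re -
        2 * (subordinator s v * (⟪p, (T.op v f : H →L[ℂ] H) x⟫_ℂ).re) +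
        subordinator s v * ‖p‖ ^ 2 := by
      funext v; ring
    rw [e]
    refine ⟨?_, (i1.sub i2).add i3⟩
    have e2 := integral_add (i1.sub i2) i3
    simp only [Pi.sub_apply] at e2
    rw [e2, integral_sub i1 i2, integral_const_mul, integral_mul_const,
      integral_subordinator hs, ← T.re_inner_poisson hs, ← T.re_inner_poisson hs, ← hp,
      inner_self_eq_ofReal, Complex.ofReal_re, hD, Elem.inner_sub, Elem.inner_star_mul, ← hp,
      inner_self_eq_ofReal, Complex.sub_re, Complex.ofReal_re]
    ring
  refine norm_le_of_re_inner_le (D := (D : H →L[ℂ] H)) (by positivity) (fun ξ η => ?_) (fun x => ?_) fun x => ?_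
  · rw [← Elem.inner_star, hstar]
  · rw [(key x).1]
    refine setIntegral_nonneg measurableSet_Ioi fun v hv => ?_
    refine mul_nonneg (subordinator_nonneg hs.le (le_of_lt hv)) ?_
    have h1 := (T.markovian v (le_of_lt hv)).norm_apply_sq_le f x
    have h2 := @norm_sub_sq ℂ _ _ _ _ ((T.poisson s f : H →L[ℂ] H) x) ((T.op v f : H →L[ℂ] H) x)
    have h3 := sq_nonneg ‖(T.poisson s f : H →L[ℂ] H) x - (T.op v f : H →L[ℂ] H) x‖
    rw [h2] at h3
    change 0 ≤ _ - 2 * (⟪_, _⟫_ℂ).re + _ at h3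
    linarith
  · rw [(key x).1]
    -- Integrability of φ_s(v) v^α is where α < 1/2 is indispensable.
    have j1 := (subordinator_mul_rpow_integrableOn hs hα2).const_mul A
    have j2 := (subordinator_integrableOn hs).mul_const (2 / α ^ 2 * s ^ (2 * α))
    have e : (fun v => subordinator s v * ((K * ‖x‖) ^ 2 *
        (A * v ^ α + 2 / α ^ 2 * s ^ (2 * α)))) = fun v => (K * ‖x‖) ^ 2 *
        (A * (subordinator s v * v ^ α) + subordinator s v * (2 / α ^ 2 * s ^ (2 * α))) := by
      funext v; ring
    have j3 := (j1.add j2).const_mul ((K * ‖x‖) ^ 2)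
    calc _ ≤ ∫ v in Ioi (0 : ℝ), subordinator s v * ((K * ‖x‖) ^ 2 *
          (A * v ^ α + 2 / α ^ 2 * s ^ (2 * α))) := by
          refine setIntegral_mono_on (key x).2 (by rw [e]; exact j3) measurableSet_Ioi
            fun v hv => ?_
          refine mul_le_mul_of_nonneg_left ?_ (subordinator_nonneg hs.le (le_of_lt hv))
          exact hS.re_inner_op_star_mul_self_le hΓ hα (by linarith) hf hC hT hs hv x
      _ = (K * ‖x‖) ^ 2 * (A * (subordinatorMoment α * s ^ (2 * α)) +
          2 / α ^ 2 * s ^ (2 * α)) := by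
          rw [e, integral_const_mul, integral_add j1 j2, integral_const_mul, integral_mul_const,
            integral_subordinator hs, integral_subordinator_mul_rpow hs hα2, one_mul]
      _ = _ := by
          have es : s ^ (2 * α) = (s ^ α) ^ 2 := by
            rw [← Real.rpow_natCast, ← Real.rpow_mul hs.le]; congr 1; push_cast; ring
          rw [es, littleLipConst, ← hA]
          ring

theorem IsTestAlgebra.littleLipColumn_le (hS : T.IsTestAlgebra S) (hΓ : T.GammaTwoNonneg S)
    {α : ℝ} (hα : 0 < α) (hα2 : α < 1 / 2) {C : ℝ} (hC : 0 ≤ C)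
    (hT : ∀ {s t : ℝ}, 0 < s → 0 ≤ t → ∀ f : Elem M,
      ‖T.op t (T.poisson s f) - T.poisson s f‖ ≤ C * (t / s ^ 2) * ‖f‖) (f : Elem M) :
    T.littleLipColumn α f ≤ (Real.toNNReal √(littleLipConst α C) : ℝ≥0∞) * T.holder α f := by
  have hΛ := littleLipConst_pos (C := C) hα hα2
  by_cases hf : T.holder α f = ∞
  · rw [hf, ENNReal.mul_top (by simpa using hΛ)]; exact le_top
  refine iSup₂_le fun s hs => ?_
  have hK0 : 0 ≤ (T.holder α f).toReal := ENNReal.toReal_nonneg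
  have h1 := hS.norm_poisson_star_mul_self_sub_le hΓ hα hα2 hf hC hT hs
  have h3 : √‖T.poisson s (star f * f) - star (T.poisson s f) * T.poisson s f‖ ≤
      √(littleLipConst α C) * ((T.holder α f).toReal * s ^ α) := by
    refine Real.sqrt_le_iff.mpr ⟨by positivity, ?_⟩
    rwa [mul_pow, Real.sq_sqrt hΛ.le]
  have h4 : s ^ (-α) * s ^ α = 1 := by rw [← Real.rpow_add hs]; simp
  calc _ ≤ ENNReal.ofReal (√(littleLipConst α C) * (T.holder α f).toReal) := by
        refine ENNReal.ofReal_le_ofReal ?_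
        calc _ ≤ s ^ (-α) * (√(littleLipConst α C) * ((T.holder α f).toReal * s ^ α)) := by
              gcongr; exact h3
          _ = √(littleLipConst α C) * (T.holder α f).toReal * (s ^ (-α) * s ^ α) := by ring
          _ = _ := by rw [h4]; ring
    _ = _ := by
        rw [ENNReal.ofReal_mul (by positivity), ENNReal.ofReal_toReal hf]; rfl

end MarkovSemigroup

end SemigroupHolder

end

theorem mainTheorem9 :
    (∀ α : ℝ, 0 < α → α < 1 → ∃ C : ℝ≥0,
      ∀ (H : Type*) [NormedAddCommGroup H] [InnerProductSpace ℂ H] [CompleteSpace H]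
        (M : VonNeumannAlgebra H) (τ : SemigroupHolder.NSFTrace M)
        (T : SemigroupHolder.MarkovSemigroup τ) (d : SemigroupHolder.Side)
        (f : SemigroupHolder.Elem M),
        T.bigLip d α f ≤ C * T.holder α f) ∧
    (∀ α : ℝ, 0 < α → α < 1 / 2 → ∃ C : ℝ≥0,
      ∀ (H : Type*) [NormedAddCommGroup H] [InnerProductSpace ℂ H] [CompleteSpace H]
        (M : VonNeumannAlgebra H) (τ : SemigroupHolder.NSFTrace M)
        (T : SemigroupHolder.MarkovSemigroup τ)
        (S : NonUnitalStarSubalgebra ℂ (SemigroupHolder.Elem M)),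
        T.IsTestAlgebra S → T.GammaTwoNonneg S →
        ∀ (d : SemigroupHolder.Side) (f : SemigroupHolder.Elem M),
        T.littleLip d α f ≤ C * T.holder α f) := by
  refine ⟨fun α hα _ => ⟨Real.toNNReal (1 / α), fun H _ _ _ M τ T d f => ?_⟩, fun α hα hα2 => ?_⟩
  · exact SemigroupHolder.Side.version_le (T.bigLipColumn_le hα) (T.holder_star α) d f
  -- C is an absolute constant fixed before the algebra is introduced, so the final constant depends
  -- on α only.
  · obtain ⟨C, hC, hop⟩ := SemigroupHolder.MarkovSemigroup.exists_norm_op_poisson_sub_le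
    refine ⟨Real.toNNReal √(SemigroupHolder.MarkovSemigroup.littleLipConst α C),
      fun H _ _ _ M τ T S hS hΓ d f => ?_⟩
    exact SemigroupHolder.Side.version_le
      (hS.littleLipColumn_le hΓ hα hα2 hC fun hs ht f => hop H M τ T hs ht f)
      (T.holder_star α) d f
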